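/- Let $\mathbb F$ be a field of characteristic zero. All superalgebras are $\mathbb Z_2$-graded over $\mathbb F$, and homomorphisms preserve the grading. Conventions. A \emph{central extension} of a Lie superalgebra $L$ is a surjective homomorphism $\pi:\widetilde L\to L$ of Lie superalgebras whose kernel lies in the center of $\widetilde L$; it is a \emph{cover} if $\widetilde L$ is perfect ($\widetilde L=[\widetilde L,\widetilde L]$). Two perfect Lie superalgebras are \emph{centrally isogenous} if their universal central extensions are isomorphic. Let $\mathfrak g=\mathfrak{psl}(2,2)=\mathfrak{sl}(2,2)/\mathbb F\cdot 1$, let $\mathfrak h$ be the Cartan subalgebra of $\mathfrak g_{\bar 0}$ consisting of the classes of the diagonal matrices in $\mathfrak{sl}(2,2)$, and let $\Delta\subset\mathfrak h^*\setminus\{0\}$ be the root system of $\mathfrak g$ relative to $\mathfrak h$ (type A$(1,1)$). A Lie superalgebra $L$ over $\mathbb F$ is \emph{A$(1,1)$-graded} if (1) $L$ contains as a subsuperalgebra a cover $\pi:\widetilde{\mathfrak g}\to\mathfrak g$ of $\mathfrak g$; (2) $L=\bigoplus_{\alpha\in\Delta\cup\{0\}}L_\alpha$, where $L_\alpha=\{x\in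 L\mid [t,x]=\alpha(\pi(t))x \text{ for all } t\in\overline{\mathfrak h}\}$, $\overline{\mathfrak g}_{\bar 0}$ is the (unique) subalgebra of $\widetilde{\mathfrak g}_{\bar 0}$ which $\pi$ maps isomorphically onto $\mathfrak g_{\bar 0}$, and $\overline{\mathfrak h}=\{t\in\overline{\mathfrak g}_{\bar 0}\mid \pi(t)\in\mathfrak h\}$; (3) $L_0=\sum_{\alpha\in\Delta}[L_\alpha,L_{-\alpha}]$. For a Jordan superalgebra $J$, the Tits--Kantor--Koecher superalgebra is $\mathrm{TKK}(J)=J_1\oplus J_0\oplus J_{-1}$, where $J_1$ and $J_{-1}$ are copies of $J$ and $J_0=\psi(J\otimes J)\subseteq \mathrm{End}(J_1)\oplus\mathrm{End}(J_{-1})$ with, for homogeneous $x,y$, $$\psi(x\otimes y)(z)=(xy)z+x(yz)-(-1)^{|x||y|}y(xz)\ (z\in J_1),\qquad \psi(x\otimes y)(w)=-(xy)w+x(yw)-(-1)^{|x||y|}y(xw)\ (w\in J_{-1}).$$ Its (super-skew-symmetric) bracket is determined by $[J_1,J_1]=0=[J_{-1},J_{-1}]$, $[x,y]=\psi(x\otimes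 y)$ for $x\in J_1$, $y\in J_{-1}$, $[S,z]=S(z)$ for $S\in J_0$, $z\in J_{\pm1}$, and the supercommutator on $J_0$. Finally, $\mathfrak M_{1,1}(\mathbb F)^+$ is the space of $2\times2$ matrices over $\mathbb F$, with diagonal matrices even and antidiagonal matrices odd, under the product $X\cdot Y=\frac12\bigl(XY+(-1)^{|X||Y|}YX\bigr)$. \textbf{Theorem.} A Lie superalgebra $L$ over $\mathbb F$ is A$(1,1)$-graded if and only if $L$ is centrally isogenous to $\mathrm{TKK}(J)$ for some Jordan superalgebra $J$ over $\mathbb F$ which contains $\mathfrak M_{1,1}(\mathbb F)^+$ as a unital subsuperalgebra (that is, $J$ is unital and the subsuperalgebra contains its unit element). -/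

import Mathlib

/-! Superspaces, superalgebras, Lie and Jordan superalgebras over a field. -/

universe u v

noncomputable section

/-- A `ℤ/2`-graded vector space `V = V₀ ⊕ V₁`. -/
class Superspace (F V : Type*) [Field F] [AddCommGroup V] [Module F V] where
  grade : ZMod 2 → Submodule F V
  isCompl : IsCompl (grade 0) (grade 1)

/-- A (not necessarily associative) superalgebra: a superspace with an even bilinear product. -/
class Superalgebra (F A : Type*) [Field F] [AddCommGroup A] [Module F A] extends
    Superspace F A where
  op : A →ₗ[F] A →ₗ[F] A
  op_mem : ∀ {i j : ZMod 2} {x y : A}, x ∈ grade i → y ∈ grade j → op x y ∈ grade (i + j)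

/-- The homogeneous component of degree `i`. -/
abbrev sgr (F : Type*) {V : Type*} [Field F] [AddCommGroup V] [Module F V] [Superspace F V]
    (i : ZMod 2) : Submodule F V :=
  Superspace.grade i

/-- The product of a superalgebra. -/
abbrev sop (F : Type*) {A : Type*} [Field F] [AddCommGroup A] [Module F A] [Superalgebra F A] :
    A →ₗ[F] A →ₗ[F] A :=
  Superalgebra.op

/-- The Koszul sign `(-1)^{ij}`. -/
def koszul (F : Type*) [Field F] (i j : ZMod 2) : F := (-1) ^ (i.val * j.val)

section Superspace

variable {F : Type*} [Field F]

@[simp] theorem koszul_zero_left (j : ZMod 2) : koszul F 0 j = 1 := by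
  simp [koszul]

@[simp] theorem koszul_zero_right (i : ZMod 2) : koszul F i 0 = 1 := by
  simp [koszul]

@[simp] theorem koszul_one_one : koszul F 1 1 = -1 := by
  simp [koszul, ZMod.val_one]

theorem zmod2_eq (i : ZMod 2) : i = 0 ∨ i = 1 := by
  fin_cases i
  · exact Or.inl rfl
  · exact Or.inr rfl

namespace Superspace

variable (F) {V : Type*} [AddCommGroup V] [Module F V] [Superspace F V]

/-- The projection of `V = V₀ ⊕ V₁` onto its homogeneous component of degree `i`. -/
def proj (i : ZMod 2) : V →ₗ[F] V :=
  if i = 0 then (grade 0).projection (grade 1) isCompl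
  else (grade 1).projection (grade 0) isCompl.symm

theorem proj_mem (i : ZMod 2) (x : V) : proj F i x ∈ sgr F i := by
  rcases zmod2_eq i with rfl | rfl
  · simp [proj]
  · simp [proj]

theorem proj_add (x : V) : proj F 0 x + proj F 1 x = x := by
  simpa [proj] using Submodule.projection_add_projection_eq_self
    (isCompl (F := F) (V := V)) x

variable {F}

theorem proj_same {i : ZMod 2} {x : V} (hx : x ∈ sgr F i) : proj F i x = x := by
  rcases zmod2_eq i with rfl | rfl
  · simpa [proj] using Submodule.projection_apply_left (isCompl (F := F) (V := V)) ⟨x, hx⟩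
  · simpa [proj] using Submodule.projection_apply_left (isCompl (F := F) (V := V)).symm ⟨x, hx⟩

theorem proj_ne {i j : ZMod 2} {x : V} (hx : x ∈ sgr F i) (h : j ≠ i) :
    proj F j x = 0 := by
  have h1 := proj_add F x
  have h2 := proj_same hx
  rcases zmod2_eq i with rfl | rfl <;> rcases zmod2_eq j with rfl | rfl <;> simp_all

theorem mem_of_proj_eq {i : ZMod 2} {x : V} (h : proj F i x = x) : x ∈ sgr F i :=
  h ▸ proj_mem F i x

theorem eq_zero_of_mem {x : V} (h0 : x ∈ sgr F 0) (h1 : x ∈ sgr F 1) :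
    x = 0 :=
  (Submodule.disjoint_def.1 isCompl.disjoint) x h0 h1

theorem isCompl_of_decomp {W : Type*} [AddCommGroup W] [Module F W] {g0 g1 : Submodule F W}
    (hd : ∀ x ∈ g0, x ∈ g1 → x = 0) (hs : ∀ x, ∃ y ∈ g0, ∃ z ∈ g1, y + z = x) :
    IsCompl g0 g1 :=
  ⟨Submodule.disjoint_def.2 hd, codisjoint_iff.2 (Submodule.eq_top_iff'.2 fun x =>
    Submodule.mem_sup.2 (hs x))⟩

/-- For a bilinear map `f`, the map `(w, v) ↦ (-1)^{|v||w|} f(v, w)`. -/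
def flip {V W U : Type*} [AddCommGroup V] [Module F V] [Superspace F V]
    [AddCommGroup W] [Module F W] [Superspace F W] [AddCommGroup U] [Module F U]
    (f : V →ₗ[F] W →ₗ[F] U) : W →ₗ[F] V →ₗ[F] U :=
  ∑ i : ZMod 2, ∑ j : ZMod 2, koszul F i j • (f.compl₁₂ (proj F i) (proj F j)).flip

theorem sum_zmod2 {M : Type*} [AddCommMonoid M] (f : ZMod 2 → M) : ∑ i, f i = f 0 + f 1 :=
  Fin.sum_univ_two f

theorem flip_apply {V W U : Type*} [AddCommGroup V] [Module F V] [Superspace F V]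
    [AddCommGroup W] [Module F W] [Superspace F W] [AddCommGroup U] [Module F U]
    (f : V →ₗ[F] W →ₗ[F] U) {i j : ZMod 2} {v : V} {w : W}
    (hv : v ∈ sgr F i) (hw : w ∈ sgr F j) :
    flip f w v = koszul F i j • f v w := by
  have hv' := fun k (hk : k ≠ i) => proj_ne hv hk
  have hw' := fun k (hk : k ≠ j) => proj_ne hw hk
  have hv2 := proj_same hv
  have hw2 := proj_same hw
  simp only [flip, sum_zmod2]
  rcases zmod2_eq i with rfl | rfl <;> rcases zmod2_eq j with rfl | rfl <;> simp_all

end Superspace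

end Superspace



/-- Lie superalgebras; the product is the bracket `[x, y]`. -/
class IsLieSuperalgebra (F L : Type*) [Field F] [AddCommGroup L] [Module F L]
    [Superalgebra F L] : Prop where
  skew : ∀ {i j : ZMod 2} {x y : L}, x ∈ sgr F i → y ∈ sgr F j →
    sop F x y = -(koszul F i j • sop F y x)
  jacobi : ∀ {i j k : ZMod 2} {x y z : L}, x ∈ sgr F i → y ∈ sgr F j → z ∈ sgr F k →
    sop F x (sop F y z) = sop F (sop F x y) z + koszul F i j • sop F y (sop F x z)

/-- The associator `(x, y, z) = (xy)z - x(yz)`. -/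
def sassoc (F : Type*) {A : Type*} [Field F] [AddCommGroup A] [Module F A] [Superalgebra F A]
    (x y z : A) : A :=
  sop F (sop F x y) z - sop F x (sop F y z)

/-- Jordan superalgebras (characteristic different from `2` and `3`): supercommutative
superalgebras satisfying the super version of the linearized Jordan identity
`(xy, z, w) + (yw, z, x) + (wx, z, y) = 0`. -/
class IsJordanSuperalgebra (F J : Type*) [Field F] [AddCommGroup J] [Module F J]
    [Superalgebra F J] : Prop where
  comm : ∀ {i j : ZMod 2} {x y : J}, x ∈ sgr F i → y ∈ sgr F j →
    sop F x y = koszul F i j • sop F y x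
  jordan : ∀ {i j k l : ZMod 2} {x y z w : J},
    x ∈ sgr F i → y ∈ sgr F j → z ∈ sgr F k → w ∈ sgr F l →
    sassoc F (sop F x y) z w
      + (koszul F i (j + k + l) * koszul F k l) • sassoc F (sop F y w) z x
      + (koszul F l (i + j + k) * koszul F j k) • sassoc F (sop F w x) z y = 0

/-- Homomorphisms of superalgebras: linear maps preserving the product and the degree. -/
structure SuperHom (F A B : Type*) [Field F] [AddCommGroup A] [Module F A] [Superalgebra F A]
    [AddCommGroup B] [Module F B] [Superalgebra F B] extends A →ₗ[F] B where
  map_grade : ∀ {i : ZMod 2} {x : A}, x ∈ sgr F i → toLinearMap x ∈ sgr F i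
  map_op : ∀ x y : A, toLinearMap (sop F x y) = sop F (toLinearMap x) (toLinearMap y)

instance (F A B : Type*) [Field F] [AddCommGroup A] [Module F A] [Superalgebra F A]
    [AddCommGroup B] [Module F B] [Superalgebra F B] : CoeFun (SuperHom F A B) fun _ => A → B :=
  ⟨fun f => f.toLinearMap⟩

/-! ### Subsuperalgebras and quotients -/

/-- A subsuperalgebra: a graded subspace closed under the product. -/
structure Subsuperalgebra (F A : Type*) [Field F] [AddCommGroup A] [Module F A]
    [Superalgebra F A] where
  carrier : Submodule F A
  proj_mem : ∀ (i : ZMod 2) {x : A}, x ∈ carrier → Superspace.proj F i x ∈ carrier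
  op_mem : ∀ {x y : A}, x ∈ carrier → y ∈ carrier → sop F x y ∈ carrier

instance (F A : Type*) [Field F] [AddCommGroup A] [Module F A] [Superalgebra F A]
    (S : Subsuperalgebra F A) : Superalgebra F S.carrier where
  grade i := (sgr F i).comap S.carrier.subtype
  isCompl := by
    refine Superspace.isCompl_of_decomp (fun x h0 h1 => ?_) fun x => ?_
    · exact Subtype.ext (Superspace.eq_zero_of_mem (F := F) h0 h1)
    · exact ⟨⟨_, S.proj_mem 0 x.2⟩, Superspace.proj_mem F 0 _, ⟨_, S.proj_mem 1 x.2⟩,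
        Superspace.proj_mem F 1 _, Subtype.ext (Superspace.proj_add F _)⟩
  op := LinearMap.mk₂ F (fun x y => ⟨sop F x.1 y.1, S.op_mem x.2 y.2⟩)
    (fun x y z => Subtype.ext (by simp)) (fun c x y => Subtype.ext (by simp))
    (fun x y z => Subtype.ext (by simp)) (fun c x y => Subtype.ext (by simp))
  op_mem hx hy := Superalgebra.op_mem (F := F) (A := A) hx hy

/-- A two-sided graded ideal. -/
structure SuperIdeal (F A : Type*) [Field F] [AddCommGroup A] [Module F A]
    [Superalgebra F A] where
  carrier : Submodule F A
  proj_mem : ∀ (i : ZMod 2) {x : A}, x ∈ carrier → Superspace.proj F i x ∈ carrier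
  op_mem_left : ∀ {x y : A}, x ∈ carrier → sop F x y ∈ carrier
  op_mem_right : ∀ {x y : A}, y ∈ carrier → sop F x y ∈ carrier

instance (F A : Type*) [Field F] [AddCommGroup A] [Module F A] [Superalgebra F A]
    (I : SuperIdeal F A) : Superalgebra F (A ⧸ I.carrier) where
  grade i := (sgr F i).map I.carrier.mkQ
  isCompl := by
    refine Superspace.isCompl_of_decomp ?_ fun x => ?_
    · rintro _ ⟨x, hx, rfl⟩ ⟨y, hy, hxy⟩
      have h : x - y ∈ I.carrier := (Submodule.Quotient.eq I.carrier).1 hxy.symm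
      have h2 := I.proj_mem 0 h
      rw [map_sub, Superspace.proj_same hx, Superspace.proj_ne hy (by decide), sub_zero] at h2
      exact (Submodule.Quotient.mk_eq_zero _).2 h2
    · obtain ⟨x, rfl⟩ := I.carrier.mkQ_surjective x
      exact ⟨_, ⟨_, Superspace.proj_mem F 0 x, rfl⟩, _, ⟨_, Superspace.proj_mem F 1 x, rfl⟩, by
        rw [← map_add, Superspace.proj_add]⟩
  op := I.carrier.liftQ
    ((I.carrier.mapQLinear I.carrier).comp ((sop F).codRestrict
      (I.carrier.compatibleMaps I.carrier) fun _ _ hy => I.op_mem_right hy))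
    (by
      intro x hx
      rw [LinearMap.mem_ker]
      ext y
      exact (Submodule.Quotient.mk_eq_zero _).2 (I.op_mem_left hx))
  op_mem := by
    rintro i j _ _ ⟨x, hx, rfl⟩ ⟨y, hy, rfl⟩
    exact ⟨_, Superalgebra.op_mem (F := F) hx hy, rfl⟩

theorem quot_op_mk {F A : Type*} [Field F] [AddCommGroup A] [Module F A] [Superalgebra F A]
    (I : SuperIdeal F A) (x y : A) :
    sop F (I.carrier.mkQ x) (I.carrier.mkQ y) = I.carrier.mkQ (sop F x y) := rfl

/-! ### Associative superalgebras: supercommutator and symmetrized product -/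

section Assoc

variable (F : Type*) {A : Type*} [Field F] [Ring A] [Algebra F A] [Superspace F A]

/-- The supercommutator `[X, Y] = XY - (-1)^{|X||Y|} YX`. -/
def superComm : A →ₗ[F] A →ₗ[F] A :=
  LinearMap.mul F A - Superspace.flip (LinearMap.mul F A)

/-- The supersymmetrized product `X · Y = (XY + (-1)^{|X||Y|} YX) / 2`. -/
def superSymm : A →ₗ[F] A →ₗ[F] A :=
  (2⁻¹ : F) • (LinearMap.mul F A + Superspace.flip (LinearMap.mul F A))

variable {F}

theorem superComm_apply {i j : ZMod 2} {x y : A} (hx : x ∈ sgr F i) (hy : y ∈ sgr F j) :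
    superComm F x y = x * y - koszul F i j • (y * x) := by
  have hk : koszul F j i = koszul F i j := by simp [koszul, mul_comm]
  simp [superComm, Superspace.flip_apply _ hy hx, hk]

theorem superSymm_apply {i j : ZMod 2} {x y : A} (hx : x ∈ sgr F i) (hy : y ∈ sgr F j) :
    superSymm F x y = (2⁻¹ : F) • (x * y + koszul F i j • (y * x)) := by
  have hk : koszul F j i = koszul F i j := by simp [koszul, mul_comm]
  simp [superSymm, Superspace.flip_apply _ hy hx, hk]

theorem superComm_skew {i j : ZMod 2} {x y : A} (hx : x ∈ sgr F i) (hy : y ∈ sgr F j) :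
    superComm F x y = -(koszul F i j • superComm F y x) := by
  rw [superComm_apply hx hy, superComm_apply hy hx]
  rcases zmod2_eq i with rfl | rfl <;> rcases zmod2_eq j with rfl | rfl <;> simp

theorem superComm_mem
    (hm : ∀ {i j : ZMod 2} {x y : A}, x ∈ sgr F i → y ∈ sgr F j → x * y ∈ sgr F (i + j))
    {i j : ZMod 2} {x y : A} (hx : x ∈ sgr F i) (hy : y ∈ sgr F j) :
    superComm F x y ∈ sgr F (i + j) := by
  rw [superComm_apply hx hy]
  exact Submodule.sub_mem _ (hm hx hy) (Submodule.smul_mem _ _ (add_comm j i ▸ hm hy hx))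

theorem superSymm_mem
    (hm : ∀ {i j : ZMod 2} {x y : A}, x ∈ sgr F i → y ∈ sgr F j → x * y ∈ sgr F (i + j))
    {i j : ZMod 2} {x y : A} (hx : x ∈ sgr F i) (hy : y ∈ sgr F j) :
    superSymm F x y ∈ sgr F (i + j) := by
  rw [superSymm_apply hx hy]
  exact Submodule.smul_mem _ _
    (Submodule.add_mem _ (hm hx hy) (Submodule.smul_mem _ _ (add_comm j i ▸ hm hy hx)))

theorem superComm_jacobi
    (hm : ∀ {i j : ZMod 2} {x y : A}, x ∈ sgr F i → y ∈ sgr F j → x * y ∈ sgr F (i + j))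
    {i j k : ZMod 2} {x y z : A} (hx : x ∈ sgr F i) (hy : y ∈ sgr F j) (hz : z ∈ sgr F k) :
    superComm F x (superComm F y z) =
      superComm F (superComm F x y) z + koszul F i j • superComm F y (superComm F x z) := by
  rw [superComm_apply hx (superComm_mem hm hy hz), superComm_apply hy (superComm_mem hm hx hz),
    superComm_apply (superComm_mem hm hx hy) hz, superComm_apply hx hy, superComm_apply hx hz,
    superComm_apply hy hz]
  rcases zmod2_eq i with rfl | rfl <;> rcases zmod2_eq j with rfl | rfl <;>
  rcases zmod2_eq k with rfl | rfl <;>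
  simp [show (1 + 1 : ZMod 2) = 0 from rfl, mul_sub, sub_mul, mul_add, add_mul, mul_assoc] <;>
  abel

end Assoc

/-! ### Matrix superalgebras -/

/-- The parity of a row or column index: `1, …, m` are even, the barred indices are odd. -/
def parity {m n : ℕ} : Fin m ⊕ Fin n → ZMod 2 := Sum.elim (fun _ => 0) fun _ => 1

section MatrixSuper

variable {F : Type*} [Field F] {m n : ℕ}

/-- `M_{m,n}(F)`, graded so that block diagonal matrices are even and block antidiagonal ones
odd. -/
instance : Superspace F (Matrix (Fin m ⊕ Fin n) (Fin m ⊕ Fin n) F) where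
  grade i :=
    { carrier := {X | ∀ r s, parity r + parity s ≠ i → X r s = 0}
      zero_mem' := fun _ _ _ => rfl
      add_mem' := fun hx hy r s h => by simp [hx r s h, hy r s h]
      smul_mem' := fun c x hx r s h => by simp [hx r s h] }
  isCompl := by
    refine Superspace.isCompl_of_decomp (fun x h0 h1 => ?_) fun x => ?_
    · ext r s
      rcases zmod2_eq (parity r + parity s) with h | h
      · exact h1 r s (by simp [h])
      · exact h0 r s (by simp [h])
    · refine ⟨Matrix.of fun r s => if parity r + parity s = 0 then x r s else 0, ?_,
        Matrix.of fun r s => if parity r + parity s = 0 then 0 else x r s, ?_, ?_⟩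
      · intro r s h
        simp [h]
      · intro r s h
        rcases zmod2_eq (parity r + parity s) with h' | h'
        · simp [h']
        · exact absurd h' h
      · ext r s
        simp only [Matrix.add_apply, Matrix.of_apply]
        split_ifs <;> simp

theorem matrix_mem_grade {i : ZMod 2} {X : Matrix (Fin m ⊕ Fin n) (Fin m ⊕ Fin n) F} :
    X ∈ sgr F i ↔ ∀ r s, parity r + parity s ≠ i → X r s = 0 := Iff.rfl

theorem matrix_mul_mem {i j : ZMod 2} {X Y : Matrix (Fin m ⊕ Fin n) (Fin m ⊕ Fin n) F}
    (hX : X ∈ sgr F i) (hY : Y ∈ sgr F j) : X * Y ∈ sgr F (i + j) := by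
  intro r s h
  rw [Matrix.mul_apply]
  refine Finset.sum_eq_zero fun t _ => ?_
  by_cases h1 : parity r + parity t = i
  · by_cases h2 : parity t + parity s = j
    · refine absurd ?_ h
      rw [← h1, ← h2]
      generalize parity r = a
      generalize parity s = b
      generalize parity t = c
      revert a b c
      decide
    · rw [hY t s h2, mul_zero]
  · rw [hX r t h1, zero_mul]

variable (F m n)

/-- The Lie superalgebra `gl(m, n)`. -/
def GLSuper : Type _ := Matrix (Fin m ⊕ Fin n) (Fin m ⊕ Fin n) F

instance : AddCommGroup (GLSuper F m n) :=
  inferInstanceAs (AddCommGroup (Matrix (Fin m ⊕ Fin n) (Fin m ⊕ Fin n) F))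

instance : Module F (GLSuper F m n) :=
  inferInstanceAs (Module F (Matrix (Fin m ⊕ Fin n) (Fin m ⊕ Fin n) F))

instance : Superalgebra F (GLSuper F m n) where
  toSuperspace := inferInstanceAs (Superspace F (Matrix (Fin m ⊕ Fin n) (Fin m ⊕ Fin n) F))
  op := superComm F (A := Matrix (Fin m ⊕ Fin n) (Fin m ⊕ Fin n) F)
  op_mem := superComm_mem (A := Matrix (Fin m ⊕ Fin n) (Fin m ⊕ Fin n) F) matrix_mul_mem

/-- The Jordan superalgebra `M_{m,n}(F)⁺`. -/
def MPlus : Type _ := Matrix (Fin m ⊕ Fin n) (Fin m ⊕ Fin n) F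

instance : AddCommGroup (MPlus F m n) :=
  inferInstanceAs (AddCommGroup (Matrix (Fin m ⊕ Fin n) (Fin m ⊕ Fin n) F))

instance : Module F (MPlus F m n) :=
  inferInstanceAs (Module F (Matrix (Fin m ⊕ Fin n) (Fin m ⊕ Fin n) F))

instance : One (MPlus F m n) :=
  inferInstanceAs (One (Matrix (Fin m ⊕ Fin n) (Fin m ⊕ Fin n) F))

instance : Superalgebra F (MPlus F m n) where
  toSuperspace := inferInstanceAs (Superspace F (Matrix (Fin m ⊕ Fin n) (Fin m ⊕ Fin n) F))
  op := superSymm F (A := Matrix (Fin m ⊕ Fin n) (Fin m ⊕ Fin n) F)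
  op_mem := superSymm_mem (A := Matrix (Fin m ⊕ Fin n) (Fin m ⊕ Fin n) F) matrix_mul_mem

/-- The supertrace `str X = tr X₁₁ - tr X₂₂`. -/
def supertrace : Matrix (Fin m ⊕ Fin n) (Fin m ⊕ Fin n) F →ₗ[F] F where
  toFun X := X.toBlocks₁₁.trace - X.toBlocks₂₂.trace
  map_add' X Y := by
    simp [Matrix.trace, Matrix.toBlocks₁₁, Matrix.toBlocks₂₂, Finset.sum_add_distrib]
    ring
  map_smul' c X := by
    simp [Matrix.trace, Matrix.toBlocks₁₁, Matrix.toBlocks₂₂, Finset.mul_sum, mul_sub]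

variable {F m n}

theorem supertrace_eq (X : Matrix (Fin m ⊕ Fin n) (Fin m ⊕ Fin n) F) :
    supertrace F m n X = ∑ r, koszul F (parity r) (parity r) * X r r := by
  simp [supertrace, Matrix.trace, Matrix.toBlocks₁₁, Matrix.toBlocks₂₂, parity, sub_eq_add_neg]

theorem supertrace_odd {X : Matrix (Fin m ⊕ Fin n) (Fin m ⊕ Fin n) F} (hX : X ∈ sgr F 1) :
    supertrace F m n X = 0 := by
  rw [supertrace_eq]
  refine Finset.sum_eq_zero fun r _ => ?_
  rw [hX r r, mul_zero]
  generalize parity r = a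
  revert a
  decide

theorem supertrace_mul {i j : ZMod 2} {X Y : Matrix (Fin m ⊕ Fin n) (Fin m ⊕ Fin n) F}
    (hX : X ∈ sgr F i) (hY : Y ∈ sgr F j) :
    supertrace F m n (X * Y) = koszul F i j * supertrace F m n (Y * X) := by
  simp only [supertrace_eq, Matrix.mul_apply, Finset.mul_sum]
  rw [Finset.sum_comm]
  refine Finset.sum_congr rfl fun r _ => Finset.sum_congr rfl fun s _ => ?_
  by_cases h1 : parity s + parity r = i
  · by_cases h2 : parity r + parity s = j
    · have hk : koszul F (parity s) (parity s) =
          koszul F i j * koszul F (parity r) (parity r) := by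
        rw [← h1, ← h2]
        rcases zmod2_eq (parity r) with h | h <;> rcases zmod2_eq (parity s) with h' | h' <;>
          simp [h, h', show (1 + 1 : ZMod 2) = 0 from rfl]
      rw [hk]
      ring
    · rw [hY r s h2]
      ring
  · rw [hX s r h1]
    ring

theorem supertrace_superComm (X Y : Matrix (Fin m ⊕ Fin n) (Fin m ⊕ Fin n) F) :
    supertrace F m n (superComm F X Y) = 0 := by
  have h : ∀ i j : ZMod 2, supertrace F m n
      (superComm F (Superspace.proj F i X) (Superspace.proj F j Y)) = 0 := by
    intro i j
    have hi := Superspace.proj_mem F i X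
    have hj := Superspace.proj_mem F j Y
    rw [superComm_apply hi hj, map_sub, map_smul, supertrace_mul hi hj, smul_eq_mul, sub_self]
  rw [← Superspace.proj_add F X, ← Superspace.proj_add F Y]
  simp [h]

theorem one_mem_grade : (1 : Matrix (Fin m ⊕ Fin n) (Fin m ⊕ Fin n) F) ∈ sgr F 0 := by
  intro r s h
  refine Matrix.one_apply_ne ?_
  rintro rfl
  refine h ?_
  generalize parity r = a
  revert a
  decide

theorem supertrace_proj {X : Matrix (Fin m ⊕ Fin n) (Fin m ⊕ Fin n) F}
    (hX : supertrace F m n X = 0) (i : ZMod 2) :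
    supertrace F m n (Superspace.proj F i X) = 0 := by
  have h1 := supertrace_odd (Superspace.proj_mem F 1 X)
  rcases zmod2_eq i with rfl | rfl
  · have h := congrArg (supertrace F m n) (Superspace.proj_add F X)
    rw [map_add, h1, add_zero] at h
    exact h.trans hX
  · exact h1

theorem superComm_scalar_left (c : F) (X : Matrix (Fin m ⊕ Fin n) (Fin m ⊕ Fin n) F) :
    superComm F (c • 1) X = 0 := by
  rw [map_smul, LinearMap.smul_apply, ← Superspace.proj_add F X, map_add,
    superComm_apply one_mem_grade (Superspace.proj_mem F 0 X),
    superComm_apply one_mem_grade (Superspace.proj_mem F 1 X)]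
  simp

theorem superComm_scalar_right (c : F) (X : Matrix (Fin m ⊕ Fin n) (Fin m ⊕ Fin n) F) :
    superComm F X (c • 1) = 0 := by
  rw [map_smul, ← Superspace.proj_add F X, map_add, LinearMap.add_apply, superComm_apply
    (Superspace.proj_mem F 0 X) one_mem_grade, superComm_apply (Superspace.proj_mem F 1 X)
    one_mem_grade]
  simp

variable (F m n)

/-- `sl(m, n)`, the matrices of supertrace zero. -/
def slSuper : Subsuperalgebra F (GLSuper F m n) where
  carrier := LinearMap.ker (supertrace F m n)
  proj_mem i _ hX := supertrace_proj hX i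
  op_mem _ _ := supertrace_superComm _ _

/-- The scalar matrices in `sl(n, n)`. -/
def slScalars : SuperIdeal F (slSuper F n n).carrier where
  carrier := (Submodule.span F {(1 : Matrix (Fin n ⊕ Fin n) (Fin n ⊕ Fin n) F)}).comap
    (slSuper F n n).carrier.subtype
  proj_mem i X hX := by
    obtain ⟨c, hc⟩ := Submodule.mem_span_singleton.1 hX
    have h0 : X ∈ sgr F 0 := by
      have : c • (1 : Matrix (Fin n ⊕ Fin n) (Fin n ⊕ Fin n) F) ∈ sgr F 0 :=
        Submodule.smul_mem _ _ one_mem_grade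
      exact (hc ▸ this :)
    rcases zmod2_eq i with rfl | rfl
    · rw [Superspace.proj_same h0]
      exact hX
    · rw [Superspace.proj_ne h0 (by decide)]
      exact Submodule.zero_mem _
  op_mem_left {X Y} hX := by
    obtain ⟨c, hc⟩ := Submodule.mem_span_singleton.1 hX
    obtain ⟨X, hX'⟩ := X
    change _ = X at hc
    subst hc
    have h : sop F ⟨_, hX'⟩ Y = 0 := Subtype.ext (superComm_scalar_left c _)
    rw [h]
    exact Submodule.zero_mem _
  op_mem_right {X Y} hY := by
    obtain ⟨c, hc⟩ := Submodule.mem_span_singleton.1 hY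
    obtain ⟨Y, hY'⟩ := Y
    change _ = Y at hc
    subst hc
    have h : sop F X ⟨_, hY'⟩ = 0 := Subtype.ext (superComm_scalar_right c _)
    rw [h]
    exact Submodule.zero_mem _

/-- `psl(n, n) = sl(n, n) / F · 1`. -/
abbrev PSLSuper : Type _ := (slSuper F n n).carrier ⧸ (slScalars F n).carrier

/-- The Cartan subalgebra of `psl(n, n)`: classes of the diagonal matrices in `sl(n, n)`. -/
def pslCartan : Submodule F (PSLSuper F n) :=
  Submodule.map (slScalars F n).carrier.mkQ
    { carrier := {X | Matrix.IsDiag (X.1 : Matrix (Fin n ⊕ Fin n) (Fin n ⊕ Fin n) F)}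
      zero_mem' := Matrix.isDiag_zero
      add_mem' := fun hX hY => Matrix.IsDiag.add hX hY
      smul_mem' := fun c _ hX => Matrix.IsDiag.smul c hX }

end MatrixSuper

/-! ### The Tits–Kantor–Koecher construction -/

section EndSuper

variable {F : Type*} [Field F]

/-- `End V`, where `T` has degree `i` if `T V_j ⊆ V_{i+j}`. -/
instance {V : Type*} [AddCommGroup V] [Module F V] [Superspace F V] :
    Superspace F (Module.End F V) where
  grade i :=
    { carrier := {T | ∀ (j : ZMod 2) (x : V), x ∈ sgr F j → T x ∈ sgr F (i + j)}
      zero_mem' := fun _ _ _ => Submodule.zero_mem _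
      add_mem' := fun hS hT j x hx => Submodule.add_mem _ (hS j x hx) (hT j x hx)
      smul_mem' := fun c _ hT j x hx => Submodule.smul_mem _ c (hT j x hx) }
  isCompl := by
    refine Superspace.isCompl_of_decomp (fun T h0 h1 => ?_) fun T => ?_
    · have key : ∀ (j : ZMod 2) (x : V), x ∈ sgr F j → T x = 0 := by
        intro j x hx
        have a0 := h0 j x hx
        have a1 := h1 j x hx
        rcases zmod2_eq j with rfl | rfl
        · exact Superspace.eq_zero_of_mem a0 a1
        · exact Superspace.eq_zero_of_mem a1 a0
      ext x
      rw [← Superspace.proj_add F x, map_add, key 0 _ (Superspace.proj_mem F 0 x),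
        key 1 _ (Superspace.proj_mem F 1 x)]
      simp
    · refine ⟨Superspace.proj F 0 ∘ₗ T ∘ₗ Superspace.proj F 0
          + Superspace.proj F 1 ∘ₗ T ∘ₗ Superspace.proj F 1, ?_,
        Superspace.proj F 1 ∘ₗ T ∘ₗ Superspace.proj F 0
          + Superspace.proj F 0 ∘ₗ T ∘ₗ Superspace.proj F 1, ?_, ?_⟩
      · intro j x hx
        have hp := Superspace.proj_same hx
        rcases zmod2_eq j with rfl | rfl
        · simpa [Superspace.proj_ne hx (show (1 : ZMod 2) ≠ 0 by decide)] using
            Superspace.proj_mem F 0 _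
        · simpa [Superspace.proj_ne hx (show (0 : ZMod 2) ≠ 1 by decide)] using
            Superspace.proj_mem F 1 _
      · intro j x hx
        rcases zmod2_eq j with rfl | rfl
        · simpa [Superspace.proj_ne hx (show (1 : ZMod 2) ≠ 0 by decide)] using
            Superspace.proj_mem F 1 _
        · simpa [Superspace.proj_ne hx (show (0 : ZMod 2) ≠ 1 by decide),
            show (1 + 1 : ZMod 2) = 0 from rfl] using Superspace.proj_mem F 0 _
      · ext x
        have h0 := Superspace.proj_add F (T (Superspace.proj F 0 x))
        have h1 := Superspace.proj_add F (T (Superspace.proj F 1 x))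
        have h := congrArg T (Superspace.proj_add F x)
        rw [map_add, ← h0, ← h1] at h
        rw [← h]
        simp only [LinearMap.add_apply, LinearMap.comp_apply]
        abel

instance {V W : Type*} [AddCommGroup V] [Module F V] [Superspace F V]
    [AddCommGroup W] [Module F W] [Superspace F W] : Superspace F (V × W) where
  grade i := (sgr F i).prod (sgr F i)
  isCompl := by
    refine Superspace.isCompl_of_decomp (fun x h0 h1 => ?_) fun x => ?_
    · exact Prod.ext (Superspace.eq_zero_of_mem (F := F) h0.1 h1.1)
        (Superspace.eq_zero_of_mem (F := F) h0.2 h1.2)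
    · exact ⟨(Superspace.proj F 0 x.1, Superspace.proj F 0 x.2),
        ⟨Superspace.proj_mem F 0 _, Superspace.proj_mem F 0 _⟩,
        (Superspace.proj F 1 x.1, Superspace.proj F 1 x.2),
        ⟨Superspace.proj_mem F 1 _, Superspace.proj_mem F 1 _⟩,
        Prod.ext (Superspace.proj_add F _) (Superspace.proj_add F _)⟩

theorem end_mul_mem {V : Type*} [AddCommGroup V] [Module F V] [Superspace F V] {i j : ZMod 2}
    {S T : Module.End F V} (hS : S ∈ sgr F i) (hT : T ∈ sgr F j) : S * T ∈ sgr F (i + j) := by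
  intro k x hx
  have h := hS _ _ (hT k x hx)
  rw [← add_assoc] at h
  exact h

theorem end_ext {V : Type*} [AddCommGroup V] [Module F V] [Superspace F V]
    {S T : Module.End F V} (h : ∀ (l : ZMod 2) (v : V), v ∈ sgr F l → S v = T v) : S = T := by
  ext x
  rw [← Superspace.proj_add F x, map_add, map_add, h 0 _ (Superspace.proj_mem F 0 x),
    h 1 _ (Superspace.proj_mem F 1 x)]

end EndSuper

section TKK

variable {F J : Type*} [Field F] [AddCommGroup J] [Module F J] [Superalgebra F J]

/-- Left multiplication by a homogeneous element is homogeneous of the same degree. -/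
theorem lmul_mem {i : ZMod 2} {x : J} (hx : x ∈ sgr F i) :
    (sop F x : Module.End F J) ∈ sgr F i :=
  fun _ _ hy => Superalgebra.op_mem hx hy

theorem comm_lmul {i j : ZMod 2} {x y : J} (hx : x ∈ sgr F i) (hy : y ∈ sgr F j) (v : J) :
    superComm F (sop F x : Module.End F J) (sop F y) v =
      sop F x (sop F y v) - koszul F i j • sop F y (sop F x v) := by
  rw [superComm_apply (lmul_mem hx) (lmul_mem hy)]
  rfl

theorem prod_superComm {i j : ZMod 2} {S T : Module.End F J × Module.End F J}
    (hS : S ∈ sgr F i) (hT : T ∈ sgr F j) :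
    superComm F S T = (superComm F S.1 T.1, superComm F S.2 T.2) := by
  rw [superComm_apply hS hT, superComm_apply hS.1 hT.1, superComm_apply hS.2 hT.2]
  rfl

theorem prod_mul_mem {i j : ZMod 2} {S T : Module.End F J × Module.End F J}
    (hS : S ∈ sgr F i) (hT : T ∈ sgr F j) : S * T ∈ sgr F (i + j) :=
  ⟨end_mul_mem hS.1 hT.1, end_mul_mem hS.2 hT.2⟩

variable (F J) in
/-- The map `ψ_{1,-1} : J ⊗ J → End(J₁) ⊕ End(J₋₁)`,
`ψ(x, y) z = (xy)z + x(yz) - (-1)^{|x||y|} y(xz)` on `J₁ = J` and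
`ψ(x, y) w = -(xy)w + x(yw) - (-1)^{|x||y|} y(xw)` on `J₋₁ = J`. -/
def tkkPsi : J →ₗ[F] J →ₗ[F] Module.End F J × Module.End F J :=
  LinearMap.mk₂ F (fun x y =>
    ((sop F (sop F x y) + superComm F (sop F x : Module.End F J) (sop F y)),
      (-sop F (sop F x y) + superComm F (sop F x : Module.End F J) (sop F y))))
    (fun x y z => by ext <;> simp <;> abel) (fun c x y => by ext <;> simp)
    (fun x y z => by ext <;> simp <;> abel) (fun c x y => by ext <;> simp)

theorem tkkPsi_apply {i j : ZMod 2} {x y : J} (hx : x ∈ sgr F i) (hy : y ∈ sgr F j) (z w : J) :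
    (tkkPsi F J x y).1 z = sop F (sop F x y) z + sop F x (sop F y z)
        - koszul F i j • sop F y (sop F x z) ∧
    (tkkPsi F J x y).2 w = -sop F (sop F x y) w + sop F x (sop F y w)
        - koszul F i j • sop F y (sop F x w) := by
  simp only [tkkPsi, LinearMap.mk₂_apply, LinearMap.add_apply, LinearMap.neg_apply,
    comm_lmul hx hy, add_sub_assoc, and_self]

theorem tkkPsi_mem {i j : ZMod 2} {x y : J} (hx : x ∈ sgr F i) (hy : y ∈ sgr F j) :
    tkkPsi F J x y ∈ sgr F (i + j) := by
  have h1 : (sop F (sop F x y) : Module.End F J) ∈ sgr F (i + j) :=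
    lmul_mem (Superalgebra.op_mem hx hy)
  have h2 : superComm F (sop F x : Module.End F J) (sop F y) ∈ sgr F (i + j) :=
    superComm_mem end_mul_mem (lmul_mem hx) (lmul_mem hy)
  exact ⟨Submodule.add_mem _ h1 h2, Submodule.add_mem _ (Submodule.neg_mem _ h1) h2⟩

variable (F J) in
/-- `J₀ = ψ(J ⊗ J)`. -/
def tkkZero : Submodule F (Module.End F J × Module.End F J) :=
  Submodule.map₂ (tkkPsi F J) ⊤ ⊤

theorem tkkPsi_mem_zero (x y : J) : tkkPsi F J x y ∈ tkkZero F J :=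
  Submodule.apply_mem_map₂ _ Submodule.mem_top Submodule.mem_top

theorem tkkZero_le {P : Submodule F (Module.End F J × Module.End F J)}
    (h : ∀ (i j : ZMod 2) (x y : J), x ∈ sgr F i → y ∈ sgr F j → tkkPsi F J x y ∈ P) :
    tkkZero F J ≤ P := by
  refine Submodule.map₂_le.2 fun x _ y _ => ?_
  have hp := fun i x => Superspace.proj_mem F (V := J) i x
  rw [← Superspace.proj_add F x, ← Superspace.proj_add F y]
  simp only [map_add, LinearMap.add_apply]
  exact Submodule.add_mem _
    (Submodule.add_mem _ (h _ _ _ _ (hp 0 x) (hp 0 y)) (h _ _ _ _ (hp 1 x) (hp 0 y)))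
    (Submodule.add_mem _ (h _ _ _ _ (hp 0 x) (hp 1 y)) (h _ _ _ _ (hp 1 x) (hp 1 y)))

theorem tkkZero_proj (i : ZMod 2) {S : Module.End F J × Module.End F J} (hS : S ∈ tkkZero F J) :
    Superspace.proj F i S ∈ tkkZero F J := by
  refine (tkkZero_le (P := (tkkZero F J).comap (Superspace.proj F i)) ?_) hS
  intro j k x y hx hy
  rw [Submodule.mem_comap]
  by_cases h : i = j + k
  · rw [h, Superspace.proj_same (tkkPsi_mem hx hy)]
    exact tkkPsi_mem_zero x y
  · rw [Superspace.proj_ne (tkkPsi_mem hx hy) h]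
    exact Submodule.zero_mem _

instance : Superspace F (tkkZero F J) where
  grade i := (sgr F i).comap (tkkZero F J).subtype
  isCompl := by
    refine Superspace.isCompl_of_decomp (fun x h0 h1 => ?_) fun x => ?_
    · exact Subtype.ext (Superspace.eq_zero_of_mem (F := F) h0 h1)
    · exact ⟨⟨_, tkkZero_proj 0 x.2⟩, Superspace.proj_mem F 0 x.1, ⟨_, tkkZero_proj 1 x.2⟩,
        Superspace.proj_mem F 1 x.1, Subtype.ext (Superspace.proj_add F _)⟩

variable (F J) in
/-- The underlying space `J₁ ⊕ J₀ ⊕ J₋₁` of `TKK(J)`, with `J₁ = J₋₁ = J`. -/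
@[ext] structure TKK where
  pos : J
  zero : tkkZero F J
  neg : J

namespace TKK

instance : Add (TKK F J) := ⟨fun X Y => ⟨X.pos + Y.pos, X.zero + Y.zero, X.neg + Y.neg⟩⟩

instance : Zero (TKK F J) := ⟨⟨0, 0, 0⟩⟩

instance : Neg (TKK F J) := ⟨fun X => ⟨-X.pos, -X.zero, -X.neg⟩⟩

instance : SMul F (TKK F J) := ⟨fun c X => ⟨c • X.pos, c • X.zero, c • X.neg⟩⟩

@[simp] theorem pos_add (X Y : TKK F J) : (X + Y).pos = X.pos + Y.pos := rfl

@[simp] theorem zero_add (X Y : TKK F J) : (X + Y).zero = X.zero + Y.zero := rfl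

@[simp] theorem neg_add (X Y : TKK F J) : (X + Y).neg = X.neg + Y.neg := rfl

@[simp] theorem pos_zero : (0 : TKK F J).pos = 0 := rfl

@[simp] theorem zero_zero : (0 : TKK F J).zero = 0 := rfl

@[simp] theorem neg_zero : (0 : TKK F J).neg = 0 := rfl

@[simp] theorem pos_neg (X : TKK F J) : (-X).pos = -X.pos := rfl

@[simp] theorem zero_neg (X : TKK F J) : (-X).zero = -X.zero := rfl

@[simp] theorem neg_neg (X : TKK F J) : (-X).neg = -X.neg := rfl

@[simp] theorem pos_smul (c : F) (X : TKK F J) : (c • X).pos = c • X.pos := rfl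

@[simp] theorem zero_smul (c : F) (X : TKK F J) : (c • X).zero = c • X.zero := rfl

@[simp] theorem neg_smul (c : F) (X : TKK F J) : (c • X).neg = c • X.neg := rfl

instance : AddCommGroup (TKK F J) where
  add_assoc _ _ _ := TKK.ext (add_assoc _ _ _) (add_assoc _ _ _) (add_assoc _ _ _)
  zero_add _ := TKK.ext (_root_.zero_add _) (_root_.zero_add _) (_root_.zero_add _)
  add_zero _ := TKK.ext (add_zero _) (add_zero _) (add_zero _)
  add_comm _ _ := TKK.ext (add_comm _ _) (add_comm _ _) (add_comm _ _)
  neg_add_cancel _ :=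
    TKK.ext (neg_add_cancel _) (neg_add_cancel _) (neg_add_cancel _)
  nsmul := nsmulRec
  zsmul := zsmulRec

instance : Module F (TKK F J) where
  one_smul _ := TKK.ext (one_smul _ _) (one_smul _ _) (one_smul _ _)
  mul_smul _ _ _ := TKK.ext (mul_smul _ _ _) (mul_smul _ _ _) (mul_smul _ _ _)
  smul_zero _ := TKK.ext (smul_zero _) (smul_zero _) (smul_zero _)
  smul_add _ _ _ := TKK.ext (smul_add _ _ _) (smul_add _ _ _) (smul_add _ _ _)
  add_smul _ _ _ := TKK.ext (add_smul _ _ _) (add_smul _ _ _) (add_smul _ _ _)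
  zero_smul _ := TKK.ext (_root_.zero_smul _ _) (_root_.zero_smul _ _) (_root_.zero_smul _ _)

instance : Superspace F (TKK F J) where
  grade i :=
    { carrier := {X | X.pos ∈ sgr F i ∧ X.zero ∈ sgr F i ∧ X.neg ∈ sgr F i}
      zero_mem' := ⟨Submodule.zero_mem _, Submodule.zero_mem _, Submodule.zero_mem _⟩
      add_mem' := fun hX hY => ⟨Submodule.add_mem _ hX.1 hY.1,
        Submodule.add_mem _ hX.2.1 hY.2.1, Submodule.add_mem _ hX.2.2 hY.2.2⟩
      smul_mem' := fun c _ hX => ⟨Submodule.smul_mem _ c hX.1,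
        Submodule.smul_mem _ c hX.2.1, Submodule.smul_mem _ c hX.2.2⟩ }
  isCompl := by
    refine Superspace.isCompl_of_decomp (fun X h0 h1 => ?_) fun X => ?_
    · exact TKK.ext (Superspace.eq_zero_of_mem (F := F) h0.1 h1.1)
        (Superspace.eq_zero_of_mem (F := F) h0.2.1 h1.2.1)
        (Superspace.eq_zero_of_mem (F := F) h0.2.2 h1.2.2)
    · have hp := fun (i : ZMod 2) (x : J) => Superspace.proj_mem F i x
      have hq := fun (i : ZMod 2) (x : tkkZero F J) => Superspace.proj_mem F i x
      exact ⟨⟨_, _, _⟩, ⟨hp 0 X.pos, hq 0 X.zero, hp 0 X.neg⟩,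
        ⟨_, _, _⟩, ⟨hp 1 X.pos, hq 1 X.zero, hp 1 X.neg⟩,
        TKK.ext (Superspace.proj_add F _) (Superspace.proj_add F _) (Superspace.proj_add F _)⟩

theorem mem_grade {i : ZMod 2} {X : TKK F J} :
    X ∈ sgr F i ↔ X.pos ∈ sgr F i ∧ X.zero ∈ sgr F i ∧ X.neg ∈ sgr F i := Iff.rfl

end TKK

variable (F J) in
/-- The action of `J₀` on `J₁`. -/
def tkkActPos : tkkZero F J →ₗ[F] J →ₗ[F] J :=
  LinearMap.fst F (Module.End F J) (Module.End F J) ∘ₗ (tkkZero F J).subtype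

variable (F J) in
/-- The action of `J₀` on `J₋₁`. -/
def tkkActNeg : tkkZero F J →ₗ[F] J →ₗ[F] J :=
  LinearMap.snd F (Module.End F J) (Module.End F J) ∘ₗ (tkkZero F J).subtype

variable (F J) in
/-- The map `ψ_{1,-1}` with values in `J₀`. -/
def tkkPsiZero : J →ₗ[F] J →ₗ[F] tkkZero F J :=
  LinearMap.mk₂ F (fun x y => ⟨tkkPsi F J x y, tkkPsi_mem_zero x y⟩)
    (fun x y z => Subtype.ext ((tkkPsi F J).map_add₂ x y z))
    (fun c x y => Subtype.ext ((tkkPsi F J).map_smul₂ c x y))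
    (fun x y z => Subtype.ext ((tkkPsi F J x).map_add y z))
    (fun c x y => Subtype.ext ((tkkPsi F J x).map_smul c y))

theorem tkkZero_mem_grade {i : ZMod 2} {S : tkkZero F J} : S ∈ sgr F i ↔ S.1 ∈ sgr F i := Iff.rfl

theorem tkkPsiZero_mem {i j : ZMod 2} {x y : J} (hx : x ∈ sgr F i) (hy : y ∈ sgr F j) :
    tkkPsiZero F J x y ∈ sgr F (i + j) :=
  tkkZero_mem_grade.2 (tkkPsi_mem hx hy)

variable [IsJordanSuperalgebra F J]

theorem lmul_comm_lmul {i j k : ZMod 2} {a z w : J} (ha : a ∈ sgr F i) (hz : z ∈ sgr F j)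
    (hw : w ∈ sgr F k) :
    superComm F (sop F a : Module.End F J) (sop F (sop F z w)) =
      superComm F (sop F (sop F a z) : Module.End F J) (sop F w)
        - koszul F i j • superComm F (sop F z : Module.End F J) (sop F (sop F a w)) := by
  refine end_ext fun l v hv => ?_
  have m := @Superalgebra.op_mem F J _ _ _ _
  have c := @IsJordanSuperalgebra.comm F J _ _ _ _ _
  rw [LinearMap.sub_apply, LinearMap.smul_apply, comm_lmul ha (m hz hw), comm_lmul (m ha hz) hw,
    comm_lmul hz (m ha hw)]
  have h := IsJordanSuperalgebra.jordan ha hz hv hw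
  simp only [sassoc] at h
  rw [c (m (m ha hz) hv) hw, c hv hw, c (m (m hz hw) hv) ha, c hv ha, c hw ha, c hv hz] at h
  simp only [map_smul, LinearMap.smul_apply] at h
  rw [c (m (m ha hw) hv) hz] at h
  rcases zmod2_eq i with rfl | rfl <;> rcases zmod2_eq j with rfl | rfl <;>
  rcases zmod2_eq k with rfl | rfl <;> rcases zmod2_eq l with rfl | rfl <;>
  simp only [show (1 + 1 : ZMod 2) = 0 from rfl, koszul_zero_left, koszul_zero_right,
    koszul_one_one, add_zero, zero_add, one_smul, neg_smul, mul_one, one_mul] at h ⊢ <;>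
  first
  | linear_combination (norm := module) h
  | linear_combination (norm := module) -h


theorem lmul_comm_inner {i j k : ZMod 2} {a z w : J} (ha : a ∈ sgr F i) (hz : z ∈ sgr F j)
    (hw : w ∈ sgr F k) :
    superComm F (sop F a : Module.End F J) (superComm F (sop F z : Module.End F J) (sop F w)) =
      sop F (sop F (sop F a z) w) - koszul F i j • sop F (sop F z (sop F a w)) := by
  refine end_ext fun l v hv => ?_
  have m := @Superalgebra.op_mem F J _ _ _ _
  have c := @IsJordanSuperalgebra.comm F J _ _ _ _ _
  rw [superComm_apply (lmul_mem ha) (superComm_mem end_mul_mem (lmul_mem hz) (lmul_mem hw))]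
  simp only [LinearMap.sub_apply, LinearMap.smul_apply, Module.End.mul_apply, comm_lmul hz hw,
    map_sub, map_smul]
  have h1 := IsJordanSuperalgebra.jordan hz ha hw hv
  have h2 := IsJordanSuperalgebra.jordan hw ha hz hv
  simp only [sassoc] at h1 h2
  rw [c (m (m ha hv) hw) hz, c (m ha hv) hw, c (m (m hv hz) hw) ha, c (m hv hz) hw,
    c (m hv hz) (m hw ha), c hz ha, c hv hz, c hw ha, c hw hz] at h1
  rw [c (m (m ha hv) hz) hw, c (m ha hv) hz, c (m (m hv hw) hz) ha, c (m hv hw) hz,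
    c (m hv hw) (m hz ha), c (m hw ha) hz, c hw ha, c hv hw, c hz ha] at h2
  simp only [map_smul, LinearMap.smul_apply] at h1 h2
  rcases zmod2_eq i with rfl | rfl <;> rcases zmod2_eq j with rfl | rfl <;>
  rcases zmod2_eq k with rfl | rfl <;> rcases zmod2_eq l with rfl | rfl <;>
  simp only [show (1 + 1 : ZMod 2) = 0 from rfl, koszul_zero_left, koszul_zero_right,
    koszul_one_one, add_zero, zero_add, one_smul, neg_smul, mul_one, one_mul] at h1 h2 ⊢ <;>
  first
  | linear_combination (norm := module) h1 + h2
  | linear_combination (norm := module) h1 - h2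
  | linear_combination (norm := module) h2 - h1
  | linear_combination (norm := module) -h1 - h2

theorem lmul_psi {i j k : ZMod 2} {a z w : J} (ha : a ∈ sgr F i) (hz : z ∈ sgr F j)
    (hw : w ∈ sgr F k) :
    superComm F ((sop F a, -sop F a) : Module.End F J × Module.End F J) (tkkPsi F J z w) =
      tkkPsi F J (sop F a z) w + koszul F i j • tkkPsi F J z (-sop F a w) := by
  have hm : ((sop F a, -sop F a) : Module.End F J × Module.End F J) ∈ sgr F i :=
    ⟨lmul_mem ha, Submodule.neg_mem _ (lmul_mem ha)⟩
  rw [prod_superComm hm (tkkPsi_mem hz hw)]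
  simp only [tkkPsi, LinearMap.mk₂_apply]
  refine Prod.ext ?_ ?_
  · simp only [map_add, map_neg, Prod.fst_add, Prod.smul_fst, lmul_comm_lmul ha hz hw,
      lmul_comm_inner ha hz hw]
    module
  · simp only [map_add, map_neg, Prod.snd_add, Prod.smul_snd, LinearMap.neg_apply,
      lmul_comm_lmul ha hz hw, lmul_comm_inner ha hz hw]
    module

theorem inner_lmul {i j k : ZMod 2} {x y a : J} (hx : x ∈ sgr F i) (hy : y ∈ sgr F j)
    (ha : a ∈ sgr F k) :
    superComm F (superComm F (sop F x : Module.End F J) (sop F y)) (sop F a) =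
      sop F (superComm F (sop F x : Module.End F J) (sop F y) a) := by
  have m := @Superalgebra.op_mem F J _ _ _ _
  have c := @IsJordanSuperalgebra.comm F J _ _ _ _ _
  rw [superComm_skew (superComm_mem end_mul_mem (lmul_mem hx) (lmul_mem hy)) (lmul_mem ha),
    lmul_comm_inner ha hx hy, comm_lmul hx hy, c (m ha hx) hy, c ha hx, c ha hy]
  simp only [map_smul, map_sub]
  rcases zmod2_eq i with rfl | rfl <;> rcases zmod2_eq j with rfl | rfl <;>
  rcases zmod2_eq k with rfl | rfl <;>
  simp [show (1 + 1 : ZMod 2) = 0 from rfl] <;> module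

theorem inner_psi {i j k l : ZMod 2} {x y z w : J} (hx : x ∈ sgr F i) (hy : y ∈ sgr F j)
    (hz : z ∈ sgr F k) (hw : w ∈ sgr F l) :
    superComm F ((superComm F (sop F x : Module.End F J) (sop F y),
        superComm F (sop F x : Module.End F J) (sop F y)) : Module.End F J × Module.End F J)
        (tkkPsi F J z w) =
      tkkPsi F J (superComm F (sop F x : Module.End F J) (sop F y) z) w
        + koszul F (i + j) k •
          tkkPsi F J z (superComm F (sop F x : Module.End F J) (sop F y) w) := by
  have hD : superComm F (sop F x : Module.End F J) (sop F y) ∈ sgr F (i + j) :=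
    superComm_mem end_mul_mem (lmul_mem hx) (lmul_mem hy)
  have hd := fun (n : ZMod 2) (a : J) (ha : a ∈ sgr F n) => inner_lmul hx hy ha
  generalize superComm F (sop F x : Module.End F J) (sop F y) = D at hD hd ⊢
  have hm : ((D, D) : Module.End F J × Module.End F J) ∈ sgr F (i + j) := ⟨hD, hD⟩
  have e1 : D (sop F z w) = sop F (D z) w + koszul F (i + j) k • sop F z (D w) := by
    have h := congrArg (fun T : Module.End F J => T w) (hd k z hz)
    simp only [superComm_apply hD (lmul_mem hz)] at h
    exact sub_eq_iff_eq_add.1 h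
  have e2 := superComm_jacobi end_mul_mem hD (lmul_mem hz) (lmul_mem hw)
  have e3 := hd _ _ (Superalgebra.op_mem hz hw)
  rw [hd _ _ hz, hd _ _ hw] at e2
  rw [prod_superComm hm (tkkPsi_mem hz hw)]
  simp only [tkkPsi, LinearMap.mk₂_apply]
  refine Prod.ext ?_ ?_
  · simp only [map_add, Prod.fst_add, Prod.smul_fst, e2, e3, e1, map_smul]
    module
  · simp only [map_add, map_neg, Prod.snd_add, Prod.smul_snd, e2, e3, e1, map_smul]
    module

/-- `J₀` acts on `ψ(J ⊗ J)` by derivations. -/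
theorem zero_psi {i j k : ZMod 2} {S : Module.End F J × Module.End F J} {z w : J}
    (hS : S ∈ tkkZero F J) (hi : S ∈ sgr F i) (hz : z ∈ sgr F j) (hw : w ∈ sgr F k) :
    superComm F S (tkkPsi F J z w) =
      tkkPsi F J (S.1 z) w + koszul F i j • tkkPsi F J z (S.2 w) := by
  let ev₁ : Module.End F J × Module.End F J →ₗ[F] J :=
    LinearMap.applyₗ z ∘ₗ LinearMap.fst F _ _
  let ev₂ : Module.End F J × Module.End F J →ₗ[F] J :=
    LinearMap.applyₗ w ∘ₗ LinearMap.snd F _ _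
  let K : Module.End F J × Module.End F J →ₗ[F] Module.End F J × Module.End F J :=
    (superComm F).flip (tkkPsi F J z w) - (tkkPsi F J).flip w ∘ₗ ev₁
      - (tkkPsi F J z ∘ₗ ev₂ ∘ₗ Superspace.proj F 0
        + koszul F 1 j • (tkkPsi F J z ∘ₗ ev₂ ∘ₗ Superspace.proj F 1))
  have hK : ∀ (n : ZMod 2) (T : Module.End F J × Module.End F J), T ∈ sgr F n →
      K T = superComm F T (tkkPsi F J z w) - tkkPsi F J (T.1 z) w
        - koszul F n j • tkkPsi F J z (T.2 w) := by
    intro n T hT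
    rcases zmod2_eq n with rfl | rfl
    · simp [K, ev₁, ev₂, Superspace.proj_same hT,
        Superspace.proj_ne hT (show (1 : ZMod 2) ≠ 0 by decide)]
    · simp [K, ev₁, ev₂, Superspace.proj_same hT,
        Superspace.proj_ne hT (show (0 : ZMod 2) ≠ 1 by decide)]
  have hle : tkkZero F J ≤ LinearMap.ker K := by
    refine tkkZero_le fun a b x y hx hy => ?_
    rw [LinearMap.mem_ker, hK _ _ (tkkPsi_mem hx hy)]
    have h1 := lmul_psi (Superalgebra.op_mem hx hy) hz hw
    have h2 := inner_psi hx hy hz hw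
    have h3 : tkkPsi F J x y = ((sop F (sop F x y), -sop F (sop F x y)) :
        Module.End F J × Module.End F J) + (superComm F (sop F x : Module.End F J) (sop F y),
        superComm F (sop F x : Module.End F J) (sop F y)) := rfl
    rw [h3, map_add, LinearMap.add_apply, h1, h2]
    simp only [Prod.fst_add, Prod.snd_add, LinearMap.add_apply, LinearMap.neg_apply, map_add,
      map_neg]
    module
  have h := hle hS
  rw [LinearMap.mem_ker, hK _ _ hi] at h
  rw [sub_sub, sub_eq_zero] at h
  exact h

theorem tkkZero_superComm {S T : Module.End F J × Module.End F J}
    (hS : S ∈ tkkZero F J) (hT : T ∈ tkkZero F J) : superComm F S T ∈ tkkZero F J := by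
  refine (tkkZero_le (P := (tkkZero F J).comap (superComm F S)) ?_) hT
  intro i j x y hx hy
  rw [Submodule.mem_comap, ← Superspace.proj_add F S, map_add, LinearMap.add_apply,
    zero_psi (tkkZero_proj 0 hS) (Superspace.proj_mem F 0 S) hx hy,
    zero_psi (tkkZero_proj 1 hS) (Superspace.proj_mem F 1 S) hx hy]
  exact Submodule.add_mem _
    (Submodule.add_mem _ (tkkPsi_mem_zero _ _) (Submodule.smul_mem _ _ (tkkPsi_mem_zero _ _)))
    (Submodule.add_mem _ (tkkPsi_mem_zero _ _) (Submodule.smul_mem _ _ (tkkPsi_mem_zero _ _)))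

variable (F J) in
/-- The supercommutator on `J₀`. -/
def tkkCommZero : tkkZero F J →ₗ[F] tkkZero F J →ₗ[F] tkkZero F J :=
  LinearMap.mk₂ F (fun S T => ⟨superComm F S.1 T.1, tkkZero_superComm S.2 T.2⟩)
    (fun S T U => Subtype.ext ((superComm F).map_add₂ S.1 T.1 U.1))
    (fun c S T => Subtype.ext ((superComm F).map_smul₂ c S.1 T.1))
    (fun S T U => Subtype.ext ((superComm F S.1).map_add T.1 U.1))
    (fun c S T => Subtype.ext ((superComm F S.1).map_smul c T.1))

variable (F J) in
/-- The bracket of `TKK(J)`. For homogeneous `a, a' ∈ J₁`, `S, S' ∈ J₀` and `b, b' ∈ J₋₁`,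
`[a + S + b, a' + S' + b']` has the components
`S a' - (-1)^{|a||S'|} S' a` in `J₁`,
`ψ(a, b') + [S, S'] - (-1)^{|b||a'|} ψ(a', b)` in `J₀`, and
`S b' - (-1)^{|b||S'|} S' b` in `J₋₁`. -/
def tkkBracket : TKK F J →ₗ[F] TKK F J →ₗ[F] TKK F J :=
  LinearMap.mk₂ F (fun X Y =>
    { pos := tkkActPos F J X.zero Y.pos - Superspace.flip (tkkActPos F J) X.pos Y.zero
      zero := tkkPsiZero F J X.pos Y.neg + tkkCommZero F J X.zero Y.zero
        - Superspace.flip (tkkPsiZero F J) X.neg Y.pos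
      neg := tkkActNeg F J X.zero Y.neg - Superspace.flip (tkkActNeg F J) X.neg Y.zero })
    (fun X X' Y => by
      apply TKK.ext <;>
      simp only [TKK.pos_add, TKK.zero_add, TKK.neg_add, LinearMap.map_add₂] <;> abel)
    (fun c X Y => by
      apply TKK.ext <;>
      simp only [TKK.pos_smul, TKK.zero_smul, TKK.neg_smul, LinearMap.map_smul₂, smul_sub,
        smul_add])
    (fun X Y Y' => by
      apply TKK.ext <;>
      simp only [TKK.pos_add, TKK.zero_add, TKK.neg_add, LinearMap.map_add] <;> abel)
    (fun c X Y => by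
      apply TKK.ext <;>
      simp only [TKK.pos_smul, TKK.zero_smul, TKK.neg_smul, LinearMap.map_smul, smul_sub,
        smul_add])

theorem tkkBracket_apply {i j : ZMod 2} {X Y : TKK F J} (hX : X ∈ sgr F i) (hY : Y ∈ sgr F j) :
    tkkBracket F J X Y =
      ⟨X.zero.1.1 Y.pos - koszul F j i • Y.zero.1.1 X.pos,
        tkkPsiZero F J X.pos Y.neg + tkkCommZero F J X.zero Y.zero
          - koszul F j i • tkkPsiZero F J Y.pos X.neg,
        X.zero.1.2 Y.neg - koszul F j i • Y.zero.1.2 X.neg⟩ := by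
  obtain ⟨ha, -, hb⟩ := TKK.mem_grade.1 hX
  obtain ⟨ha', hS', -⟩ := TKK.mem_grade.1 hY
  refine TKK.ext ?_ ?_ ?_
  · exact congrArg (_ - ·) (Superspace.flip_apply _ hS' ha)
  · exact congrArg (_ - ·) (Superspace.flip_apply _ ha' hb)
  · exact congrArg (_ - ·) (Superspace.flip_apply _ hS' hb)

theorem tkkBracket_mem {i j : ZMod 2} {X Y : TKK F J} (hX : X ∈ sgr F i) (hY : Y ∈ sgr F j) :
    tkkBracket F J X Y ∈ sgr F (i + j) := by
  rw [tkkBracket_apply hX hY]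
  obtain ⟨a, S, b⟩ := X
  obtain ⟨a', S', b'⟩ := Y
  obtain ⟨ha : a ∈ sgr F i, hS : S ∈ sgr F i, hb : b ∈ sgr F i⟩ := hX
  obtain ⟨ha' : a' ∈ sgr F j, hS' : S' ∈ sgr F j, hb' : b' ∈ sgr F j⟩ := hY
  rw [tkkZero_mem_grade] at hS hS'
  have c := add_comm j i
  have h1 : S'.1.1 a ∈ sgr F (i + j) := by
    have h := hS'.1 i a ha
    rwa [c] at h
  have h2 : tkkPsiZero F J a' b ∈ sgr F (i + j) := by
    have h := tkkPsi_mem ha' hb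
    rwa [c] at h
  have h3 : S'.1.2 b ∈ sgr F (i + j) := by
    have h := hS'.2 i b hb
    rwa [c] at h
  have h4 : tkkPsiZero F J a b' ∈ sgr F (i + j) := tkkZero_mem_grade.2 (tkkPsi_mem ha hb')
  have h5 : tkkCommZero F J S S' ∈ sgr F (i + j) :=
    tkkZero_mem_grade.2 (superComm_mem prod_mul_mem hS hS')
  exact ⟨Submodule.sub_mem _ (hS.1 j a' ha') (Submodule.smul_mem _ _ h1),
    Submodule.sub_mem _ (Submodule.add_mem _ h4 h5) (Submodule.smul_mem _ _ h2),
    Submodule.sub_mem _ (hS.2 j b' hb') (Submodule.smul_mem _ _ h3)⟩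

theorem psi_pos_symm {i j k : ZMod 2} {x y z : J} (hx : x ∈ sgr F i) (hy : y ∈ sgr F j)
    (hz : z ∈ sgr F k) : (tkkPsi F J x y).1 z =
      (koszul F i j * koszul F i k * koszul F j k) • (tkkPsi F J z y).1 x := by
  have m := @Superalgebra.op_mem F J _ _ _ _
  have c := @IsJordanSuperalgebra.comm F J _ _ _ _ _
  rw [(tkkPsi_apply hx hy z 0).1, (tkkPsi_apply hz hy x 0).1, c (m hz hy) hx, c hz hy, c hz hx,
    c hy hx, map_smul, map_smul, map_smul, c hz (m hx hy)]
  rcases zmod2_eq i with rfl | rfl <;> rcases zmod2_eq j with rfl | rfl <;>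
  rcases zmod2_eq k with rfl | rfl <;>
  simp [show (1 + 1 : ZMod 2) = 0 from rfl] <;> abel

theorem psi_neg_symm {i j k : ZMod 2} {x y z : J} (hx : x ∈ sgr F i) (hy : y ∈ sgr F j)
    (hz : z ∈ sgr F k) : (tkkPsi F J x y).2 z =
      koszul F j k • (tkkPsi F J x z).2 y := by
  have m := @Superalgebra.op_mem F J _ _ _ _
  have c := @IsJordanSuperalgebra.comm F J _ _ _ _ _
  rw [(tkkPsi_apply hx hy 0 z).2, (tkkPsi_apply hx hz 0 y).2, c (m hx hy) hz, c (m hx hz) hy, c hz hy, map_smul]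
  rcases zmod2_eq i with rfl | rfl <;> rcases zmod2_eq j with rfl | rfl <;>
  rcases zmod2_eq k with rfl | rfl <;>
  simp [show (1 + 1 : ZMod 2) = 0 from rfl] <;> abel

theorem tkkCommZero_apply {i j : ZMod 2} {S T : tkkZero F J} (hS : S ∈ sgr F i)
    (hT : T ∈ sgr F j) (v : J) :
    (tkkCommZero F J S T).1.1 v = S.1.1 (T.1.1 v) - koszul F i j • T.1.1 (S.1.1 v) ∧
    (tkkCommZero F J S T).1.2 v = S.1.2 (T.1.2 v) - koszul F i j • T.1.2 (S.1.2 v) := by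
  have h : (tkkCommZero F J S T).1 = S.1 * T.1 - koszul F i j • (T.1 * S.1) :=
    superComm_apply (tkkZero_mem_grade.1 hS) (tkkZero_mem_grade.1 hT)
  rw [h]
  exact ⟨rfl, rfl⟩

theorem tkkCommZero_psi {i j k : ZMod 2} {S : tkkZero F J} {z w : J}
    (hS : S ∈ sgr F i) (hz : z ∈ sgr F j) (hw : w ∈ sgr F k) :
    tkkCommZero F J S (tkkPsiZero F J z w) =
      tkkPsiZero F J (S.1.1 z) w + koszul F i j • tkkPsiZero F J z (S.1.2 w) :=
  Subtype.ext (zero_psi S.2 (tkkZero_mem_grade.1 hS) hz hw)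

theorem tkkCommZero_skew {i j : ZMod 2} {S T : tkkZero F J}
    (hS : S ∈ sgr F i) (hT : T ∈ sgr F j) :
    tkkCommZero F J S T = -(koszul F i j • tkkCommZero F J T S) :=
  Subtype.ext (superComm_skew (tkkZero_mem_grade.1 hS) (tkkZero_mem_grade.1 hT))

theorem tkkCommZero_jacobi {i j k : ZMod 2} {S T U : tkkZero F J}
    (hS : S ∈ sgr F i) (hT : T ∈ sgr F j) (hU : U ∈ sgr F k) :
    tkkCommZero F J S (tkkCommZero F J T U) = tkkCommZero F J (tkkCommZero F J S T) U
      + koszul F i j • tkkCommZero F J T (tkkCommZero F J S U) :=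
  Subtype.ext (superComm_jacobi prod_mul_mem (tkkZero_mem_grade.1 hS) (tkkZero_mem_grade.1 hT)
    (tkkZero_mem_grade.1 hU))

theorem tkkBracket_skew {i j : ZMod 2} {X Y : TKK F J} (hX : X ∈ sgr F i) (hY : Y ∈ sgr F j) :
    tkkBracket F J X Y = -(koszul F i j • tkkBracket F J Y X) := by
  rw [tkkBracket_apply hX hY, tkkBracket_apply hY hX, tkkCommZero_skew hX.2.1 hY.2.1]
  apply TKK.ext
  all_goals
    simp only [TKK.pos_neg, TKK.zero_neg, TKK.neg_neg, TKK.pos_smul, TKK.zero_smul, TKK.neg_smul]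
    rcases zmod2_eq i with rfl | rfl <;> rcases zmod2_eq j with rfl | rfl <;>
    simp only [koszul_zero_left, koszul_zero_right, koszul_one_one, one_smul] <;> module

set_option maxHeartbeats 1000000 in
theorem tkkBracket_jacobi {i j k : ZMod 2} {X Y Z : TKK F J}
    (hX : X ∈ sgr F i) (hY : Y ∈ sgr F j) (hZ : Z ∈ sgr F k) :
    tkkBracket F J X (tkkBracket F J Y Z) = tkkBracket F J (tkkBracket F J X Y) Z
      + koszul F i j • tkkBracket F J Y (tkkBracket F J X Z) := by
  rw [tkkBracket_apply hX (tkkBracket_mem hY hZ), tkkBracket_apply (tkkBracket_mem hX hY) hZ,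
    tkkBracket_apply hY (tkkBracket_mem hX hZ), tkkBracket_apply hY hZ, tkkBracket_apply hX hY,
    tkkBracket_apply hX hZ]
  obtain ⟨a, S, b⟩ := X
  obtain ⟨a', S', b'⟩ := Y
  obtain ⟨a'', S'', b''⟩ := Z
  obtain ⟨ha : a ∈ sgr F i, hS : S ∈ sgr F i, hb : b ∈ sgr F i⟩ := hX
  obtain ⟨ha' : a' ∈ sgr F j, hS' : S' ∈ sgr F j, hb' : b' ∈ sgr F j⟩ := hY
  obtain ⟨ha'' : a'' ∈ sgr F k, hS'' : S'' ∈ sgr F k, hb'' : b'' ∈ sgr F k⟩ := hZ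
  apply TKK.ext
  · have e1 := psi_pos_symm ha' hb'' ha
    have e2 := psi_pos_symm ha'' hb' ha
    have e3 := psi_pos_symm ha'' hb ha'
    have c1 := (tkkCommZero_apply hS hS' a'').1
    have c2 := (tkkCommZero_apply hS' hS'' a).1
    have c3 := (tkkCommZero_apply hS hS'' a').1
    simp only [TKK.pos_add, TKK.pos_smul, Submodule.coe_add, Submodule.coe_sub,
      Submodule.coe_smul, Prod.fst_sub, Prod.fst_add, Prod.smul_fst, LinearMap.add_apply, LinearMap.sub_apply,
      LinearMap.smul_apply, map_sub, map_smul, c1, c2, c3]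
    change _ - _ • (((tkkPsi F J a' b'').1 a) + _ - _ • ((tkkPsi F J a'' b').1 a)) =
      ((tkkPsi F J a b').1 a'' + _ - _ • ((tkkPsi F J a' b).1 a'')) - _ + _ • (_ - _ •
        (((tkkPsi F J a b'').1 a') + _ - _ • ((tkkPsi F J a'' b).1 a')))
    rw [e1, e2, e3]
    rcases zmod2_eq i with rfl | rfl <;> rcases zmod2_eq j with rfl | rfl <;>
    rcases zmod2_eq k with rfl | rfl <;>
    simp only [show (1 + 1 : ZMod 2) = 0 from rfl, koszul_zero_left, koszul_zero_right,
      koszul_one_one, add_zero, zero_add, one_smul, neg_smul, mul_one, one_mul] <;> module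
  · simp only [TKK.zero_add, TKK.zero_smul, map_add, map_sub,
      map_smul, LinearMap.add_apply, LinearMap.sub_apply, LinearMap.smul_apply,
      tkkCommZero_skew (tkkPsiZero_mem ha hb') hS'', tkkCommZero_skew (tkkPsiZero_mem ha' hb) hS'',
      tkkCommZero_psi hS ha' hb'', tkkCommZero_psi hS ha'' hb', tkkCommZero_psi hS'' ha hb',
      tkkCommZero_psi hS'' ha' hb, tkkCommZero_psi hS' ha hb'', tkkCommZero_psi hS' ha'' hb,
      tkkCommZero_jacobi hS hS' hS'']
    rcases zmod2_eq i with rfl | rfl <;> rcases zmod2_eq j with rfl | rfl <;>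
    rcases zmod2_eq k with rfl | rfl <;>
    simp only [show (1 + 1 : ZMod 2) = 0 from rfl, koszul_zero_left, koszul_zero_right,
      koszul_one_one, add_zero, zero_add, one_smul, neg_smul] <;> module
  · have e1 := psi_neg_symm ha' hb'' hb
    have e2 := psi_neg_symm ha'' hb' hb
    have e3 := psi_neg_symm ha hb' hb''
    have c1 := (tkkCommZero_apply hS hS' b'').2
    have c2 := (tkkCommZero_apply hS' hS'' b).2
    have c3 := (tkkCommZero_apply hS hS'' b').2
    simp only [TKK.neg_add, TKK.neg_smul, Submodule.coe_add, Submodule.coe_sub,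
      Submodule.coe_smul, Prod.snd_sub, Prod.snd_add, Prod.smul_snd, LinearMap.add_apply, LinearMap.sub_apply,
      LinearMap.smul_apply, map_sub, map_smul, c1, c2, c3]
    change _ - _ • (((tkkPsi F J a' b'').2 b) + _ - _ • ((tkkPsi F J a'' b').2 b)) =
      ((tkkPsi F J a b').2 b'' + _ - _ • ((tkkPsi F J a' b).2 b'')) - _ + _ • (_ - _ •
        (((tkkPsi F J a b'').2 b') + _ - _ • ((tkkPsi F J a'' b).2 b')))
    rw [e1, e2, e3]
    rcases zmod2_eq i with rfl | rfl <;> rcases zmod2_eq j with rfl | rfl <;>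
    rcases zmod2_eq k with rfl | rfl <;>
    simp only [show (1 + 1 : ZMod 2) = 0 from rfl, koszul_zero_left, koszul_zero_right,
      koszul_one_one, add_zero, zero_add, one_smul, neg_smul] <;> module

instance : Superalgebra F (TKK F J) where
  op := tkkBracket F J
  op_mem := tkkBracket_mem

theorem tkk_sop : sop F (A := TKK F J) = tkkBracket F J := rfl

instance : IsLieSuperalgebra F (TKK F J) where
  skew hX hY := by
    rw [tkk_sop]
    exact tkkBracket_skew hX hY
  jacobi hX hY hZ := by
    rw [tkk_sop]
    exact tkkBracket_jacobi hX hY hZ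

end TKK

/-! ### Central extensions and central isogeny -/

section Central

/-- `L` is perfect: `L = [L, L]`. -/
def IsPerfectSuper (F L : Type*) [Field F] [AddCommGroup L] [Module F L] [Superalgebra F L] :
    Prop :=
  Submodule.map₂ (sop F (A := L)) ⊤ ⊤ = ⊤

/-- `π : E → L` is a central extension of `L`: a surjective homomorphism of Lie superalgebras
whose kernel is central. -/
structure IsCentralExtension {F E L : Type*} [Field F] [AddCommGroup E] [Module F E]
    [Superalgebra F E] [AddCommGroup L] [Module F L] [Superalgebra F L]
    (π : SuperHom F E L) : Prop where
  lie : IsLieSuperalgebra F E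
  surjective : Function.Surjective π
  central : ∀ x : E, π x = 0 → ∀ y : E, sop F x y = 0

/-- `π : E → L` is a cover of `L`: a central extension with `E` perfect. -/
structure IsCover {F E L : Type*} [Field F] [AddCommGroup E] [Module F E]
    [Superalgebra F E] [AddCommGroup L] [Module F L] [Superalgebra F L]
    (π : SuperHom F E L) : Prop extends IsCentralExtension π where
  perfect : IsPerfectSuper F E

/-- `π : U → L` is the universal central extension of `L`: a cover of `L` that maps uniquely, over
`L`, to every central extension of `L`. -/
structure IsUniversalCentralExtension {F : Type u} {U L : Type v} [Field F] [AddCommGroup U]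
    [Module F U] [Superalgebra F U] [AddCommGroup L] [Module F L] [Superalgebra F L]
    (π : SuperHom F U L) : Prop extends IsCover π where
  universal : ∀ (E : Type v) [AddCommGroup E] [Module F E] [Superalgebra F E]
    (ρ : SuperHom F E L), IsCentralExtension ρ →
      ∃! φ : SuperHom F U E, ∀ x : U, ρ (φ x) = π x

/-- Two perfect Lie superalgebras are centrally isogenous if their universal central extensions
are isomorphic, i.e. if a single Lie superalgebra `U` is a universal central extension of both. -/
def CentrallyIsogenous (F : Type u) (L₁ L₂ : Type v) [Field F] [AddCommGroup L₁] [Module F L₁]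
    [Superalgebra F L₁] [AddCommGroup L₂] [Module F L₂] [Superalgebra F L₂] : Prop :=
  IsLieSuperalgebra F L₁ ∧ IsPerfectSuper F L₁ ∧ IsLieSuperalgebra F L₂ ∧ IsPerfectSuper F L₂ ∧
    ∃ (U : Type v) (_ : AddCommGroup U) (_ : Module F U) (_ : Superalgebra F U)
      (π₁ : SuperHom F U L₁) (π₂ : SuperHom F U L₂),
      IsUniversalCentralExtension π₁ ∧ IsUniversalCentralExtension π₂

end Central

/-! ### Root gradings of type `A(1,1)` -/

section RootGraded

variable (F : Type*) [Field F]

/-- The root spaces `{x ∈ psl(2,2) | [h, x] = α(h) x for all h ∈ 𝔥}`. -/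
def pslRootSpace (α : Module.Dual F (pslCartan F 2)) : Submodule F (PSLSuper F 2) where
  carrier := {x | ∀ h : pslCartan F 2, sop F h.1 x = α h • x}
  zero_mem' h := by simp
  add_mem' hx hy h := by rw [map_add, hx h, hy h, smul_add]
  smul_mem' c x hx h := by rw [map_smul, hx h, smul_comm]

/-- The root system `Δ` of `psl(2,2)` relative to `𝔥`. -/
def rootsA11 : Set (Module.Dual F (pslCartan F 2)) :=
  {α | α ≠ 0 ∧ pslRootSpace F α ≠ ⊥}

variable {F} {L : Type*} [AddCommGroup L] [Module F L] [Superalgebra F L]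

/-- Let `G ⊆ L` be a subsuperalgebra, `π : G → psl(2,2)` a homomorphism and `B ⊆ G` a subspace.
With `𝔥' = {t ∈ B | π t ∈ 𝔥}`, this is the space
`L_α = {x ∈ L | [t, x] = α(π t) x for all t ∈ 𝔥'}`. -/
def weightSpaceA11 {G : Subsuperalgebra F L} (π : SuperHom F G.carrier (PSLSuper F 2))
    (B : Submodule F G.carrier) (α : Module.Dual F (pslCartan F 2)) : Submodule F L where
  carrier := {x | ∀ t ∈ B, ∀ ht : π t ∈ pslCartan F 2, sop F t.1 x = α ⟨π t, ht⟩ • x}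
  zero_mem' t _ ht := by simp
  add_mem' hx hy t hB ht := by rw [map_add, hx t hB ht, hy t hB ht, smul_add]
  smul_mem' c x hx t hB ht := by rw [map_smul, hx t hB ht, smul_comm]

/-- `B` is a subalgebra of the even part of `G` which `π` maps isomorphically onto the even part
of `psl(2,2)`. -/
structure IsEvenLift {G : Subsuperalgebra F L} (π : SuperHom F G.carrier (PSLSuper F 2))
    (B : Submodule F G.carrier) : Prop where
  le_even : B ≤ sgr F 0
  op_mem : ∀ x ∈ B, ∀ y ∈ B, sop F x y ∈ B
  bijOn : Set.BijOn π B (sgr F 0 : Submodule F (PSLSuper F 2))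

variable (F L) in
/-- `L` is an `A(1,1)`-graded Lie superalgebra: it contains a cover `G` of `psl(2,2)` such that,
for the lift of `𝔥` to the subalgebra `B` of `G₀` that projects isomorphically onto `psl(2,2)₀`,
`L = ⨁_{α ∈ Δ ∪ {0}} L_α` and `L₀ = ∑_{α ∈ Δ} [L_α, L_{-α}]`. -/
def IsA11Graded : Prop :=
  IsLieSuperalgebra F L ∧
  ∃ (G : Subsuperalgebra F L) (π : SuperHom F G.carrier (PSLSuper F 2))
    (B : Submodule F G.carrier),
    IsCover π ∧ IsEvenLift π B ∧
    iSupIndep (fun α : ↥(insert 0 (rootsA11 F)) => weightSpaceA11 π B α.1) ∧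
    (⨆ α : ↥(insert 0 (rootsA11 F)), weightSpaceA11 π B α.1) = ⊤ ∧
    weightSpaceA11 π B 0 = ⨆ α ∈ rootsA11 F,
      Submodule.map₂ (sop F) (weightSpaceA11 π B α) (weightSpaceA11 π B (-α))

end RootGraded

/-- `J` contains `M_{1,1}(F)⁺` as a unital subsuperalgebra: there is an injective homomorphism
`M_{1,1}(F)⁺ → J` which sends the identity matrix to a unit element of `J`. -/
def ContainsM11 (F J : Type*) [Field F] [AddCommGroup J] [Module F J] [Superalgebra F J] : Prop :=
  ∃ φ : SuperHom F (MPlus F 1 1) J, Function.Injective φ ∧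
    ∀ a : J, sop F (φ 1) a = a ∧ sop F a (φ 1) = a

end

noncomputable section
set_option linter.unusedSectionVars false

open scoped TensorProduct

/-! ### Elementary facts on superspaces and Lie superalgebras -/

section Basics

variable {F : Type*} [Field F]

/-! Let h₁ = E₁₁ - E₂₂ and h₂ = E₃₃ - E₄₄, the middle terms of the two commuting sl₂-triples that
span the even part of psl(2,2). On the roots of type A(1,1) the sum h = h₁ + h₂ takes only the
values 2, 0 and -2. A root grading therefore coarsens to a 3-grading by a diagonal sl₂-triple e, h,
f, which is the shape of a Tits–Kantor–Koecher superalgebra.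

From L to J: the weight 2 space becomes a Jordan superalgebra with unit e under x · y = [[x, f], y]
/ 2, because brackets of weight ±4 vanish and the Jacobi identity can be rewritten in terms of t(x)
= [x, f] / 2 (`t_op_op_τ`, `t_jordan`). The map τ identifies the weight 2 and weight -2 spaces, and
[x, τ(y)] acts on both as ψ(x ⊗ y) (`act_op_τ`), so L maps onto TKK(J) (`toTKK`). The kernel is
central and L is perfect as soon as the weight 0 space equals [L₂, L₋₂]; `exists_shortTriple`
deduces this from condition (3) and sl₂-theory. The matrices over M_{1,1} in the upper right
position of psl(2,2) lift to weight 2 vectors of the cover inside L, and this embeds M_{1,1}⁺ in J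
(`containsM11_of_lift`).

From J to L: TKK(J) has no centre when J is unital, so an L centrally isogenous to it covers it
(`CentrallyIsogenous.exists_cover`). J₁ and J₋₁ lift to L with all their triple products
(`exists_tkkLift`). The idempotents E₁₁ and E₂₂ of M_{1,1}⁺ are complementary in J, and their Peirce
decomposition grades L by the roots of A(1,1); the weights ±(2, -2), which are not roots, do not
occur because Peirce spaces for 1 and 0 are orthogonal (`peirce_orthogonal`, `op_xy_eq_zero`). The
cover of psl(2,2) in L is generated by the lift of M_{1,1}⁺. It is compared with sl(2,2) through a
graph in L × gl(2,2), each of whose components determines the other up to central elements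
(`pairs_fst_eq_zero`, `pairs_central`). The even part of psl(2,2) splits over it because sl₂-triples
lift and perfectness makes the two lifts commute (`exists_evenLift`).

Two principles recur. In a central extension the bracket depends only on images (`op_central`), so
eigenvectors of nonzero weight are determined by their images (`eq_of_weight`) and relations between
them can be checked downstairs. And the universal central extension of a perfect L, a quotient of L
⊗ L, is also universal for everything that L covers (`uce_isUniversal`); this turns central isogeny
into the existence of covers. -/

theorem Superspace.homogeneous_induction {V : Type*} [AddCommGroup V] [Module F V] [Superspace F V]
    {p : V → Prop} (hom : ∀ (i : ZMod 2) (x : V), x ∈ sgr F i → p x)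
    (add : ∀ x y, p x → p y → p (x + y)) (x : V) : p x := by
  rw [← Superspace.proj_add F x]
  exact add _ _ (hom _ _ (Superspace.proj_mem F 0 x)) (hom _ _ (Superspace.proj_mem F 1 x))

theorem one_add_one_add (i : ZMod 2) : 1 + (1 + i) = i := by
  revert i
  decide

theorem koszul_comm (i j : ZMod 2) : koszul F i j = koszul F j i := by
  simp [koszul, mul_comm]

theorem koszul_mul_self (i j : ZMod 2) : koszul F i j * koszul F i j = 1 := by
  rcases zmod2_eq i with rfl | rfl <;> rcases zmod2_eq j with rfl | rfl <;> simp

/-- A subspace is graded if it is stable under the projections to homogeneous components. -/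
def IsGradedSub {V : Type*} [AddCommGroup V] [Module F V] [Superspace F V]
    (A : Submodule F V) : Prop :=
  ∀ (i : ZMod 2) {x : V}, x ∈ A → Superspace.proj F i x ∈ A

theorem IsGradedSub.top {V : Type*} [AddCommGroup V] [Module F V] [Superspace F V] :
    IsGradedSub (⊤ : Submodule F V) := fun _ _ _ => Submodule.mem_top

/-- An even linear map commutes with the projections. -/
theorem Superspace.proj_map {V W : Type*} [AddCommGroup V] [Module F V] [Superspace F V]
    [AddCommGroup W] [Module F W] [Superspace F W] {f : V →ₗ[F] W}
    (hf : ∀ (i : ZMod 2) (x : V), x ∈ sgr F i → f x ∈ sgr F i) (i : ZMod 2) (x : V) :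
    Superspace.proj F i (f x) = f (Superspace.proj F i x) := by
  refine Superspace.homogeneous_induction (F := F) (p := fun x =>
    Superspace.proj F i (f x) = f (Superspace.proj F i x)) (fun j y hy => ?_)
    (fun y z hy hz => by simp only [map_add, hy, hz]) x
  by_cases h : i = j
  · subst h
    rw [Superspace.proj_same hy, Superspace.proj_same (hf _ _ hy)]
  · rw [Superspace.proj_ne hy h, Superspace.proj_ne (hf _ _ hy) h, map_zero]

theorem IsGradedSub.map {V W : Type*} [AddCommGroup V] [Module F V] [Superspace F V]
    [AddCommGroup W] [Module F W] [Superspace F W] {f : V →ₗ[F] W}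
    (hf : ∀ (i : ZMod 2) (x : V), x ∈ sgr F i → f x ∈ sgr F i) {A : Submodule F V}
    (hA : IsGradedSub A) : IsGradedSub (A.map f) := by
  rintro i _ ⟨x, hx, rfl⟩
  exact ⟨_, hA i hx, (Superspace.proj_map hf i x).symm⟩

theorem IsGradedSub.inf {V : Type*} [AddCommGroup V] [Module F V] [Superspace F V]
    {A B : Submodule F V} (hA : IsGradedSub A) (hB : IsGradedSub B) : IsGradedSub (A ⊓ B) :=
  fun i _ hx => ⟨hA i hx.1, hB i hx.2⟩

theorem IsGradedSub.map₂ {A : Type*} [AddCommGroup A] [Module F A] [Superalgebra F A]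
    {P Q : Submodule F A} (hP : IsGradedSub P) (hQ : IsGradedSub Q) :
    IsGradedSub (Submodule.map₂ (sop F) P Q) := by
  intro i x hx
  suffices h : Submodule.map₂ (sop F) P Q ≤
      (Submodule.map₂ (sop F) P Q).comap (Superspace.proj F i) from h hx
  refine Submodule.map₂_le.2 fun p hp q hq => ?_
  have key : ∀ j k : ZMod 2, Superspace.proj F i
      (sop F (Superspace.proj F j p) (Superspace.proj F k q)) ∈ Submodule.map₂ (sop F) P Q := by
    intro j k
    have hm := Superalgebra.op_mem (F := F) (Superspace.proj_mem F j p) (Superspace.proj_mem F k q)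
    by_cases h : i = j + k
    · rw [h, Superspace.proj_same hm]
      exact Submodule.apply_mem_map₂ _ (hP _ hp) (hQ _ hq)
    · rw [Superspace.proj_ne hm h]
      exact Submodule.zero_mem _
  rw [Submodule.mem_comap, ← Superspace.proj_add F p, ← Superspace.proj_add F q]
  simp only [map_add, LinearMap.add_apply]
  exact Submodule.add_mem _ (Submodule.add_mem _ (key _ _) (key _ _))
    (Submodule.add_mem _ (key _ _) (key _ _))

namespace LieSuper

variable {L : Type*} [AddCommGroup L] [Module F L] [Superalgebra F L] [IsLieSuperalgebra F L]

/-- With an even first argument all Koszul signs are 1, so ad h is an ordinary derivation and no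
homogeneity of the other arguments is needed. -/
theorem jacobi_even {h : L} (hh : h ∈ sgr F 0) (x y : L) :
    sop F h (sop F x y) = sop F (sop F h x) y + sop F x (sop F h y) := by
  refine Superspace.homogeneous_induction (F := F) (p := fun x =>
    sop F h (sop F x y) = sop F (sop F h x) y + sop F x (sop F h y)) (fun i x hx => ?_)
    (fun a b ha hb => by simp only [map_add, LinearMap.add_apply, ha, hb]; abel) x
  refine Superspace.homogeneous_induction (F := F) (p := fun y =>
    sop F h (sop F x y) = sop F (sop F h x) y + sop F x (sop F h y)) (fun j y hy => ?_)
    (fun a b ha hb => by simp only [map_add, ha, hb]; abel) y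
  simpa using IsLieSuperalgebra.jacobi hh hx hy

theorem skew_even {h : L} (hh : h ∈ sgr F 0) (x : L) : sop F h x = -sop F x h := by
  refine Superspace.homogeneous_induction (F := F) (p := fun x => sop F h x = -sop F x h)
    (fun i x hx => ?_) (fun a b ha hb => by simp only [map_add, LinearMap.add_apply, ha, hb]; abel) x
  simpa using IsLieSuperalgebra.skew hh hx

/-- The second argument of the Jacobi identity taken even. -/
theorem jacobi_even_mid {i : ZMod 2} {x f : L} (hf : f ∈ sgr F 0) (hx : x ∈ sgr F i) (y : L) :
    sop F x (sop F f y) = sop F (sop F x f) y + sop F f (sop F x y) := by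
  refine Superspace.homogeneous_induction (F := F) (p := fun y =>
    sop F x (sop F f y) = sop F (sop F x f) y + sop F f (sop F x y)) (fun j y hy => ?_)
    (fun a b ha hb => by simp only [map_add, ha, hb]; abel) y
  simpa using IsLieSuperalgebra.jacobi hx hf hy

/-- Skew-symmetry on the level of graded subspaces. -/
theorem op_mem_of_swap {A B Q : Submodule F L} (hA : IsGradedSub A) (hB : IsGradedSub B)
    (h : ∀ b ∈ B, ∀ a ∈ A, sop F b a ∈ Q) {a b : L} (ha : a ∈ A) (hb : b ∈ B) :
    sop F a b ∈ Q := by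
  have key : ∀ i j : ZMod 2, sop F (Superspace.proj F i a) (Superspace.proj F j b) ∈ Q := by
    intro i j
    rw [IsLieSuperalgebra.skew (Superspace.proj_mem F i a) (Superspace.proj_mem F j b)]
    exact Submodule.neg_mem _ (Submodule.smul_mem _ _ (h _ (hB _ hb) _ (hA _ ha)))
  rw [← Superspace.proj_add F a, ← Superspace.proj_add F b]
  simp only [map_add, LinearMap.add_apply]
  exact Submodule.add_mem _ (Submodule.add_mem _ (key _ _) (key _ _))
    (Submodule.add_mem _ (key _ _) (key _ _))

/-- The Jacobi identity on the level of graded subspaces. -/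
theorem op_mem_of_jacobi {A B C Q : Submodule F L} (hA : IsGradedSub A) (hB : IsGradedSub B)
    (h1 : ∀ a ∈ A, ∀ b ∈ B, ∀ c ∈ C, sop F (sop F a b) c ∈ Q)
    (h2 : ∀ a ∈ A, ∀ b ∈ B, ∀ c ∈ C, sop F b (sop F a c) ∈ Q) (hC : IsGradedSub C)
    {a b c : L} (ha : a ∈ A) (hb : b ∈ B) (hc : c ∈ C) :
    sop F a (sop F b c) ∈ Q := by
  have key : ∀ i j k : ZMod 2, sop F (Superspace.proj F i a)
      (sop F (Superspace.proj F j b) (Superspace.proj F k c)) ∈ Q := by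
    intro i j k
    rw [IsLieSuperalgebra.jacobi (Superspace.proj_mem F i a) (Superspace.proj_mem F j b)
      (Superspace.proj_mem F k c)]
    exact Submodule.add_mem _ (h1 _ (hA _ ha) _ (hB _ hb) _ (hC _ hc))
      (Submodule.smul_mem _ _ (h2 _ (hA _ ha) _ (hB _ hb) _ (hC _ hc)))
  rw [← Superspace.proj_add F a, ← Superspace.proj_add F b, ← Superspace.proj_add F c]
  simp only [map_add, LinearMap.add_apply]
  exact Submodule.add_mem _ (Submodule.add_mem _ (Submodule.add_mem _ (key _ _ _) (key _ _ _))
    (Submodule.add_mem _ (key _ _ _) (key _ _ _)))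
    (Submodule.add_mem _ (Submodule.add_mem _ (key _ _ _) (key _ _ _))
    (Submodule.add_mem _ (key _ _ _) (key _ _ _)))

variable (F) in
/-- The annihilator of a subspace. -/
def annihilator (A : Submodule F L) : Submodule F L where
  carrier := {z | ∀ a ∈ A, sop F z a = 0}
  zero_mem' a _ := by simp
  add_mem' hx hy a ha := by rw [map_add, LinearMap.add_apply, hx a ha, hy a ha, add_zero]
  smul_mem' c x hx a ha := by rw [map_smul, LinearMap.smul_apply, hx a ha, smul_zero]

/-- For homogeneous components a_j of a, the equation [z, a_j] = 0 splits by degree, and its part of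
degree i + j is [z_i, a_j]. -/
theorem annihilator_graded {A : Submodule F L} (hA : IsGradedSub A) :
    IsGradedSub (annihilator F A) := by
  intro i z hz a ha
  have key : ∀ j : ZMod 2, sop F (Superspace.proj F i z) (Superspace.proj F j a) = 0 := by
    intro j
    have h := congrArg (Superspace.proj F (i + j)) (hz _ (hA j ha))
    rw [← Superspace.proj_add F z, map_add, LinearMap.add_apply, map_add, map_zero] at h
    have hm := fun k => Superalgebra.op_mem (F := F) (Superspace.proj_mem F k z)
      (Superspace.proj_mem F j a)
    rcases zmod2_eq i with rfl | rfl
    · rwa [Superspace.proj_same (hm 0), Superspace.proj_ne (hm 1) (by simp), add_zero] at h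
    · rwa [Superspace.proj_same (hm 1), Superspace.proj_ne (hm 0) (by simp), _root_.zero_add] at h
  rw [← Superspace.proj_add F a, map_add, key, key, add_zero]

theorem op_eq_zero_of_swap {A : Submodule F L} (hA : IsGradedSub A) {z a : L}
    (hz : z ∈ annihilator F A) (ha : a ∈ A) : sop F a z = 0 :=
  (Submodule.mem_bot F).1 (op_mem_of_swap hA (annihilator_graded hA)
    (fun _ hb _ ha => (Submodule.mem_bot F).2 (hb _ ha)) ha hz)

/-- If `z` annihilates the graded subspaces `A` and `B`, it annihilates `[A, B]`. -/
theorem annihilator_map₂ {A B : Submodule F L} (hA : IsGradedSub A) (hB : IsGradedSub B) {z : L}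
    (hzA : z ∈ annihilator F A) (hzB : z ∈ annihilator F B) :
    z ∈ annihilator F (Submodule.map₂ (sop F) A B) := by
  have hg : IsGradedSub (annihilator F A ⊓ annihilator F B) :=
    (annihilator_graded hA).inf (annihilator_graded hB)
  have hle : Submodule.map₂ (sop F) A B ≤ LinearMap.ker (sop F z) := by
    refine Submodule.map₂_le.2 fun a ha b hb => ?_
    refine (Submodule.mem_bot F).1 (op_mem_of_jacobi hg hA ?_ ?_ hB ⟨hzA, hzB⟩ ha hb)
    · intro z hz a ha b _
      simp [hz.1 a ha]
    · intro z hz a _ b hb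
      simp [hz.2 b hb]
  exact fun x hx => hle hx

end LieSuper

theorem IsPerfectSuper.mem {L : Type*} [AddCommGroup L] [Module F L] [Superalgebra F L]
    (h : IsPerfectSuper F L) (x : L) : x ∈ Submodule.map₂ (sop F (A := L)) ⊤ ⊤ := by
  rw [IsPerfectSuper] at h
  rw [h]
  exact Submodule.mem_top

theorem IsPerfectSuper.of_surjective {L M : Type*} [AddCommGroup L] [Module F L]
    [Superalgebra F L] [AddCommGroup M] [Module F M] [Superalgebra F M] (h : IsPerfectSuper F L)
    (ρ : SuperHom F L M) (hρ : Function.Surjective ρ) : IsPerfectSuper F M := by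
  refine Submodule.eq_top_iff'.2 fun y => ?_
  obtain ⟨x, rfl⟩ := hρ y
  suffices hle : Submodule.map₂ (sop F (A := L)) ⊤ ⊤ ≤
      (Submodule.map₂ (sop F (A := M)) ⊤ ⊤).comap ρ.toLinearMap from hle (h.mem x)
  refine Submodule.map₂_le.2 fun a _ b _ => ?_
  rw [Submodule.mem_comap, ρ.map_op]
  exact Submodule.apply_mem_map₂ _ Submodule.mem_top Submodule.mem_top

end Basics

/-! ### The universal central extension of a perfect Lie superalgebra -/

section Universal

variable {F : Type*} [Field F]

/-- Composition of homomorphisms. -/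
def SuperHom.comp {A B C : Type*} [AddCommGroup A] [Module F A] [Superalgebra F A]
    [AddCommGroup B] [Module F B] [Superalgebra F B] [AddCommGroup C] [Module F C]
    [Superalgebra F C] (g : SuperHom F B C) (f : SuperHom F A B) : SuperHom F A C where
  toLinearMap := g.toLinearMap ∘ₗ f.toLinearMap
  map_grade hx := g.map_grade (f.map_grade hx)
  map_op x y := by
    rw [LinearMap.comp_apply, f.map_op, g.map_op]
    rfl

variable (F) in
/-- The identity homomorphism. -/
def SuperHom.id (A : Type*) [AddCommGroup A] [Module F A] [Superalgebra F A] :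
    SuperHom F A A where
  toLinearMap := LinearMap.id
  map_grade hx := hx
  map_op _ _ := rfl

theorem SuperHom.ext {A B : Type*} [AddCommGroup A] [Module F A] [Superalgebra F A]
    [AddCommGroup B] [Module F B] [Superalgebra F B] {f g : SuperHom F A B}
    (h : ∀ x, f x = g x) : f = g := by
  obtain ⟨f, _, _⟩ := f
  obtain ⟨g, _, _⟩ := g
  have : f = g := LinearMap.ext h
  subst this
  rfl

/-- Altering an argument by an element of the kernel alters the bracket by a bracket with a central
element. Hence brackets upstairs are functions of the images, which is how relations are transported
along central extensions below. -/
theorem IsCentralExtension.op_central {E M : Type*} [AddCommGroup E] [Module F E]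
    [Superalgebra F E] [AddCommGroup M] [Module F M] [Superalgebra F M] {ε : SuperHom F E M}
    (hε : IsCentralExtension ε) {x x' y y' : E} (hx : ε x = ε x') (hy : ε y = ε y') :
    sop F x y = sop F x' y' := by
  have := hε.lie
  have h1 : sop F (x - x') y = 0 := hε.central _ (by rw [map_sub, hx, sub_self]) _
  have h2 : sop F x' (y - y') = 0 := by
    refine LieSuper.op_eq_zero_of_swap (F := F) IsGradedSub.top (fun a _ => ?_) Submodule.mem_top
    exact hε.central _ (by rw [map_sub, hy, sub_self]) _
  rw [map_sub, LinearMap.sub_apply, sub_eq_zero] at h1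
  rw [map_sub, sub_eq_zero] at h2
  rw [h1, h2]

/-- A surjective even map has an even linear section. -/
theorem exists_even_section {E M : Type*} [AddCommGroup E] [Module F E] [Superalgebra F E]
    [AddCommGroup M] [Module F M] [Superalgebra F M] (ε : SuperHom F E M)
    (hε : Function.Surjective ε) : ∃ s : M →ₗ[F] E, (∀ x, ε (s x) = x) ∧
      ∀ (i : ZMod 2) (x : M), x ∈ sgr F i → s x ∈ sgr F i := by
  obtain ⟨s, hs⟩ := ε.toLinearMap.exists_rightInverse_of_surjective (LinearMap.range_eq_top.2 hε)
  have hs' : ∀ x, ε.toLinearMap (s x) = x := fun x => LinearMap.congr_fun hs x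
  -- The even component of an arbitrary linear section is again a section, because ε commutes with
  -- the projections.
  refine ⟨Superspace.proj F 0 ∘ₗ s ∘ₗ Superspace.proj F 0
    + Superspace.proj F 1 ∘ₗ s ∘ₗ Superspace.proj F 1, fun x => ?_, fun i x hx => ?_⟩
  · have hp := Superspace.proj_map (f := ε.toLinearMap) (fun i x hx => ε.map_grade hx)
    simp only [LinearMap.add_apply, LinearMap.comp_apply, map_add, ← hp, hs']
    rw [Superspace.proj_same (Superspace.proj_mem F 0 x),
      Superspace.proj_same (Superspace.proj_mem F 1 x), Superspace.proj_add]
  · rcases zmod2_eq i with rfl | rfl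
    · simpa [Superspace.proj_ne hx (show (1 : ZMod 2) ≠ 0 by decide)] using
        Superspace.proj_mem F 0 _
    · simpa [Superspace.proj_ne hx (show (0 : ZMod 2) ≠ 1 by decide)] using
        Superspace.proj_mem F 1 _

/-! ### The grading of V ⊗ V. -/

section Tensor

variable (F) (V : Type*) [AddCommGroup V] [Module F V] [Superspace F V]

/-- The projections of `V ⊗ V` to its homogeneous components. -/
def tensorProj (i : ZMod 2) : V ⊗[F] V →ₗ[F] V ⊗[F] V :=
  TensorProduct.map (Superspace.proj F 0) (Superspace.proj F i)
    + TensorProduct.map (Superspace.proj F 1) (Superspace.proj F (1 + i))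

variable {F V}

theorem tensorProj_tmul {i j : ZMod 2} {x y : V} (hx : x ∈ sgr F i) (hy : y ∈ sgr F j) :
    tensorProj F V (i + j) (x ⊗ₜ y) = x ⊗ₜ y := by
  have hx2 := Superspace.proj_same hx
  have hy2 := Superspace.proj_same hy
  rcases zmod2_eq i with rfl | rfl
  · simp [tensorProj, Superspace.proj_ne hx (show (1 : ZMod 2) ≠ 0 by decide), hx2, hy2]
  · have h := one_add_one_add j
    simp [tensorProj, Superspace.proj_ne hx (show (0 : ZMod 2) ≠ 1 by decide), hx2, hy2, h]

theorem tensorProj_add (t : V ⊗[F] V) : tensorProj F V 0 t + tensorProj F V 1 t = t := by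
  induction t using TensorProduct.induction_on with
  | zero => simp
  | tmul x y =>
    simp only [tensorProj, LinearMap.add_apply, TensorProduct.map_tmul, add_zero,
      show (1 + 1 : ZMod 2) = 0 from rfl]
    rw [show ∀ a b c d : V ⊗[F] V, a + b + (c + d) = (a + c) + (d + b) by intros; abel,
      ← TensorProduct.tmul_add, ← TensorProduct.tmul_add, Superspace.proj_add,
      ← TensorProduct.add_tmul, Superspace.proj_add]
  | add x y hx hy =>
    nth_rw 3 [← hx, ← hy]
    simp only [map_add]
    abel

theorem tensorProj_idem (i : ZMod 2) (t : V ⊗[F] V) :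
    tensorProj F V i (tensorProj F V i t) = tensorProj F V i t := by
  induction t using TensorProduct.induction_on with
  | zero => simp
  | tmul x y =>
    have h0 := tensorProj_tmul (Superspace.proj_mem F 0 x) (Superspace.proj_mem F i y)
    have h1 := tensorProj_tmul (Superspace.proj_mem F 1 x) (Superspace.proj_mem F (1 + i) y)
    rw [_root_.zero_add] at h0
    rw [one_add_one_add] at h1
    have h2 : tensorProj F V i (x ⊗ₜ y) = Superspace.proj F 0 x ⊗ₜ Superspace.proj F i y
      + Superspace.proj F 1 x ⊗ₜ Superspace.proj F (1 + i) y := rfl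
    rw [h2, map_add, h0, h1]
  | add x y hx hy => simp only [map_add, hx, hy]

/-- Homogeneous components are taken as fixed spaces of complementary idempotents, which avoids
decomposing the tensor product into four summands. -/
instance : Superspace F (V ⊗[F] V) where
  grade i := LinearMap.eqLocus (tensorProj F V i) LinearMap.id
  isCompl := by
    refine Superspace.isCompl_of_decomp (fun t h0 h1 => ?_) fun t => ?_
    · have h := tensorProj_add t
      rw [show tensorProj F V 0 t = t from h0, show tensorProj F V 1 t = t from h1] at h
      exact add_eq_left.1 h
    · exact ⟨_, tensorProj_idem 0 t, _, tensorProj_idem 1 t, tensorProj_add t⟩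

theorem tmul_mem_grade {i j : ZMod 2} {x y : V} (hx : x ∈ sgr F i) (hy : y ∈ sgr F j) :
    (x ⊗ₜ y : V ⊗[F] V) ∈ sgr F (i + j) := tensorProj_tmul hx hy

/-- A linear map on `V ⊗ V` coming from an even bilinear map is even. -/
theorem lift_mem_grade {W : Type*} [AddCommGroup W] [Module F W] [Superspace F W]
    {f : V ⊗[F] V →ₗ[F] W} (hf : ∀ (i j : ZMod 2) (x y : V), x ∈ sgr F i → y ∈ sgr F j →
      f (x ⊗ₜ y) ∈ sgr F (i + j)) {i : ZMod 2} {t : V ⊗[F] V} (ht : t ∈ sgr F i) :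
    f t ∈ sgr F i := by
  have ht' : tensorProj F V i t = t := ht
  rw [← ht']
  clear ht ht'
  induction t using TensorProduct.induction_on with
  | zero => simp
  | tmul x y =>
    have h0 := hf _ _ _ _ (Superspace.proj_mem F 0 x) (Superspace.proj_mem F i y)
    have h1 := hf _ _ _ _ (Superspace.proj_mem F 1 x) (Superspace.proj_mem F (1 + i) y)
    rw [_root_.zero_add] at h0
    rw [one_add_one_add] at h1
    simp only [tensorProj, LinearMap.add_apply, TensorProduct.map_tmul, map_add]
    exact Submodule.add_mem _ h0 h1
  | add x y hx hy =>
    rw [map_add, map_add]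
    exact Submodule.add_mem _ hx hy

end Tensor

/-! ### The universal central extension as a quotient of L ⊗ L. -/

section Bracket

variable (F) (L : Type*) [AddCommGroup L] [Module F L] [Superalgebra F L]

/-- The bracket as a linear map `L ⊗ L → L`. -/
def bracketMap : L ⊗[F] L →ₗ[F] L := TensorProduct.lift (sop F)

variable {F L}

theorem bracketMap_mem {i : ZMod 2} {t : L ⊗[F] L} (ht : t ∈ sgr F i) :
    bracketMap F L t ∈ sgr F i :=
  lift_mem_grade (fun _ _ _ _ hx hy => by
    simpa [bracketMap] using Superalgebra.op_mem (F := F) hx hy) ht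

/-- `L ⊗ L` with the product `X * Y = [X] ⊗ [Y]`, where `[x ⊗ y] = [x, y]`. -/
instance tensorSuperalgebra : Superalgebra F (L ⊗[F] L) where
  op := (TensorProduct.mk F L L).compl₁₂ (bracketMap F L) (bracketMap F L)
  op_mem hx hy := tmul_mem_grade (bracketMap_mem hx) (bracketMap_mem hy)

theorem tensor_sop (X Y : L ⊗[F] L) :
    sop F X Y = bracketMap F L X ⊗ₜ bracketMap F L Y := rfl

variable (F L) in
/-- The relations defining the universal central extension as a quotient of `L ⊗ L`. -/
def uceRelations : Set (L ⊗[F] L) :=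
  {t | (∃ (i j : ZMod 2) (x y : L), x ∈ sgr F i ∧ y ∈ sgr F j ∧
      t = x ⊗ₜ y + koszul F i j • (y ⊗ₜ x)) ∨
    ∃ (i j k : ZMod 2) (x y z : L), x ∈ sgr F i ∧ y ∈ sgr F j ∧ z ∈ sgr F k ∧
      t = x ⊗ₜ sop F y z - (sop F x y ⊗ₜ z + koszul F i j • (y ⊗ₜ sop F x z))}

theorem uceRelations_homogeneous {t : L ⊗[F] L} (ht : t ∈ uceRelations F L) :
    ∃ i : ZMod 2, t ∈ sgr F i := by
  obtain ⟨i, j, x, y, hx, hy, rfl⟩ | ⟨i, j, k, x, y, z, hx, hy, hz, rfl⟩ := ht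
  · exact ⟨i + j, Submodule.add_mem _ (tmul_mem_grade hx hy)
      (Submodule.smul_mem _ _ (add_comm j i ▸ tmul_mem_grade hy hx))⟩
  · have m := @Superalgebra.op_mem F L _ _ _ _
    refine ⟨i + j + k, Submodule.sub_mem _ ?_ (Submodule.add_mem _ (tmul_mem_grade (m hx hy) hz)
      (Submodule.smul_mem _ _ ?_))⟩
    · rw [add_assoc]
      exact tmul_mem_grade hx (m hy hz)
    · rw [add_comm i j, add_assoc]
      exact tmul_mem_grade hy (m hx hz)

variable [IsLieSuperalgebra F L]

/-- The product of L ⊗ L factors through the bracket in both arguments. Vanishing of the bracket on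
the relations therefore makes their span a two-sided ideal, and it also yields the projection to L.
-/
theorem uceRelations_bracket : Submodule.span F (uceRelations F L) ≤
    LinearMap.ker (bracketMap F L) := by
  refine Submodule.span_le.2 ?_
  rintro t (⟨i, j, x, y, hx, hy, rfl⟩ | ⟨i, j, k, x, y, z, hx, hy, hz, rfl⟩)
  · simp [bracketMap, IsLieSuperalgebra.skew hx hy]
  · simp [bracketMap, IsLieSuperalgebra.jacobi hx hy hz]

variable (F L) in
/-- The ideal of relations. -/
def uceIdeal : SuperIdeal F (L ⊗[F] L) where
  carrier := Submodule.span F (uceRelations F L)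
  proj_mem i t ht := by
    suffices h : Submodule.span F (uceRelations F L) ≤
        (Submodule.span F (uceRelations F L)).comap (Superspace.proj F i) from h ht
    refine Submodule.span_le.2 fun t ht => ?_
    obtain ⟨j, hj⟩ := uceRelations_homogeneous ht
    rw [SetLike.mem_coe, Submodule.mem_comap]
    by_cases h : i = j
    · rw [h, Superspace.proj_same hj]
      exact Submodule.subset_span ht
    · rw [Superspace.proj_ne hj h]
      exact Submodule.zero_mem _
  op_mem_left {x y} hx := by
    rw [tensor_sop, LinearMap.mem_ker.1 (uceRelations_bracket hx), TensorProduct.zero_tmul]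
    exact Submodule.zero_mem _
  op_mem_right {x y} hy := by
    rw [tensor_sop, LinearMap.mem_ker.1 (uceRelations_bracket hy), TensorProduct.tmul_zero]
    exact Submodule.zero_mem _

variable (F L) in
/-- The universal central extension of a perfect Lie superalgebra. -/
abbrev UCE : Type _ := (L ⊗[F] L) ⧸ (uceIdeal F L).carrier

/-- The class of `x ⊗ y`. -/
def uceMk (x y : L) : UCE F L := (uceIdeal F L).carrier.mkQ (x ⊗ₜ y)

theorem uceMk_skew {i j : ZMod 2} {x y : L} (hx : x ∈ sgr F i) (hy : y ∈ sgr F j) :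
    uceMk (F := F) x y = -(koszul F i j • uceMk y x) := by
  rw [eq_neg_iff_add_eq_zero]
  exact (Submodule.Quotient.mk_eq_zero _).2 (Submodule.subset_span (Or.inl ⟨i, j, x, y, hx, hy, rfl⟩))

theorem uceMk_jacobi {i j k : ZMod 2} {x y z : L} (hx : x ∈ sgr F i) (hy : y ∈ sgr F j)
    (hz : z ∈ sgr F k) : uceMk (F := F) x (sop F y z) =
      uceMk (sop F x y) z + koszul F i j • uceMk y (sop F x z) := by
  rw [← sub_eq_zero]
  exact (Submodule.Quotient.mk_eq_zero _).2
    (Submodule.subset_span (Or.inr ⟨i, j, k, x, y, z, hx, hy, hz, rfl⟩))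

variable (F L) in
/-- The projection of the universal central extension. -/
def uceHom : SuperHom F (UCE F L) L where
  toLinearMap := (uceIdeal F L).carrier.liftQ (bracketMap F L) uceRelations_bracket
  map_grade := by
    rintro i _ ⟨t, ht, rfl⟩
    exact bracketMap_mem ht
  map_op x y := by
    obtain ⟨x, rfl⟩ := (uceIdeal F L).carrier.mkQ_surjective x
    obtain ⟨y, rfl⟩ := (uceIdeal F L).carrier.mkQ_surjective y
    rw [quot_op_mk, tensor_sop]
    simp [bracketMap]

/-- Brackets depend only on the images in L, so skew-symmetry and the Jacobi identity of the
quotient are precisely the relations that were imposed. -/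
theorem uce_sop (x y : UCE F L) : sop F x y = uceMk (uceHom F L x) (uceHom F L y) := by
  obtain ⟨x, rfl⟩ := (uceIdeal F L).carrier.mkQ_surjective x
  obtain ⟨y, rfl⟩ := (uceIdeal F L).carrier.mkQ_surjective y
  rfl

instance : IsLieSuperalgebra F (UCE F L) where
  skew hx hy := by
    rw [uce_sop, uce_sop]
    exact uceMk_skew ((uceHom F L).map_grade hx) ((uceHom F L).map_grade hy)
  jacobi {i j k x y z} hx hy hz := by
    have h := uceMk_jacobi ((uceHom F L).map_grade hx) ((uceHom F L).map_grade hy)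
      ((uceHom F L).map_grade hz)
    rw [uce_sop x (sop F y z), uce_sop (sop F x y) z, uce_sop y (sop F x z), (uceHom F L).map_op,
      (uceHom F L).map_op, (uceHom F L).map_op]
    exact h

theorem uceHom_surjective (h : IsPerfectSuper F L) : Function.Surjective (uceHom F L) := by
  intro x
  suffices hle : Submodule.map₂ (sop F (A := L)) ⊤ ⊤ ≤
    LinearMap.range (uceHom F L).toLinearMap from hle (h.mem x)
  exact Submodule.map₂_le.2 fun a _ b _ => ⟨uceMk a b, rfl⟩

theorem uce_perfect (h : IsPerfectSuper F L) : IsPerfectSuper F (UCE F L) := by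
  refine Submodule.eq_top_iff'.2 fun X => ?_
  obtain ⟨t, rfl⟩ := (uceIdeal F L).carrier.mkQ_surjective X
  induction t using TensorProduct.induction_on with
  | zero => simp
  | add x y hx hy => rw [map_add]; exact Submodule.add_mem _ hx hy
  | tmul x y =>
    obtain ⟨X, rfl⟩ := uceHom_surjective h x
    obtain ⟨Y, rfl⟩ := uceHom_surjective h y
    have := uce_sop X Y
    rw [uceMk] at this
    rw [← this]
    exact Submodule.apply_mem_map₂ _ Submodule.mem_top Submodule.mem_top

/-- As L is perfect, y may be taken to be a bracket [a, b], and the Jacobi relation writes z ⊗ [a,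
b] through [z, a] = 0 and [z, b] = 0. This keeps a composite UCE(L) → L → M central even though
composites of central extensions need not be central. -/
theorem uceMk_central (h : IsPerfectSuper F L) {z : L} (hz : ∀ y, sop F z y = 0) (y : L) :
    uceMk (F := F) z y = 0 := by
  have hg : ∀ (i : ZMod 2) (y : L), sop F (Superspace.proj F i z) y = 0 := fun i y =>
    LieSuper.annihilator_graded (F := F) IsGradedSub.top i (fun y _ => hz y) y Submodule.mem_top
  have key : ∀ (i j k : ZMod 2) (a b : L), a ∈ sgr F j → b ∈ sgr F k →
      uceMk (F := F) (Superspace.proj F i z) (sop F a b) = 0 := by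
    intro i j k a b ha hb
    rw [uceMk_jacobi (Superspace.proj_mem F i z) ha hb, hg, hg]
    simp [uceMk]
  let f : L →ₗ[F] UCE F L := (uceIdeal F L).carrier.mkQ ∘ₗ TensorProduct.mk F L L z
  suffices hle : Submodule.map₂ (sop F (A := L)) ⊤ ⊤ ≤ LinearMap.ker f from hle (h.mem y)
  refine Submodule.map₂_le.2 fun a _ b _ => ?_
  rw [LinearMap.mem_ker]
  refine Superspace.homogeneous_induction (F := F) (p := fun a => f (sop F a b) = 0)
    (fun j a ha => ?_) (fun x y hx hy => by
      rw [map_add, LinearMap.add_apply, map_add, hx, hy, add_zero]) a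
  refine Superspace.homogeneous_induction (F := F) (p := fun b => f (sop F a b) = 0)
    (fun k b hb => ?_) (fun x y hx hy => by rw [map_add, map_add, hx, hy, add_zero]) b
  have h0 := key 0 j k a b ha hb
  have h1 := key 1 j k a b ha hb
  have : f (sop F a b) = uceMk (F := F) (Superspace.proj F 0 z) (sop F a b)
      + uceMk (F := F) (Superspace.proj F 1 z) (sop F a b) := by
    rw [uceMk, uceMk, ← map_add, ← TensorProduct.add_tmul, Superspace.proj_add]
    rfl
  rw [this, h0, h1, add_zero]

end Bracket

/-- For a central extension `ρ : L → M` with `L` perfect, `UCE(L) → L → M` is the universal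
central extension of `M`. -/
theorem uce_isUniversal {F : Type u} [Field F] {L M : Type v} [AddCommGroup L] [Module F L]
    [Superalgebra F L] [IsLieSuperalgebra F L] [AddCommGroup M] [Module F M] [Superalgebra F M]
    (hL : IsPerfectSuper F L) (ρ : SuperHom F L M) (hρ : IsCentralExtension ρ) :
    IsUniversalCentralExtension (ρ.comp (uceHom F L)) where
  lie := inferInstance
  surjective := hρ.surjective.comp (uceHom_surjective hL)
  central x hx y := by
    rw [uce_sop]
    exact uceMk_central hL (hρ.central _ hx) _
  perfect := uce_perfect hL
  universal E _ _ _ ε hε := by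
    have := hε.lie
    -- A linear section suffices: the candidate x ⊗ y ↦ [s(ρ x), s(ρ y)] does not depend on its
    -- choice, by `op_central`.
    obtain ⟨s, hs, hsg⟩ := exists_even_section ε hε.surjective
    have hrg : ∀ (i : ZMod 2) (x : L), x ∈ sgr F i → s (ρ x) ∈ sgr F i := fun i x hx =>
      hsg i _ (ρ.map_grade hx)
    let σ : L →ₗ[F] E := s ∘ₗ ρ.toLinearMap
    have hσ : ∀ x, ε (σ x) = ρ x := fun x => hs _
    let g : L ⊗[F] L →ₗ[F] E := TensorProduct.lift ((sop F).compl₁₂ σ σ)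
    have hg : ∀ x y, g (x ⊗ₜ y) = sop F (σ x) (σ y) := fun x y => rfl
    have hεg : ∀ t, ε (g t) = ρ (bracketMap F L t) := by
      intro t
      induction t using TensorProduct.induction_on with
      | zero => simp
      | tmul x y =>
        rw [hg, ε.map_op]
        rw [hσ, hσ, ← ρ.map_op]
        rfl
      | add x y hx hy => simp only [map_add, hx, hy]
    -- σ is multiplicative only modulo the kernel of ε, but outer brackets do not see that kernel;
    -- this is what makes g respect the Jacobi relations.
    have hop : ∀ x y, ε (σ (sop F x y)) = ε (sop F (σ x) (σ y)) := by
      intro x y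
      rw [hσ, ρ.map_op, ε.map_op]
      rw [hσ, hσ]
    have hker : Submodule.span F (uceRelations F L) ≤ LinearMap.ker g := by
      refine Submodule.span_le.2 ?_
      rintro t (⟨i, j, x, y, hx, hy, rfl⟩ | ⟨i, j, k, x, y, z, hx, hy, hz, rfl⟩)
      · have h := IsLieSuperalgebra.skew (hrg _ _ hx) (hrg _ _ hy)
        rw [SetLike.mem_coe, LinearMap.mem_ker, map_add, map_smul, hg, hg, ← eq_neg_iff_add_eq_zero]
        exact h
      · have h := IsLieSuperalgebra.jacobi (hrg _ _ hx) (hrg _ _ hy) (hrg _ _ hz)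
        rw [SetLike.mem_coe, LinearMap.mem_ker, map_sub, map_add, map_smul, hg, hg, hg, sub_eq_zero,
          hε.op_central rfl (hop y z), hε.op_central rfl (hop x z), hε.op_central (hop x y) rfl]
        exact h
    let φ : SuperHom F (UCE F L) E :=
      { toLinearMap := (uceIdeal F L).carrier.liftQ g hker
        map_grade := by
          rintro i _ ⟨t, ht, rfl⟩
          exact lift_mem_grade (f := g) (fun _ _ _ _ hx hy =>
            Superalgebra.op_mem (hrg _ _ hx) (hrg _ _ hy)) ht
        map_op := by
          intro X Y
          obtain ⟨X, rfl⟩ := (uceIdeal F L).carrier.mkQ_surjective X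
          obtain ⟨Y, rfl⟩ := (uceIdeal F L).carrier.mkQ_surjective Y
          exact hε.op_central ((hσ _).trans (hεg X).symm) ((hσ _).trans (hεg Y).symm) }
    have hφ : ∀ X, ε (φ X) = ρ.comp (uceHom F L) X := by
      intro X
      obtain ⟨X, rfl⟩ := (uceIdeal F L).carrier.mkQ_surjective X
      exact hεg X
    refine ⟨φ, hφ, fun φ' hφ' => SuperHom.ext fun X => ?_⟩
    -- Uniqueness: two lifts of the same map agree on brackets, and these span the perfect UCE(L).
    have hle : Submodule.map₂ (sop F (A := UCE F L)) ⊤ ⊤ ≤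
        LinearMap.eqLocus φ'.toLinearMap φ.toLinearMap := by
      refine Submodule.map₂_le.2 fun a _ b _ => ?_
      rw [LinearMap.mem_eqLocus, φ'.map_op, φ.map_op]
      exact hε.op_central ((hφ' a).trans (hφ a).symm) ((hφ' b).trans (hφ b).symm)
    exact hle ((uce_perfect hL).mem X)

/-- A perfect central extension of `M` is centrally isogenous to `M`. -/
theorem centrallyIsogenous_of_cover {F : Type u} [Field F] {L M : Type v} [AddCommGroup L]
    [Module F L] [Superalgebra F L] [AddCommGroup M] [Module F M]
    [Superalgebra F M] [IsLieSuperalgebra F M] (ρ : SuperHom F L M) (hρ : IsCover ρ) :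
    CentrallyIsogenous F L M := by
  have := hρ.lie
  -- The single algebra UCE(L) serves both sides: over L through the identity, over M through ρ.
  refine ⟨inferInstance, hρ.perfect, inferInstance, hρ.perfect.of_surjective ρ hρ.surjective,
    UCE F L, inferInstance, inferInstance, inferInstance, (SuperHom.id F L).comp (uceHom F L),
    ρ.comp (uceHom F L), uce_isUniversal hρ.perfect _ ⟨inferInstance, fun x => ⟨x, rfl⟩, ?_⟩,
    uce_isUniversal hρ.perfect _ hρ.toIsCentralExtension⟩
  intro x hx y
  rw [show x = 0 from hx, map_zero, LinearMap.zero_apply]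

end Universal
end

noncomputable section
set_option linter.unusedSectionVars false

/-! ### Weight spaces of an even element -/

section Weight

variable {F L : Type*} [Field F] [AddCommGroup L] [Module F L] [Superalgebra F L]

variable (F) in
/-- The eigenspace of `ad h` for the eigenvalue `c`. -/
def adWeight (h : L) (c : F) : Submodule F L where
  carrier := {x | sop F h x = c • x}
  zero_mem' := by simp
  add_mem' {x y} hx hy := by
    change sop F h (x + y) = c • (x + y)
    rw [map_add, hx, hy, smul_add]
  smul_mem' a x hx := by
    change sop F h (a • x) = c • a • x
    rw [map_smul, hx, smul_comm]

theorem mem_adWeight {h : L} {c : F} {x : L} : x ∈ adWeight F h c ↔ sop F h x = c • x := Iff.rfl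

theorem adWeight_graded {h : L} (hh : h ∈ sgr F 0) (c : F) : IsGradedSub (adWeight F h c) := by
  intro i x hx
  have hp := Superspace.proj_map (f := sop F h) (fun i x hx => by
    simpa using Superalgebra.op_mem (F := F) hh hx) i x
  rw [mem_adWeight, ← hp, mem_adWeight.1 hx, map_smul]

variable [IsLieSuperalgebra F L]

theorem adWeight_op {h : L} (hh : h ∈ sgr F 0) {a b : F} {x y : L} (hx : x ∈ adWeight F h a)
    (hy : y ∈ adWeight F h b) : sop F x y ∈ adWeight F h (a + b) := by
  rw [mem_adWeight, LieSuper.jacobi_even hh, mem_adWeight.1 hx, mem_adWeight.1 hy, map_smul,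
    map_smul, LinearMap.smul_apply, add_smul]

end Weight

/-! ### Short gradings by an `sl₂`-triple -/

/-- An even `sl₂`-triple `e, h, f` such that `ad h` is diagonalizable with eigenvalues
`2, 0, -2` and the eigenspace of `0` is `[L₂, L₋₂]`. -/
structure ShortTriple (F L : Type*) [Field F] [AddCommGroup L] [Module F L]
    [Superalgebra F L] where
  e : L
  h : L
  f : L
  e_even : e ∈ sgr F 0
  h_even : h ∈ sgr F 0
  f_even : f ∈ sgr F 0
  he : sop F h e = (2 : F) • e
  hf : sop F h f = (-2 : F) • f
  ef : sop F e f = h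
  cube : ∀ x, sop F h (sop F h (sop F h x)) = (4 : F) • sop F h x
  zero_le : adWeight F h 0 ≤ Submodule.map₂ (sop F) (adWeight F h 2) (adWeight F h (-2))

namespace ShortTriple

variable {F L : Type*} [Field F] [CharZero F] [AddCommGroup L] [Module F L] [Superalgebra F L]
  (T : ShortTriple F L)

/-- The field `cube` says that X³ - 4X annihilates ad h, so every eigenvalue is a root of this
polynomial. The weights ±4 are excluded in this way. -/
theorem eq_zero_of_weight {c : F} (hc : c ^ 3 ≠ 4 * c) {x : L} (hx : x ∈ adWeight F T.h c) :
    x = 0 := by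
  have h := T.cube x
  simp only [mem_adWeight.1 hx, map_smul, smul_smul] at h
  have h2 : (c ^ 3 - 4 * c) • x = 0 := by
    rw [sub_smul, ← h, ← sub_smul]
    ring_nf
    simp
  exact (smul_eq_zero.1 h2).resolve_left (sub_ne_zero.2 hc)

theorem eq_zero_four {x : L} (hx : x ∈ adWeight F T.h (2 + 2)) : x = 0 :=
  T.eq_zero_of_weight (by norm_num) hx

theorem eq_zero_neg_four {x : L} (hx : x ∈ adWeight F T.h (-2 + -2)) : x = 0 :=
  T.eq_zero_of_weight (by norm_num) hx

/-- The component of weight `2`. -/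
def projPos : L →ₗ[F] L :=
  (8⁻¹ : F) • (sop F T.h ∘ₗ sop F T.h + (2 : F) • sop F T.h)

/-- The component of weight `-2`. -/
def projNeg : L →ₗ[F] L :=
  (8⁻¹ : F) • (sop F T.h ∘ₗ sop F T.h - (2 : F) • sop F T.h)

/-- The component of weight `0`. -/
def projZero : L →ₗ[F] L :=
  LinearMap.id - (4⁻¹ : F) • (sop F T.h ∘ₗ sop F T.h)

/-- The three projections are the Lagrange interpolation polynomials in ad h at the nodes 2, 0, -2;
reducing the cube of ad h shows that their values are eigenvectors. -/
theorem projPos_mem (x : L) : T.projPos x ∈ adWeight F T.h 2 := by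
  rw [mem_adWeight]
  simp only [projPos, LinearMap.smul_apply, LinearMap.add_apply, LinearMap.comp_apply, map_smul,
    map_add, T.cube]
  module

theorem projNeg_mem (x : L) : T.projNeg x ∈ adWeight F T.h (-2) := by
  rw [mem_adWeight]
  simp only [projNeg, LinearMap.smul_apply, LinearMap.sub_apply, LinearMap.comp_apply, map_smul,
    map_sub, T.cube]
  module

theorem projZero_mem (x : L) : T.projZero x ∈ adWeight F T.h 0 := by
  rw [mem_adWeight]
  simp only [projZero, LinearMap.smul_apply, LinearMap.sub_apply, LinearMap.comp_apply, map_smul,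
    map_sub, T.cube, LinearMap.id_apply, smul_smul]
  norm_num

theorem proj_sum (x : L) : T.projPos x + T.projZero x + T.projNeg x = x := by
  simp only [projPos, projZero, projNeg, LinearMap.smul_apply, LinearMap.sub_apply,
    LinearMap.add_apply, LinearMap.comp_apply, LinearMap.id_apply]
  module

theorem weight_induction {p : L → Prop}
    (pos : ∀ (i : ZMod 2) (x : L), x ∈ sgr F i → x ∈ adWeight F T.h 2 → p x)
    (zero : ∀ (i : ZMod 2) (x : L), x ∈ sgr F i → x ∈ adWeight F T.h 0 → p x)
    (neg : ∀ (i : ZMod 2) (x : L), x ∈ sgr F i → x ∈ adWeight F T.h (-2) → p x)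
    (add : ∀ x y, p x → p y → p (x + y)) (x : L) : p x := by
  refine Superspace.homogeneous_induction (F := F) (fun i x hx => ?_) add x
  have hD : ∀ y ∈ sgr F i, sop F T.h y ∈ sgr F i := fun y hy => by
    simpa using Superalgebra.op_mem (F := F) T.h_even hy
  rw [← T.proj_sum x]
  refine add _ _ (add _ _ (pos i _ ?_ (T.projPos_mem x)) (zero i _ ?_ (T.projZero_mem x)))
    (neg i _ ?_ (T.projNeg_mem x))
  · exact Submodule.smul_mem _ _ (Submodule.add_mem _ (hD _ (hD _ hx))
      (Submodule.smul_mem _ _ (hD _ hx)))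
  · exact Submodule.sub_mem _ hx (Submodule.smul_mem _ _ (hD _ (hD _ hx)))
  · exact Submodule.smul_mem _ _ (Submodule.sub_mem _ (hD _ (hD _ hx))
      (Submodule.smul_mem _ _ (hD _ hx)))

theorem projPos_pos {x : L} (hx : x ∈ adWeight F T.h 2) : T.projPos x = x := by
  simp only [projPos, LinearMap.smul_apply, LinearMap.add_apply, LinearMap.comp_apply,
    mem_adWeight.1 hx, map_smul, smul_smul, ← add_smul]
  norm_num

theorem projPos_zero {x : L} (hx : x ∈ adWeight F T.h 0) : T.projPos x = 0 := by
  simp [projPos, mem_adWeight.1 hx]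

theorem projPos_neg {x : L} (hx : x ∈ adWeight F T.h (-2)) : T.projPos x = 0 := by
  simp only [projPos, LinearMap.smul_apply, LinearMap.add_apply, LinearMap.comp_apply,
    mem_adWeight.1 hx, map_smul, smul_smul, ← add_smul]
  norm_num

/-- `t(x) = [x, f] / 2`. -/
def t : L →ₗ[F] L := (2⁻¹ : F) • (sop F).flip T.f

theorem t_apply (x : L) : T.t x = (2⁻¹ : F) • sop F x T.f := rfl

/-- `τ(x) = [f, t(x)] / 2`. -/
def τ : L →ₗ[F] L := (2⁻¹ : F) • (sop F T.f ∘ₗ T.t)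

theorem τ_apply (x : L) : T.τ x = (2⁻¹ : F) • sop F T.f (T.t x) := rfl

theorem t_mem {i : ZMod 2} {x : L} (hx : x ∈ sgr F i) : T.t x ∈ sgr F i :=
  Submodule.smul_mem _ _ (by simpa using Superalgebra.op_mem (F := F) hx T.f_even)

theorem τ_mem {i : ZMod 2} {x : L} (hx : x ∈ sgr F i) : T.τ x ∈ sgr F i :=
  Submodule.smul_mem _ _ (by simpa using Superalgebra.op_mem (F := F) T.f_even (T.t_mem hx))

theorem e_weight : T.e ∈ adWeight F T.h 2 := T.he

theorem f_weight : T.f ∈ adWeight F T.h (-2) := T.hf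

variable [IsLieSuperalgebra F L]

theorem t_weight {x : L} (hx : x ∈ adWeight F T.h 2) : T.t x ∈ adWeight F T.h 0 := by
  have h := adWeight_op T.h_even hx T.f_weight
  rw [add_neg_cancel] at h
  exact Submodule.smul_mem _ _ h

theorem τ_weight {x : L} (hx : x ∈ adWeight F T.h 2) : T.τ x ∈ adWeight F T.h (-2) := by
  have h := adWeight_op T.h_even T.f_weight (T.t_weight hx)
  rw [add_zero] at h
  exact Submodule.smul_mem _ _ h

/-- The product `x · y = [t(x), y]` has weight `2`. -/
theorem mul_weight {x y : L} (hx : x ∈ adWeight F T.h 2) (hy : y ∈ adWeight F T.h 2) :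
    sop F (T.t x) y ∈ adWeight F T.h 2 := by
  have h := adWeight_op T.h_even (T.t_weight hx) hy
  rwa [_root_.zero_add] at h

theorem mul_mem {i j : ZMod 2} {x y : L} (hx : x ∈ sgr F i) (hy : y ∈ sgr F j) :
    sop F (T.t x) y ∈ sgr F (i + j) := Superalgebra.op_mem (T.t_mem hx) hy

theorem fe : sop F T.f T.e = -T.h := by
  rw [LieSuper.skew_even T.f_even, T.ef]

theorem t_e : T.t T.e = (2⁻¹ : F) • T.h := by rw [t_apply, T.ef]

theorem op_f_eq (x : L) : sop F x T.f = (2 : F) • T.t x := by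
  rw [t_apply, smul_smul]
  norm_num

theorem op_f_t (x : L) : sop F T.f (T.t x) = (2 : F) • T.τ x := by
  rw [τ_apply, smul_smul]
  norm_num

theorem e_mul {x : L} (hx : x ∈ adWeight F T.h 2) : sop F (T.t T.e) x = x := by
  rw [t_e, map_smul, LinearMap.smul_apply, mem_adWeight.1 hx, smul_smul]
  norm_num

/-- The bracket [x, y] has weight 4 and vanishes; bracketing it with f and applying the Jacobi
identity relates [x, t(y)] to [t(x), y]. -/
theorem mul_comm {i j : ZMod 2} {x y : L} (hx : x ∈ sgr F i) (hy : y ∈ sgr F j)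
    (hx' : x ∈ adWeight F T.h 2) (hy' : y ∈ adWeight F T.h 2) :
    sop F (T.t x) y = koszul F i j • sop F (T.t y) x := by
  have h0 : sop F x y = 0 := T.eq_zero_four (adWeight_op T.h_even hx' hy')
  have h := IsLieSuperalgebra.jacobi hx hy T.f_even
  rw [h0, map_zero, LinearMap.zero_apply, _root_.zero_add, T.op_f_eq, T.op_f_eq, map_smul, map_smul,
    IsLieSuperalgebra.skew hx (T.t_mem hy), IsLieSuperalgebra.skew hy (T.t_mem hx)] at h
  have h2 := congrArg (fun v => (2⁻¹ : F) • v) h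
  rcases zmod2_eq i with rfl | rfl <;> rcases zmod2_eq j with rfl | rfl <;>
    simp [smul_smul] at h2 ⊢ <;> simp [h2]

/-- Since [e, x] = 0 by weight, ad e applied to [x, f] leaves only [x, [e, f]] = [x, h] = -2x. -/
theorem mul_e {x : L} (hx : x ∈ adWeight F T.h 2) : sop F (T.t x) T.e = x := by
  have h0 := T.eq_zero_four (adWeight_op T.h_even T.e_weight hx)
  have hxh : sop F x T.h = -((2 : F) • x) := by
    rw [← mem_adWeight.1 hx, LieSuper.skew_even T.h_even, neg_neg]
  have h1 := LieSuper.jacobi_even T.e_even x T.f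
  rw [T.ef, h0, map_zero, LinearMap.zero_apply, _root_.zero_add, hxh, op_f_eq, map_smul,
    LieSuper.skew_even T.e_even, smul_neg, neg_inj] at h1
  have h2 := congrArg (fun v => (2⁻¹ : F) • v) h1
  simpa [smul_smul] using h2

theorem op_e_t {x : L} (hx : x ∈ adWeight F T.h 2) : sop F T.e (T.t x) = -x := by
  rw [LieSuper.skew_even T.e_even, T.mul_e hx]

theorem op_e_τ {x : L} (hx : x ∈ adWeight F T.h 2) : sop F T.e (T.τ x) = T.t x := by
  have h := LieSuper.jacobi_even T.e_even T.f (T.t x)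
  rw [T.ef, mem_adWeight.1 (T.t_weight hx), zero_smul, _root_.zero_add, op_e_t T hx, map_neg,
    LieSuper.skew_even T.f_even x, neg_neg, op_f_eq, op_f_t, map_smul] at h
  have h2 := congrArg (fun v => (2⁻¹ : F) • v) h
  simpa [smul_smul] using h2

/-- Weight -2 is the lowest weight, so [f, y] = 0; if also [e, y] = 0, then [h, y] = [[e, f], y] = 0
while h acts by -2. Identities in weight -2 can thus be verified after applying ad e. -/
theorem eq_zero_of_op_e {y : L} (hy : y ∈ adWeight F T.h (-2)) (h : sop F T.e y = 0) : y = 0 := by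
  have h1 := LieSuper.jacobi_even T.e_even T.f y
  rw [T.eq_zero_neg_four (adWeight_op T.h_even T.f_weight hy), h, map_zero, map_zero, T.ef,
    mem_adWeight.1 hy, add_zero] at h1
  simpa using h1.symm

/-- With t(x) in the role of the multiplication L_x, the right side is L_{xz} + [L_x, L_z], the
first component of ψ(x ⊗ z). It follows by expanding [x, [f, t(z)]] with f even. -/
theorem op_τ {i : ZMod 2} {j : ZMod 2} {x z : L} (hx : x ∈ sgr F i) (hz : z ∈ sgr F j)
    (hx' : x ∈ adWeight F T.h 2) (hz' : z ∈ adWeight F T.h 2) :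
    sop F x (T.τ z) = T.t (sop F (T.t x) z) + sop F (T.t x) (T.t z) := by
  have h := LieSuper.jacobi_even_mid T.f_even hx (T.t z)
  have h2 : sop F x (T.t z) = -sop F (T.t x) z := by
    rw [IsLieSuperalgebra.skew hx (T.t_mem hz), T.mul_comm hx hz hx' hz']
  rw [op_f_t, op_f_eq, map_smul, map_smul, LinearMap.smul_apply, h2, map_neg,
    LieSuper.skew_even T.f_even, neg_neg, op_f_eq, ← smul_add] at h
  have h3 := congrArg (fun v => (2⁻¹ : F) • v) h
  simp only [smul_smul] at h3
  norm_num at h3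
  rw [h3, add_comm]

/-- Under the identification τ, t(w) acts on the weight -2 space as minus multiplication by w; this
accounts for the sign in the second component of ψ. Both sides have weight -2, so it is enough to
compare them after ad e. -/
theorem t_op_τ {i : ZMod 2} {j : ZMod 2} {w z : L} (hw : w ∈ sgr F i) (hz : z ∈ sgr F j)
    (hw' : w ∈ adWeight F T.h 2) (hz' : z ∈ adWeight F T.h 2) :
    sop F (T.t w) (T.τ z) = -T.τ (sop F (T.t w) z) := by
  rw [← add_eq_zero_iff_eq_neg]
  refine T.eq_zero_of_op_e (Submodule.add_mem _ ?_ (T.τ_weight (T.mul_weight hw' hz'))) ?_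
  · have h := adWeight_op T.h_even (T.t_weight hw') (T.τ_weight hz')
    rwa [_root_.zero_add] at h
  · rw [map_add, T.op_e_τ (T.mul_weight hw' hz'), LieSuper.jacobi_even T.e_even, T.op_e_t hw',
      T.op_e_τ hz', map_neg, LinearMap.neg_apply, T.op_τ hw hz hw' hz']
    abel

/-- The Jacobi identity for t(w), x and τ(z), rewritten by `op_τ` and `t_op_τ`. It mixes the Jordan
identity with a commutator identity; symmetrizing in x and z separates the two. -/
theorem t_op_op_τ {i j k : ZMod 2} {w x z : L} (hw : w ∈ sgr F i) (hx : x ∈ sgr F j)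
    (hz : z ∈ sgr F k) (hw' : w ∈ adWeight F T.h 2) (hx' : x ∈ adWeight F T.h 2)
    (hz' : z ∈ adWeight F T.h 2) :
    sop F (T.t w) (T.t (sop F (T.t x) z)) + sop F (T.t w) (sop F (T.t x) (T.t z)) =
      T.t (sop F (T.t (sop F (T.t w) x)) z) + sop F (T.t (sop F (T.t w) x)) (T.t z)
      - koszul F i j • (T.t (sop F (T.t x) (sop F (T.t w) z))
        + sop F (T.t x) (T.t (sop F (T.t w) z))) := by
  have h := IsLieSuperalgebra.jacobi (T.t_mem hw) hx (T.τ_mem hz)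
  rw [T.t_op_τ hw hz hw' hz', map_neg, T.op_τ hx hz hx' hz',
    T.op_τ hx (T.mul_mem hw hz) hx' (T.mul_weight hw' hz'),
    T.op_τ (T.mul_mem hw hx) hz (T.mul_weight hw' hx') hz', map_add] at h
  rw [h, smul_neg, sub_eq_add_neg]

/-- The operator form of the Jordan identity. -/
theorem t_jordan {i j k : ZMod 2} {w x z : L} (hw : w ∈ sgr F i) (hx : x ∈ sgr F j)
    (hz : z ∈ sgr F k) (hw' : w ∈ adWeight F T.h 2) (hx' : x ∈ adWeight F T.h 2)
    (hz' : z ∈ adWeight F T.h 2) :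
    sop F (T.t w) (T.t (sop F (T.t x) z)) = sop F (T.t (sop F (T.t w) x)) (T.t z)
      + koszul F j k • sop F (T.t (sop F (T.t w) z)) (T.t x) := by
  have h1 := T.t_op_op_τ hw hx hz hw' hx' hz'
  -- Exchanging x and z, the terms [t(w), [t(x), t(z)]] change sign while those containing t(x · z)
  -- do not, up to Koszul signs; half the sum keeps the latter.
  have h2 := T.t_op_op_τ hw hz hx hw' hz' hx'
  rw [T.mul_comm hz hx hz' hx', IsLieSuperalgebra.skew (T.t_mem hz) (T.t_mem hx),
    T.mul_comm hz (T.mul_mem hw hx) hz' (T.mul_weight hw' hx'),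
    IsLieSuperalgebra.skew (T.t_mem hz) (T.t_mem (T.mul_mem hw hx))] at h2
  rw [T.mul_comm hx (T.mul_mem hw hz) hx' (T.mul_weight hw' hz'),
    IsLieSuperalgebra.skew (T.t_mem hx) (T.t_mem (T.mul_mem hw hz))] at h1
  simp only [map_smul, map_neg] at h1 h2
  rcases zmod2_eq i with rfl | rfl <;> rcases zmod2_eq j with rfl | rfl <;>
  rcases zmod2_eq k with rfl | rfl <;>
  simp only [show (1 + 1 : ZMod 2) = 0 from rfl, koszul_zero_left, koszul_zero_right,
    koszul_one_one, add_zero, _root_.zero_add, one_smul, neg_smul, neg_neg]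
    at h1 h2 ⊢ <;>
  first
  | linear_combination (norm := module) (2⁻¹ : F) • h1 + (2⁻¹ : F) • h2
  | linear_combination (norm := module) (2⁻¹ : F) • h1 - (2⁻¹ : F) • h2

/-- `σ(y) = -[e, [e, y]]`, the inverse of `τ`. -/
theorem τ_op_e_op_e {y : L} (hy : y ∈ adWeight F T.h (-2)) :
    T.τ (-sop F T.e (sop F T.e y)) = y := by
  have hw : sop F T.e y ∈ adWeight F T.h 0 := by
    have h := adWeight_op T.h_even T.e_weight hy
    rwa [add_neg_cancel] at h
  have hx : -sop F T.e (sop F T.e y) ∈ adWeight F T.h 2 := by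
    have h := adWeight_op T.h_even T.e_weight hw
    rw [add_zero] at h
    exact Submodule.neg_mem _ h
  rw [← sub_eq_zero]
  refine T.eq_zero_of_op_e (Submodule.sub_mem _ (T.τ_weight hx) hy) ?_
  rw [map_sub, T.op_e_τ hx, t_apply, map_neg, LinearMap.neg_apply,
    ← LieSuper.skew_even T.f_even, LieSuper.jacobi_even T.f_even, T.fe, map_neg,
    LinearMap.neg_apply, mem_adWeight.1 hw, LieSuper.jacobi_even T.f_even T.e y, T.fe, map_neg,
    LinearMap.neg_apply, mem_adWeight.1 hy,
    T.eq_zero_neg_four (adWeight_op T.h_even T.f_weight hy)]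
  simp [smul_smul]

end ShortTriple
end

noncomputable section
set_option linter.unusedSectionVars false

/-! ### Brackets of homogeneous elements of `TKK(J)` for the short grading -/

section TKKBracket

variable {F J : Type*} [Field F] [AddCommGroup J] [Module F J] [Superalgebra F J]
  [IsJordanSuperalgebra F J]

namespace TKK

variable (F) in
/-- The inclusion of `J₁`. -/
def inPos : J →ₗ[F] TKK F J where
  toFun x := ⟨x, 0, 0⟩
  map_add' _ _ := TKK.ext rfl (add_zero _).symm (add_zero _).symm
  map_smul' _ _ := TKK.ext rfl (smul_zero _).symm (smul_zero _).symm

/-- The inclusion of `J₀`. -/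
def inZero : tkkZero F J →ₗ[F] TKK F J where
  toFun x := ⟨0, x, 0⟩
  map_add' _ _ := TKK.ext (add_zero _).symm rfl (add_zero _).symm
  map_smul' _ _ := TKK.ext (smul_zero _).symm rfl (smul_zero _).symm

variable (F) in
/-- The inclusion of `J₋₁`. -/
def inNeg : J →ₗ[F] TKK F J where
  toFun x := ⟨0, 0, x⟩
  map_add' _ _ := TKK.ext (add_zero _).symm (add_zero _).symm rfl
  map_smul' _ _ := TKK.ext (smul_zero _).symm (smul_zero _).symm rfl

theorem inPos_pos (x : J) : (inPos F x).pos = x := rfl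
theorem inPos_zero (x : J) : (inPos F x).zero = 0 := rfl
theorem inPos_neg (x : J) : (inPos F x).neg = 0 := rfl
theorem inZero_pos (x : tkkZero F J) : (inZero x).pos = 0 := rfl
theorem inZero_zero (x : tkkZero F J) : (inZero x).zero = x := rfl
theorem inZero_neg (x : tkkZero F J) : (inZero x).neg = 0 := rfl
theorem inNeg_pos (x : J) : (inNeg F x).pos = 0 := rfl
theorem inNeg_zero (x : J) : (inNeg F x).zero = 0 := rfl
theorem inNeg_neg (x : J) : (inNeg F x).neg = x := rfl

theorem decomp (X : TKK F J) : inPos F X.pos + inZero X.zero + inNeg F X.neg = X := by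
  refine TKK.ext ?_ ?_ ?_ <;>
  simp [inPos_pos, inPos_zero, inPos_neg, inZero_pos, inZero_zero, inZero_neg, inNeg_pos,
    inNeg_zero, inNeg_neg]

theorem inPos_mem {i : ZMod 2} {x : J} (hx : x ∈ sgr F i) : inPos F x ∈ sgr F i :=
  ⟨hx, Submodule.zero_mem _, Submodule.zero_mem _⟩

theorem inNeg_mem {i : ZMod 2} {x : J} (hx : x ∈ sgr F i) : inNeg F x ∈ sgr F i :=
  ⟨Submodule.zero_mem _, Submodule.zero_mem _, hx⟩

theorem inZero_mem {i : ZMod 2} {x : tkkZero F J} (hx : x ∈ sgr F i) : inZero x ∈ sgr F i :=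
  ⟨Submodule.zero_mem _, hx, Submodule.zero_mem _⟩

theorem sop_eq (X Y : TKK F J) : sop F X Y =
    { pos := tkkActPos F J X.zero Y.pos - Superspace.flip (tkkActPos F J) X.pos Y.zero
      zero := tkkPsiZero F J X.pos Y.neg + tkkCommZero F J X.zero Y.zero
        - Superspace.flip (tkkPsiZero F J) X.neg Y.pos
      neg := tkkActNeg F J X.zero Y.neg - Superspace.flip (tkkActNeg F J) X.neg Y.zero } := rfl

theorem op_pos_pos (x y : J) : sop F (inPos F x) (inPos F y) = 0 := by
  rw [sop_eq]
  refine TKK.ext ?_ ?_ ?_ <;> simp [inPos_zero, inPos_neg]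

theorem op_neg_neg (x y : J) : sop F (inNeg F x) (inNeg F y) = 0 := by
  rw [sop_eq]
  refine TKK.ext ?_ ?_ ?_ <;> simp [inNeg_zero, inNeg_pos]

theorem op_pos_neg (x y : J) :
    sop F (inPos F x) (inNeg F y) = inZero (tkkPsiZero F J x y) := by
  rw [sop_eq]
  refine TKK.ext ?_ ?_ ?_ <;> simp [inNeg_zero, inNeg_pos, inPos_zero, inPos_neg, inPos_pos,
    inNeg_neg, inZero_pos, inZero_zero, inZero_neg]

theorem op_zero_pos (S : tkkZero F J) (x : J) :
    sop F (inZero S) (inPos F x) = inPos F (S.1.1 x) := by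
  rw [sop_eq]
  refine TKK.ext ?_ ?_ ?_ <;> simp [inPos_zero, inPos_neg, inPos_pos,
    inZero_pos, inZero_zero, inZero_neg, tkkActPos]

theorem op_zero_neg (S : tkkZero F J) (x : J) :
    sop F (inZero S) (inNeg F x) = inNeg F (S.1.2 x) := by
  rw [sop_eq]
  refine TKK.ext ?_ ?_ ?_ <;> simp [inNeg_zero, inNeg_neg, inNeg_pos,
    inZero_pos, inZero_zero, inZero_neg, tkkActNeg]

theorem op_zero_zero (S T : tkkZero F J) :
    sop F (inZero S) (inZero T) = inZero (tkkCommZero F J S T) := by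
  rw [sop_eq]
  refine TKK.ext ?_ ?_ ?_ <;> simp [inZero_pos, inZero_zero, inZero_neg]

end TKK

end TKKBracket

/-! ### The Jordan superalgebra of a short grading -/

namespace ShortTriple

variable {F L : Type*} [Field F] [CharZero F] [AddCommGroup L] [Module F L] [Superalgebra F L]
  [IsLieSuperalgebra F L] (T : ShortTriple F L)

/-- The space of weight `2`, as a Jordan superalgebra with the product `[t(x), y]`. -/
def J : Type _ := adWeight F T.h 2

instance : AddCommGroup T.J := inferInstanceAs (AddCommGroup (adWeight F T.h 2))

instance : Module F T.J := inferInstanceAs (Module F (adWeight F T.h 2))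

/-- The inclusion `J → L`. -/
def val : T.J →ₗ[F] L := (adWeight F T.h 2).subtype

theorem val_weight (x : T.J) : T.val x ∈ adWeight F T.h 2 := x.2

theorem val_injective : Function.Injective T.val := Subtype.val_injective

instance : Superalgebra F T.J where
  grade i := (sgr F i).comap T.val
  isCompl := by
    refine Superspace.isCompl_of_decomp (fun x h0 h1 => ?_) fun x => ?_
    · exact T.val_injective ((Superspace.eq_zero_of_mem (F := F) h0 h1).trans (map_zero _).symm)
    · exact ⟨⟨_, adWeight_graded T.h_even 2 0 (T.val_weight x)⟩, Superspace.proj_mem F 0 _,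
        ⟨_, adWeight_graded T.h_even 2 1 (T.val_weight x)⟩, Superspace.proj_mem F 1 _,
        Subtype.ext (Superspace.proj_add F _)⟩
  op := LinearMap.mk₂ F (fun x y => (⟨sop F (T.t (T.val x)) (T.val y),
      T.mul_weight (T.val_weight x) (T.val_weight y)⟩ : adWeight F T.h 2))
    (fun x y z => Subtype.ext ((sop F ∘ₗ T.t).map_add₂ (T.val x) (T.val y) (T.val z)))
    (fun c x y => Subtype.ext ((sop F ∘ₗ T.t).map_smul₂ c (T.val x) (T.val y)))
    (fun x y z => Subtype.ext ((sop F (T.t (T.val x))).map_add (T.val y) (T.val z)))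
    (fun c x y => Subtype.ext ((sop F (T.t (T.val x))).map_smul c (T.val y)))
  op_mem hx hy := T.mul_mem (F := F) hx hy

theorem val_op (x y : T.J) : T.val (sop F x y) = sop F (T.t (T.val x)) (T.val y) := rfl

theorem val_mem {i : ZMod 2} {x : T.J} : x ∈ sgr F i ↔ T.val x ∈ sgr F i := Iff.rfl

theorem J_comm {i j : ZMod 2} {x y : T.J} (hx : x ∈ sgr F i) (hy : y ∈ sgr F j) :
    sop F x y = koszul F i j • sop F y x :=
  T.val_injective (by
    rw [map_smul, val_op, val_op]
    exact T.mul_comm hx hy (T.val_weight x) (T.val_weight y))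

/-- The operator identity `t_jordan` applied to v; each bracket [t(a), t(b)] acts on J as the
supercommutator of the multiplications by a and b. -/
theorem J_jordan_op {i j k l : ZMod 2} {w x z v : T.J} (hw : w ∈ sgr F i) (hx : x ∈ sgr F j)
    (hz : z ∈ sgr F k) (hv : v ∈ sgr F l) :
    sop F w (sop F (sop F x z) v) - koszul F i (j + k) • sop F (sop F x z) (sop F w v) =
      sop F (sop F w x) (sop F z v) - koszul F (i + j) k • sop F z (sop F (sop F w x) v)
      + koszul F j k • (sop F (sop F w z) (sop F x v)
        - koszul F (i + k) j • sop F x (sop F (sop F w z) v)) := by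
  have h := congrArg (fun u => sop F u (T.val v)) (T.t_jordan hw hx hz (T.val_weight w) (T.val_weight x) (T.val_weight z))
  have e := fun {i j : ZMod 2} {a b : L} (ha : a ∈ sgr F i) (hb : b ∈ sgr F j) =>
    eq_sub_of_add_eq (IsLieSuperalgebra.jacobi ha hb hv).symm
  have hx' := T.val_mem.1 hx
  have hz' := T.val_mem.1 hz
  have hw' := T.val_mem.1 hw
  simp only [map_add, map_smul, LinearMap.add_apply, LinearMap.smul_apply] at h
  refine T.val_injective ?_
  simp only [map_sub, map_add, map_smul, val_op]
  refine Eq.trans (e (T.t_mem hw') (T.t_mem (T.mul_mem hx' hz'))).symm (h.trans ?_)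
  refine congrArg₂ _ (e (T.t_mem (T.mul_mem hw' hx')) (T.t_mem hz')) (congrArg _ ?_)
  exact e (T.t_mem (T.mul_mem hw' hz')) (T.t_mem hx')

instance : IsJordanSuperalgebra F T.J where
  comm := T.J_comm
  jordan {i j k l x y z w} hx hy hz hw := by
    have m := @Superalgebra.op_mem F T.J _ _ _ _
    have c := @J_comm F L _ _ _ _ _ _ T
    have h := T.J_jordan_op hw hx hy hz
    simp only [sassoc]
    -- Supercommutativity brings every outer multiplier to the left, after which the cyclic sum of
    -- associators is `J_jordan_op` up to sign.
    rw [c (m (m hx hy) hz) hw, c hz hw, c (m (m hy hw) hz) hx, c hy hw, c hz hx,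
      c (m (m hw hx) hz) hy, c hz hy]
    simp only [map_smul, LinearMap.smul_apply]
    rcases zmod2_eq i with rfl | rfl <;> rcases zmod2_eq j with rfl | rfl <;>
    rcases zmod2_eq k with rfl | rfl <;> rcases zmod2_eq l with rfl | rfl <;>
    simp only [show (1 + 1 : ZMod 2) = 0 from rfl, koszul_zero_left, koszul_zero_right,
      koszul_one_one, add_zero, _root_.zero_add, one_smul, neg_smul, mul_one,
      neg_neg, mul_neg] at h ⊢ <;>
    first
    | linear_combination (norm := module) h
    | linear_combination (norm := module) -h

/-- The unit element of `J`. -/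
def one : T.J := (⟨T.e, T.e_weight⟩ : adWeight F T.h 2)

theorem val_one : T.val T.one = T.e := rfl

theorem one_op (x : T.J) : sop F T.one x = x := T.val_injective (T.e_mul (T.val_weight x))

theorem op_one (x : T.J) : sop F x T.one = x := T.val_injective (T.mul_e (T.val_weight x))

/-! ### The homomorphism to the Tits–Kantor–Koecher superalgebra -/

/-- The projection `L → J`. -/
def toJ : L →ₗ[F] T.J := T.projPos.codRestrict (adWeight F T.h 2) T.projPos_mem

theorem val_toJ (x : L) : T.val (T.toJ x) = T.projPos x := rfl

theorem toJ_val (x : T.J) : T.toJ (T.val x) = x := T.val_injective (T.projPos_pos (T.val_weight x))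

/-- The map `y ↦ -[e, [e, y]]` from `L` to `J`. -/
def σ : L →ₗ[F] T.J := -(T.toJ ∘ₗ sop F T.e ∘ₗ sop F T.e)

theorem σ_apply (y : L) : T.σ y = -T.toJ (sop F T.e (sop F T.e y)) := rfl

theorem toJ_eq_zero {x : L} (hx : x ∈ adWeight F T.h 0 ∨ x ∈ adWeight F T.h (-2)) :
    T.toJ x = 0 :=
  T.val_injective (hx.elim T.projPos_zero T.projPos_neg)

theorem σ_τ (x : T.J) : T.σ (T.τ (T.val x)) = x := by
  rw [σ_apply, T.op_e_τ (T.val_weight x), T.op_e_t (T.val_weight x), map_neg, neg_neg, toJ_val]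

theorem τ_σ {y : L} (hy : y ∈ adWeight F T.h (-2)) : T.τ (T.val (T.σ y)) = y := by
  have hw := adWeight_op T.h_even T.e_weight hy
  have hw' := adWeight_op T.h_even T.e_weight hw
  rw [add_neg_cancel, add_zero] at hw'
  rw [σ_apply, map_neg, val_toJ, T.projPos_pos hw']
  exact T.τ_op_e_op_e hy

theorem σ_eq_zero {y : L} (hy : y ∈ adWeight F T.h 0 ∨ y ∈ adWeight F T.h 2) : T.σ y = 0 := by
  rw [σ_apply]
  have h := T.e_weight
  obtain hy | hy := hy
  · have h1 := adWeight_op T.h_even h hy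
    rw [add_zero] at h1
    rw [T.eq_zero_four (adWeight_op T.h_even h h1), map_zero, neg_zero]
  · rw [T.eq_zero_four (adWeight_op T.h_even h hy), map_zero, map_zero, neg_zero]

theorem toJ_mem {i : ZMod 2} {x : L} (hx : x ∈ sgr F i) : T.toJ x ∈ sgr F i := by
  have hD : ∀ y ∈ sgr F i, sop F T.h y ∈ sgr F i := fun y hy => by
    simpa using Superalgebra.op_mem (F := F) T.h_even hy
  exact Submodule.smul_mem _ _ (Submodule.add_mem _ (hD _ (hD _ hx))
      (Submodule.smul_mem _ _ (hD _ hx)))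

theorem σ_mem {i : ZMod 2} {x : L} (hx : x ∈ sgr F i) : T.σ x ∈ sgr F i := by
  have hD : ∀ y ∈ sgr F i, sop F T.e y ∈ sgr F i := fun y hy => by
    simpa using Superalgebra.op_mem (F := F) T.e_even hy
  exact Submodule.neg_mem _ (T.toJ_mem (hD _ (hD _ hx)))

/-- The action of `L` on `J₁ = J` and `J₋₁ = J`, supported in weight `0`. -/
def act : L →ₗ[F] Module.End F T.J × Module.End F T.J :=
  LinearMap.prod ((sop F (A := L)).compr₂ T.toJ |>.compl₂ T.val)
    ((sop F (A := L)).compr₂ T.σ |>.compl₂ (T.τ ∘ₗ T.val))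

theorem act_fst (X : L) (v : T.J) : (T.act X).1 v = T.toJ (sop F X (T.val v)) := rfl

theorem act_snd (X : L) (v : T.J) : (T.act X).2 v = T.σ (sop F X (T.τ (T.val v))) := rfl

theorem val_act_fst {X : L} (hX : X ∈ adWeight F T.h 0) (v : T.J) :
    T.val ((T.act X).1 v) = sop F X (T.val v) := by
  have h := adWeight_op T.h_even hX (T.val_weight v)
  rw [_root_.zero_add] at h
  exact T.projPos_pos h

theorem τ_act_snd {X : L} (hX : X ∈ adWeight F T.h 0) (v : T.J) :
    T.τ (T.val ((T.act X).2 v)) = sop F X (T.τ (T.val v)) := by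
  have h := adWeight_op T.h_even hX (T.τ_weight (T.val_weight v))
  rw [_root_.zero_add] at h
  exact T.τ_σ h

theorem act_pos {X : L} (hX : X ∈ adWeight F T.h 2) : T.act X = 0 := by
  refine Prod.ext (LinearMap.ext fun v => ?_) (LinearMap.ext fun v => ?_)
  · rw [act_fst, T.eq_zero_four (adWeight_op T.h_even hX (T.val_weight v)), map_zero]
    rfl
  · have h := adWeight_op T.h_even hX (T.τ_weight (T.val_weight v))
    rw [add_neg_cancel] at h
    exact T.σ_eq_zero (Or.inl h)

theorem act_neg {X : L} (hX : X ∈ adWeight F T.h (-2)) : T.act X = 0 := by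
  refine Prod.ext (LinearMap.ext fun v => ?_) (LinearMap.ext fun v => ?_)
  · have h := adWeight_op T.h_even hX (T.val_weight v)
    rw [neg_add_cancel] at h
    exact T.toJ_eq_zero (Or.inl h)
  · rw [act_snd, T.eq_zero_neg_four (adWeight_op T.h_even hX (T.τ_weight (T.val_weight v))), map_zero]
    rfl

theorem act_mem {i : ZMod 2} {X : L} (hX : X ∈ sgr F i) : T.act X ∈ sgr F i :=
  ⟨fun _ _ hv => T.toJ_mem (Superalgebra.op_mem hX hv),
    fun _ _ hv => T.σ_mem (Superalgebra.op_mem hX (T.τ_mem hv))⟩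

/-- By `op_τ` the element [x, τ(y)] is t(x · y) + [t(x), t(y)]. On J this is the first component of
ψ; on the weight -2 space every t changes sign by `t_op_τ`, so the commutator term survives and the
multiplication term is negated. -/
theorem act_op_τ (x y : T.J) : T.act (sop F (T.val x) (T.τ (T.val y))) = tkkPsi F T.J x y := by
  refine Superspace.homogeneous_induction (F := F) (p := fun x =>
    T.act (sop F (T.val x) (T.τ (T.val y))) = tkkPsi F T.J x y) (fun i x hx => ?_)
    (fun a b ha hb => by simp only [map_add, LinearMap.add_apply, ha, hb]) x
  refine Superspace.homogeneous_induction (F := F) (p := fun y =>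
    T.act (sop F (T.val x) (T.τ (T.val y))) = tkkPsi F T.J x y) (fun j y hy => ?_)
    (fun a b ha hb => by simp only [map_add, ha, hb]) y
  have hxy := T.op_τ hx hy (T.val_weight x) (T.val_weight y)
  have hw : sop F (T.val x) (T.τ (T.val y)) ∈ adWeight F T.h 0 := by
    have h := adWeight_op T.h_even (T.val_weight x) (T.τ_weight (T.val_weight y))
    rwa [add_neg_cancel] at h
  have hm := fun {k : ZMod 2} {v : L} (hv : v ∈ sgr F k) => eq_sub_of_add_eq
    (IsLieSuperalgebra.jacobi (T.t_mem hx) (T.t_mem hy) hv).symm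
  refine Prod.ext (end_ext fun k v hv => T.val_injective ?_) (end_ext fun k v hv => ?_)
  · rw [T.val_act_fst hw, (tkkPsi_apply hx hy v v).1]
    rw [hxy]
    rw [map_add, LinearMap.add_apply, hm hv]
    simp only [map_sub, map_add, map_smul, val_op]
    abel
  · have hinj : Function.Injective fun v : T.J => T.τ (T.val v) := fun a b hab => by
      rw [← T.σ_τ a, ← T.σ_τ b]
      exact congrArg T.σ hab
    refine hinj ?_
    change T.τ (T.val _) = T.τ (T.val _)
    rw [T.τ_act_snd hw, (tkkPsi_apply hx hy v v).2]
    rw [hxy]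
    rw [map_add, LinearMap.add_apply, hm (T.τ_mem hv)]
    have hv' := T.val_mem.1 hv
    have hx' := T.val_mem.1 hx
    have hy' := T.val_mem.1 hy
    rw [T.t_op_τ (T.mul_mem hx' hy') hv' (T.mul_weight (T.val_weight x) (T.val_weight y)) (T.val_weight v), T.t_op_τ hy' hv' (T.val_weight y) (T.val_weight v),
      T.t_op_τ hx' hv' (T.val_weight x) (T.val_weight v), map_neg, map_neg,
      T.t_op_τ hx' (T.mul_mem hy' hv') (T.val_weight x) (T.mul_weight (T.val_weight y) (T.val_weight v)),
      T.t_op_τ hy' (T.mul_mem hx' hv') (T.val_weight y) (T.mul_weight (T.val_weight x) (T.val_weight v))]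
    simp only [map_sub, map_add, map_smul, map_neg, val_op, neg_neg]
    abel

/-- Weight ±2 acts as zero by construction. Weight 0 is spanned by [L₂, L₋₂], and as τ is onto L₋₂,
each such bracket acts as some ψ(x ⊗ y). -/
theorem act_mem_zero (X : L) : T.act X ∈ tkkZero F T.J := by
  refine T.weight_induction (p := fun X => T.act X ∈ tkkZero F T.J)
    (fun i X _ hX => ?_) (fun i X _ hX => ?_) (fun i X _ hX => ?_)
    (fun a b ha hb => by rw [map_add]; exact Submodule.add_mem _ ha hb) X
  · rw [T.act_pos hX]
    exact Submodule.zero_mem _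
  · suffices h : Submodule.map₂ (sop F) (adWeight F T.h 2) (adWeight F T.h (-2)) ≤
        (tkkZero F T.J).comap T.act from h (T.zero_le hX)
    refine Submodule.map₂_le.2 fun x hx y hy => ?_
    rw [Submodule.mem_comap, ← T.τ_σ hy, ← show T.val (T.toJ x) = x from T.projPos_pos hx, act_op_τ]
    exact tkkPsi_mem_zero _ _
  · rw [T.act_neg hX]
    exact Submodule.zero_mem _

/-- The action with values in `J₀`. -/
def actZero : L →ₗ[F] tkkZero F T.J := T.act.codRestrict _ T.act_mem_zero

theorem actZero_val (X : L) : (T.actZero X).1 = T.act X := rfl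

/-- The linear map `L → TKK(J)`. -/
def toTKKLin : L →ₗ[F] TKK F T.J where
  toFun X := ⟨T.toJ X, T.actZero X, T.σ X⟩
  map_add' _ _ := TKK.ext (map_add _ _ _) (map_add _ _ _) (map_add _ _ _)
  map_smul' _ _ := TKK.ext (map_smul _ _ _) (map_smul _ _ _) (map_smul _ _ _)

theorem toTKKLin_pos {X : L} (hX : X ∈ adWeight F T.h 2) :
    T.toTKKLin X = TKK.inPos F (T.toJ X) :=
  TKK.ext rfl (Subtype.ext (T.act_pos hX)) (T.σ_eq_zero (Or.inr hX))

theorem toTKKLin_neg {X : L} (hX : X ∈ adWeight F T.h (-2)) :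
    T.toTKKLin X = TKK.inNeg F (T.σ X) :=
  TKK.ext (T.toJ_eq_zero (Or.inr hX)) (Subtype.ext (T.act_neg hX)) rfl

theorem toTKKLin_zero {X : L} (hX : X ∈ adWeight F T.h 0) :
    T.toTKKLin X = TKK.inZero (T.actZero X) :=
  TKK.ext (T.toJ_eq_zero (Or.inl hX)) rfl (T.σ_eq_zero (Or.inl hX))

theorem toTKKLin_mem {i : ZMod 2} {X : L} (hX : X ∈ sgr F i) : T.toTKKLin X ∈ sgr F i :=
  ⟨T.toJ_mem hX, T.act_mem hX, T.σ_mem hX⟩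

theorem toTKKLin_swap {i j : ZMod 2} {X Y : L} (hX : X ∈ sgr F i) (hY : Y ∈ sgr F j)
    (h : T.toTKKLin (sop F X Y) = sop F (T.toTKKLin X) (T.toTKKLin Y)) :
    T.toTKKLin (sop F Y X) = sop F (T.toTKKLin Y) (T.toTKKLin X) := by
  rw [IsLieSuperalgebra.skew hY hX, IsLieSuperalgebra.skew (T.toTKKLin_mem hY) (T.toTKKLin_mem hX),
    map_neg, map_smul, h]

theorem toTKKLin_op_pos_neg {X Y : L} (hX : X ∈ adWeight F T.h 2) (hY : Y ∈ adWeight F T.h (-2)) :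
    T.toTKKLin (sop F X Y) = sop F (T.toTKKLin X) (T.toTKKLin Y) := by
  have h := adWeight_op T.h_even hX hY
  rw [add_neg_cancel] at h
  rw [T.toTKKLin_zero h, T.toTKKLin_pos hX, T.toTKKLin_neg hY, TKK.op_pos_neg]
  refine congrArg _ (Subtype.ext ?_)
  change T.act _ = tkkPsi F T.J _ _
  rw [← act_op_τ, T.τ_σ hY, T.val_toJ, T.projPos_pos hX]

theorem toTKKLin_op_zero_pos {X Y : L} (hX : X ∈ adWeight F T.h 0) (hY : Y ∈ adWeight F T.h 2) :
    T.toTKKLin (sop F X Y) = sop F (T.toTKKLin X) (T.toTKKLin Y) := by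
  have h := adWeight_op T.h_even hX hY
  rw [_root_.zero_add] at h
  rw [T.toTKKLin_zero hX, T.toTKKLin_pos hY, T.toTKKLin_pos h, TKK.op_zero_pos, actZero_val,
    act_fst, T.val_toJ, T.projPos_pos hY]

theorem toTKKLin_op_zero_neg {X Y : L} (hX : X ∈ adWeight F T.h 0)
    (hY : Y ∈ adWeight F T.h (-2)) :
    T.toTKKLin (sop F X Y) = sop F (T.toTKKLin X) (T.toTKKLin Y) := by
  have h := adWeight_op T.h_even hX hY
  rw [_root_.zero_add] at h
  rw [T.toTKKLin_zero hX, T.toTKKLin_neg hY, T.toTKKLin_neg h, TKK.op_zero_neg, actZero_val,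
    act_snd, T.τ_σ hY]

theorem toTKKLin_op_zero_zero {i j : ZMod 2} {X Y : L} (hXi : X ∈ sgr F i) (hYj : Y ∈ sgr F j)
    (hX : X ∈ adWeight F T.h 0) (hY : Y ∈ adWeight F T.h 0) :
    T.toTKKLin (sop F X Y) = sop F (T.toTKKLin X) (T.toTKKLin Y) := by
  have h := adWeight_op T.h_even hX hY
  rw [_root_.zero_add] at h
  rw [T.toTKKLin_zero hX, T.toTKKLin_zero hY, T.toTKKLin_zero h, TKK.op_zero_zero]
  refine congrArg _ (Subtype.ext ?_)
  have hc := tkkCommZero_apply (F := F) (S := T.actZero X) (T := T.actZero Y) (T.act_mem hXi)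
    (T.act_mem hYj)
  have hm := fun {k : ZMod 2} {v : L} (hv : v ∈ sgr F k) => eq_sub_of_add_eq
    (IsLieSuperalgebra.jacobi hXi hYj hv).symm
  refine Prod.ext (end_ext fun k v hv => ?_) (end_ext fun k v hv => ?_)
  · rw [(hc v).1]
    simp only [actZero_val]
    rw [act_fst, T.act_fst X, T.act_fst Y ((T.act X).1 v), T.val_act_fst hX, T.val_act_fst hY,
      hm (T.val_mem.1 hv), map_sub, map_smul]
  · rw [(hc v).2]
    simp only [actZero_val]
    rw [act_snd, T.act_snd X, T.act_snd Y ((T.act X).2 v), T.τ_act_snd hX, T.τ_act_snd hY,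
      hm (T.τ_mem (T.val_mem.1 hv)), map_sub, map_smul]

theorem toTKKLin_op (X Y : L) :
    T.toTKKLin (sop F X Y) = sop F (T.toTKKLin X) (T.toTKKLin Y) := by
  refine T.weight_induction (p := fun X => T.toTKKLin (sop F X Y) =
    sop F (T.toTKKLin X) (T.toTKKLin Y)) (fun i X hXi hX => ?_) (fun i X hXi hX => ?_)
    (fun i X hXi hX => ?_)
    (fun a b ha hb => by simp only [map_add, LinearMap.add_apply, ha, hb]) X
  all_goals
    refine T.weight_induction (p := fun Y => T.toTKKLin (sop F X Y) =
      sop F (T.toTKKLin X) (T.toTKKLin Y)) (fun j Y hYj hY => ?_) (fun j Y hYj hY => ?_)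
      (fun j Y hYj hY => ?_) (fun a b ha hb => by simp only [map_add, ha, hb]) Y
  · rw [T.eq_zero_four (adWeight_op T.h_even hX hY), T.toTKKLin_pos hX, T.toTKKLin_pos hY,
      TKK.op_pos_pos, map_zero]
  · exact T.toTKKLin_swap hYj hXi (T.toTKKLin_op_zero_pos hY hX)
  · exact T.toTKKLin_op_pos_neg hX hY
  · exact T.toTKKLin_op_zero_pos hX hY
  · exact T.toTKKLin_op_zero_zero hXi hYj hX hY
  · exact T.toTKKLin_op_zero_neg hX hY
  · exact T.toTKKLin_swap hYj hXi (T.toTKKLin_op_pos_neg hY hX)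
  · exact T.toTKKLin_swap hYj hXi (T.toTKKLin_op_zero_neg hY hX)
  · rw [T.eq_zero_neg_four (adWeight_op T.h_even hX hY), T.toTKKLin_neg hX, T.toTKKLin_neg hY,
      TKK.op_neg_neg, map_zero]

/-- The homomorphism `L → TKK(J)`. -/
def toTKK : SuperHom F L (TKK F T.J) where
  toLinearMap := T.toTKKLin
  map_grade := T.toTKKLin_mem
  map_op := T.toTKKLin_op

/-- J₁ and J₋₁ are attained through the weights ±2, and J₀ is spanned by their brackets. -/
theorem toTKKLin_surjective : Function.Surjective T.toTKKLin := by
  intro X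
  have hp : ∀ x : T.J, T.toTKKLin (T.val x) = TKK.inPos F x := fun x => by
    rw [T.toTKKLin_pos (T.val_weight x), T.toJ_val]
  have hn : ∀ x : T.J, T.toTKKLin (T.τ (T.val x)) = TKK.inNeg F x := fun x => by
    rw [T.toTKKLin_neg (T.τ_weight (T.val_weight x)), T.σ_τ]
  have h0 : ∀ S : tkkZero F T.J, TKK.inZero S ∈ LinearMap.range T.toTKKLin := by
    rintro ⟨S, hS⟩
    have hle : tkkZero F T.J ≤ Submodule.map (tkkZero F T.J).subtype
        ((LinearMap.range T.toTKKLin).comap TKK.inZero) := by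
      refine Submodule.map₂_le.2 fun x _ y _ => ⟨tkkPsiZero F T.J x y, ?_, rfl⟩
      refine ⟨sop F (T.val x) (T.τ (T.val y)), ?_⟩
      rw [toTKKLin_op, hp, hn, TKK.op_pos_neg]
    obtain ⟨S', hS', h⟩ := hle hS
    rwa [show (⟨S, hS⟩ : tkkZero F T.J) = S' from Subtype.ext h.symm]
  rw [← LinearMap.mem_range, ← TKK.decomp X]
  exact Submodule.add_mem _ (Submodule.add_mem _ ⟨_, hp _⟩ (h0 _)) ⟨_, hn _⟩

/-- Nonzero weights are reached by bracketing with h, and weight 0 by `zero_le`. -/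
theorem perfect (T : ShortTriple F L) : IsPerfectSuper F L := by
  refine Submodule.eq_top_iff'.2 fun X => ?_
  refine T.weight_induction (p := fun X => X ∈ Submodule.map₂ (sop F (A := L)) ⊤ ⊤)
    (fun i X _ hX => ?_) (fun i X _ hX => ?_) (fun i X _ hX => ?_)
    (fun a b ha hb => Submodule.add_mem _ ha hb) X
  · have h : sop F ((2⁻¹ : F) • T.h) X = X := by
      rw [map_smul, LinearMap.smul_apply, mem_adWeight.1 hX, smul_smul]
      norm_num
    rw [← h]
    exact Submodule.apply_mem_map₂ _ Submodule.mem_top Submodule.mem_top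
  · exact Submodule.map₂_le_map₂ le_top le_top (T.zero_le hX)
  · have h : sop F ((-2⁻¹ : F) • T.h) X = X := by
      rw [map_smul, LinearMap.smul_apply, mem_adWeight.1 hX, smul_smul]
      norm_num
    rw [← h]
    exact Submodule.apply_mem_map₂ _ Submodule.mem_top Submodule.mem_top

/-- The J₁ and J₋₁ components of the image force X into weight 0, and the J₀ component makes it
annihilate the weights ±2. It then annihilates [L₂, L₋₂], which contains the whole weight 0 space.
-/
theorem toTKK_central {X : L} (hX : T.toTKKLin X = 0) (Y : L) : sop F X Y = 0 := by
  have hpos : T.toJ X = 0 := congrArg TKK.pos hX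
  have hzero : T.act X = 0 := congrArg (fun Z => (TKK.zero Z).1) hX
  have hneg : T.σ X = 0 := congrArg TKK.neg hX
  have e1 : T.projPos X = 0 := congrArg T.val hpos
  have e2 : T.projNeg X = 0 := by
    have h := congrArg T.σ (T.proj_sum X)
    rw [map_add, map_add, T.σ_eq_zero (Or.inr (T.projPos_mem X)),
      T.σ_eq_zero (Or.inl (T.projZero_mem X)), _root_.zero_add, _root_.zero_add, hneg] at h
    rw [← T.τ_σ (T.projNeg_mem X), h, map_zero, map_zero]
  have hw : X ∈ adWeight F T.h 0 := by
    have h := T.proj_sum X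
    rw [e1, e2, _root_.zero_add, add_zero] at h
    exact h ▸ T.projZero_mem X
  have ap : X ∈ LieSuper.annihilator F (adWeight F T.h 2) := fun y hy => by
    have h := T.val_act_fst hw (⟨y, hy⟩ : adWeight F T.h 2)
    rw [hzero] at h
    exact h.symm.trans (map_zero _)
  have an : X ∈ LieSuper.annihilator F (adWeight F T.h (-2)) := fun y hy => by
    have h := T.τ_act_snd hw (T.σ y)
    rw [hzero, T.τ_σ hy] at h
    exact h.symm.trans (by simp)
  have a0 := LieSuper.annihilator_map₂ (adWeight_graded T.h_even 2)
    (adWeight_graded T.h_even (-2)) ap an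
  rw [← T.proj_sum Y, map_add, map_add, ap _ (T.projPos_mem Y), an _ (T.projNeg_mem Y),
    a0 _ (T.zero_le (T.projZero_mem Y)), add_zero, add_zero]

theorem toTKK_isCover : IsCover T.toTKK where
  lie := inferInstance
  surjective := T.toTKKLin_surjective
  central _ hx y := T.toTKK_central hx y
  perfect := T.perfect

end ShortTriple
end

noncomputable section
set_option linter.unusedSectionVars false

/-! ### Matrix computations in `sl(2, 2)` and `psl(2, 2)` -/

section Matrices

variable {F : Type*} [Field F]

theorem parity_add_self {m n : ℕ} (r : Fin m ⊕ Fin n) : parity r + parity r = 0 := by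
  generalize parity r = a
  revert a
  decide

/-- An entry in place (r, t) has degree `parity r + parity t`, so the Koszul signs can be read from
the indices and no homogeneity of X or Y is required. -/
theorem superComm_entry {m n : ℕ} (X Y : Matrix (Fin m ⊕ Fin n) (Fin m ⊕ Fin n) F)
    (r s : Fin m ⊕ Fin n) : superComm F X Y r s = ∑ t, (X r t * Y t s -
      koszul F (parity t + parity s) (parity r + parity t) * (Y r t * X t s)) := by
  refine Superspace.homogeneous_induction (F := F) (p := fun X => superComm F X Y r s =
    ∑ t, (X r t * Y t s - koszul F (parity t + parity s) (parity r + parity t) *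
      (Y r t * X t s))) (fun i X hX => ?_) (fun a b ha hb => ?_) X
  · refine Superspace.homogeneous_induction (F := F) (p := fun Y => superComm F X Y r s =
      ∑ t, (X r t * Y t s - koszul F (parity t + parity s) (parity r + parity t) *
        (Y r t * X t s))) (fun j Y hY => ?_) (fun a b ha hb => ?_) Y
    · rw [superComm_apply hX hY, Matrix.sub_apply, Matrix.smul_apply, Matrix.mul_apply,
        Matrix.mul_apply, Finset.smul_sum, ← Finset.sum_sub_distrib]
      refine Finset.sum_congr rfl fun t _ => congrArg _ ?_
      by_cases h1 : parity t + parity s = i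
      · by_cases h2 : parity r + parity t = j
        · rw [h1, h2, smul_eq_mul]
        · rw [hY r t h2]
          simp
      · rw [hX t s h1]
        simp
    · rw [map_add, Matrix.add_apply, ha, hb, ← Finset.sum_add_distrib]
      refine Finset.sum_congr rfl fun t _ => ?_
      simp only [Matrix.add_apply]
      ring
  · rw [map_add, LinearMap.add_apply, Matrix.add_apply, ha, hb, ← Finset.sum_add_distrib]
    refine Finset.sum_congr rfl fun t _ => ?_
    simp only [Matrix.add_apply]
    ring

theorem superComm_diagonal {m n : ℕ} (d : Fin m ⊕ Fin n → F)
    (Z : Matrix (Fin m ⊕ Fin n) (Fin m ⊕ Fin n) F) (r s : Fin m ⊕ Fin n) :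
    superComm F (Matrix.diagonal d) Z r s = (d r - d s) * Z r s := by
  rw [superComm_entry, Finset.sum_sub_distrib, Finset.sum_eq_single r, Finset.sum_eq_single s]
  · simp [parity_add_self]
    ring
  · intro t _ h
    simp [h]
  · simp
  · intro t _ h
    simp [h.symm]
  · simp

instance (m n : ℕ) : IsLieSuperalgebra F (GLSuper F m n) where
  skew hx hy := superComm_skew (A := Matrix (Fin m ⊕ Fin n) (Fin m ⊕ Fin n) F) hx hy
  jacobi hx hy hz :=
    superComm_jacobi (A := Matrix (Fin m ⊕ Fin n) (Fin m ⊕ Fin n) F) matrix_mul_mem hx hy hz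

theorem supertrace_two (X : Matrix (Fin 2 ⊕ Fin 2) (Fin 2 ⊕ Fin 2) F) :
    supertrace F 2 2 X = X (.inl 0) (.inl 0) + X (.inl 1) (.inl 1)
      - X (.inr 0) (.inr 0) - X (.inr 1) (.inr 1) := by
  simp [supertrace_eq, parity]
  ring

/-- The class in `psl(2, 2)` of a matrix of supertrace zero. -/
def pslMk (Z : Matrix (Fin 2 ⊕ Fin 2) (Fin 2 ⊕ Fin 2) F) (hZ : supertrace F 2 2 Z = 0) :
    PSLSuper F 2 :=
  (slScalars F 2).carrier.mkQ ⟨Z, hZ⟩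

theorem pslMk_op {Z W : Matrix (Fin 2 ⊕ Fin 2) (Fin 2 ⊕ Fin 2) F}
    (hZ : supertrace F 2 2 Z = 0) (hW : supertrace F 2 2 W = 0) :
    sop F (pslMk Z hZ) (pslMk W hW) = pslMk (superComm F Z W) (supertrace_superComm Z W) := rfl

theorem pslMk_add {Z W : Matrix (Fin 2 ⊕ Fin 2) (Fin 2 ⊕ Fin 2) F}
    (hZ : supertrace F 2 2 Z = 0) (hW : supertrace F 2 2 W = 0) :
    pslMk Z hZ + pslMk W hW = pslMk (Z + W) (by rw [map_add, hZ, hW, add_zero]) := rfl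

theorem pslMk_smul (c : F) {Z : Matrix (Fin 2 ⊕ Fin 2) (Fin 2 ⊕ Fin 2) F}
    (hZ : supertrace F 2 2 Z = 0) :
    c • pslMk Z hZ = pslMk (c • Z) (by rw [map_smul, hZ, smul_zero]) := rfl

theorem pslMk_eq_iff {Z W : Matrix (Fin 2 ⊕ Fin 2) (Fin 2 ⊕ Fin 2) F}
    (hZ : supertrace F 2 2 Z = 0) (hW : supertrace F 2 2 W = 0) :
    pslMk Z hZ = pslMk W hW ↔ ∃ c : F, Z - W = c • 1 := by
  rw [pslMk, pslMk, Submodule.mkQ_apply, Submodule.mkQ_apply, Submodule.Quotient.eq]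
  change Z - W ∈ Submodule.span F {1} ↔ _
  rw [Submodule.mem_span_singleton]
  exact exists_congr fun c => eq_comm

theorem pslMk_eq_zero_iff {Z : Matrix (Fin 2 ⊕ Fin 2) (Fin 2 ⊕ Fin 2) F}
    (hZ : supertrace F 2 2 Z = 0) : pslMk Z hZ = 0 ↔ ∃ c : F, Z = c • 1 := by
  rw [show (0 : PSLSuper F 2) = pslMk 0 (map_zero _) from rfl, pslMk_eq_iff, sub_zero]

theorem pslMk_congr {Z W : Matrix (Fin 2 ⊕ Fin 2) (Fin 2 ⊕ Fin 2) F}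
    (hZ : supertrace F 2 2 Z = 0) (h : Z = W) : pslMk Z hZ = pslMk W (h ▸ hZ) := by
  subst h
  rfl

theorem pslMk_surjective (x : PSLSuper F 2) : ∃ Z hZ, pslMk Z hZ = x := by
  obtain ⟨⟨Z, hZ⟩, rfl⟩ := (slScalars F 2).carrier.mkQ_surjective x
  exact ⟨Z, hZ, rfl⟩

theorem pslMk_mem {i : ZMod 2} {Z : Matrix (Fin 2 ⊕ Fin 2) (Fin 2 ⊕ Fin 2) F}
    (hZ : supertrace F 2 2 Z = 0) (h : Z ∈ sgr F i) : pslMk Z hZ ∈ sgr F i :=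
  ⟨⟨Z, hZ⟩, h, rfl⟩

theorem mem_psl_grade {i : ZMod 2} {x : PSLSuper F 2} (hx : x ∈ sgr F i) :
    ∃ Z hZ, Z ∈ sgr F i ∧ pslMk Z hZ = x := by
  obtain ⟨⟨Z, hZ⟩, h, rfl⟩ := hx
  exact ⟨Z, hZ, h, rfl⟩

variable (F) in
/-- The diagonal entries of `h₁ = E₁₁ - E₂₂`. -/
def wt₁ : Fin 2 ⊕ Fin 2 → F := Sum.elim ![1, -1] 0

variable (F) in
/-- The diagonal entries of `h₂ = E₃₃ - E₄₄`. -/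
def wt₂ : Fin 2 ⊕ Fin 2 → F := Sum.elim 0 ![1, -1]

theorem supertrace_wt₁ : supertrace F 2 2 (Matrix.diagonal (wt₁ F)) = 0 := by
  simp [supertrace_two, wt₁]

theorem supertrace_wt₂ : supertrace F 2 2 (Matrix.diagonal (wt₂ F)) = 0 := by
  simp [supertrace_two, wt₂]

theorem supertrace_single {r s : Fin 2 ⊕ Fin 2} (h : r ≠ s) (c : F) :
    supertrace F 2 2 (Matrix.single r s c) = 0 := by
  rw [supertrace_eq]
  refine Finset.sum_eq_zero fun t _ => ?_
  rw [Matrix.single_apply, if_neg (by rintro ⟨rfl, rfl⟩; exact h rfl), mul_zero]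

variable (F) in
/-- The class of `E_{rs}`. -/
def pslE (r s : Fin 2 ⊕ Fin 2) (h : r ≠ s) : PSLSuper F 2 :=
  pslMk (Matrix.single r s 1) (supertrace_single h 1)

variable (F) in
/-- The class of `h₁`. -/
def pslH₁ : PSLSuper F 2 := pslMk _ (supertrace_wt₁ (F := F))

variable (F) in
/-- The class of `h₂`. -/
def pslH₂ : PSLSuper F 2 := pslMk _ (supertrace_wt₂ (F := F))

theorem pslMk_diag_mem {Z : Matrix (Fin 2 ⊕ Fin 2) (Fin 2 ⊕ Fin 2) F}
    (hZ : supertrace F 2 2 Z = 0) (hd : Z.IsDiag) : pslMk Z hZ ∈ pslCartan F 2 :=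
  ⟨⟨Z, hZ⟩, hd, rfl⟩

theorem mem_pslCartan {x : PSLSuper F 2} (hx : x ∈ pslCartan F 2) :
    ∃ d hZ, pslMk (Matrix.diagonal d) hZ = x := by
  obtain ⟨⟨Z, hZ⟩, hd, rfl⟩ := hx
  have hZd : Matrix.diagonal Z.diag = Z := Matrix.IsDiag.diagonal_diag hd
  exact ⟨Matrix.diag Z, hZd.symm ▸ hZ, pslMk_congr _ hZd⟩

theorem pslH₁_mem : pslH₁ F ∈ pslCartan F 2 := pslMk_diag_mem _ (Matrix.isDiag_diagonal _)

theorem pslH₂_mem : pslH₂ F ∈ pslCartan F 2 := pslMk_diag_mem _ (Matrix.isDiag_diagonal _)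

/-- Supertrace zero makes the traces of the two diagonal blocks equal, so one scalar matrix, with
half that trace on the diagonal, renders both blocks traceless. -/
theorem pslCartan_span [CharZero F] {x : PSLSuper F 2} (hx : x ∈ pslCartan F 2) :
    ∃ a b : F, x = a • pslH₁ F + b • pslH₂ F := by
  obtain ⟨d, hZ, rfl⟩ := mem_pslCartan hx
  refine ⟨(d (.inl 0) - d (.inl 1)) / 2, (d (.inr 0) - d (.inr 1)) / 2, ?_⟩
  rw [pslH₁, pslH₂, pslMk_smul, pslMk_smul, pslMk_add, pslMk_eq_iff]
  refine ⟨(d (.inl 0) + d (.inl 1)) / 2, ?_⟩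
  rw [supertrace_two] at hZ
  simp only [Matrix.diagonal_apply_eq] at hZ
  have hd : d (.inr 0) + d (.inr 1) = d (.inl 0) + d (.inl 1) := by linear_combination -hZ
  rw [← Matrix.diagonal_smul, ← Matrix.diagonal_smul, Matrix.diagonal_add, Matrix.diagonal_sub,
    Matrix.smul_one_eq_diagonal, Matrix.diagonal_eq_diagonal_iff]
  rintro (i | i) <;> fin_cases i <;> simp [wt₁, wt₂]
  · ring
  · ring
  · linear_combination (2⁻¹ : F) * hd
  · linear_combination (2⁻¹ : F) * hd

/-- The functional `Z ↦ Z_{rr} - Z_{ss}` on `psl(2, 2)`. -/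
def diagDiff (r s : Fin 2 ⊕ Fin 2) : PSLSuper F 2 →ₗ[F] F :=
  (slScalars F 2).carrier.liftQ
    ((Matrix.entryLinearMap F F r r - Matrix.entryLinearMap F F s s) ∘ₗ
      (slSuper F 2 2).carrier.subtype) (by
    rintro ⟨Z, hZ⟩ h
    obtain ⟨c, hc⟩ := Submodule.mem_span_singleton.1 h
    change c • (1 : Matrix (Fin 2 ⊕ Fin 2) (Fin 2 ⊕ Fin 2) F) = Z at hc
    subst hc
    rw [LinearMap.mem_ker]
    change (c • (1 : Matrix (Fin 2 ⊕ Fin 2) (Fin 2 ⊕ Fin 2) F)) r r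
      - (c • (1 : Matrix (Fin 2 ⊕ Fin 2) (Fin 2 ⊕ Fin 2) F)) s s = 0
    simp)

theorem diagDiff_mk (r s : Fin 2 ⊕ Fin 2) {Z : Matrix (Fin 2 ⊕ Fin 2) (Fin 2 ⊕ Fin 2) F}
    (hZ : supertrace F 2 2 Z = 0) : diagDiff r s (pslMk Z hZ) = Z r r - Z s s := rfl

/-- The root `Z ↦ Z_{rr} - Z_{ss}`. -/
def rootOf (r s : Fin 2 ⊕ Fin 2) : Module.Dual F (pslCartan F 2) :=
  diagDiff r s ∘ₗ (pslCartan F 2).subtype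

theorem rootOf_H₁ (r s : Fin 2 ⊕ Fin 2) :
    rootOf r s ⟨pslH₁ F, pslH₁_mem⟩ = wt₁ F r - wt₁ F s := by
  change diagDiff r s (pslH₁ F) = _
  rw [pslH₁, diagDiff_mk]
  simp

theorem rootOf_H₂ (r s : Fin 2 ⊕ Fin 2) :
    rootOf r s ⟨pslH₂ F, pslH₂_mem⟩ = wt₂ F r - wt₂ F s := by
  change diagDiff r s (pslH₂ F) = _
  rw [pslH₂, diagDiff_mk]
  simp

theorem dual_ext [CharZero F] {α β : Module.Dual F (pslCartan F 2)}
    (h1 : α ⟨pslH₁ F, pslH₁_mem⟩ = β ⟨pslH₁ F, pslH₁_mem⟩)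
    (h2 : α ⟨pslH₂ F, pslH₂_mem⟩ = β ⟨pslH₂ F, pslH₂_mem⟩) : α = β := by
  ext ⟨x, hx⟩
  obtain ⟨a, b, rfl⟩ := pslCartan_span hx
  have e : (⟨a • pslH₁ F + b • pslH₂ F, hx⟩ : pslCartan F 2) =
      a • ⟨pslH₁ F, pslH₁_mem⟩ + b • ⟨pslH₂ F, pslH₂_mem⟩ := rfl
  rw [e, map_add, map_add, map_smul, map_smul, map_smul, map_smul, h1, h2]

theorem wt_ne [CharZero F] {r s : Fin 2 ⊕ Fin 2} (h : r ≠ s) (h1 : wt₁ F r - wt₁ F s = 0)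
    (h2 : wt₂ F r - wt₂ F s = 0) : False := by
  obtain r | r := r <;> obtain s | s := s <;> fin_cases r <;> fin_cases s <;>
    simp [wt₁, wt₂] at h h1 h2 <;> first | (norm_num at h1; done) | norm_num at h2

theorem rootOf_mem [CharZero F] {r s : Fin 2 ⊕ Fin 2} (h : r ≠ s) : rootOf r s ∈ rootsA11 F := by
  constructor
  · intro h0
    refine wt_ne (F := F) h ?_ ?_
    · rw [← rootOf_H₁, h0, LinearMap.zero_apply]
    · rw [← rootOf_H₂, h0, LinearMap.zero_apply]
  · intro hbot
    have hmem : pslE F r s h ∈ pslRootSpace F (rootOf r s) := by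
      rintro ⟨x, hx⟩
      obtain ⟨d, hZ, rfl⟩ := mem_pslCartan hx
      change sop F (pslMk (Matrix.diagonal d) hZ) (pslE F r s h) = (diagDiff r s (pslMk _ hZ)) • _
      rw [diagDiff_mk, pslE, pslMk_op, pslMk_smul]
      refine pslMk_congr _ ?_
      ext a b
      rw [superComm_diagonal, Matrix.smul_apply, Matrix.single_apply]
      split_ifs with hab
      · obtain ⟨rfl, rfl⟩ := hab
        simp
      · simp
    rw [hbot, Submodule.mem_bot, pslE, pslMk_eq_zero_iff] at hmem
    obtain ⟨c, hc⟩ := hmem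
    have := congrFun (congrFun hc r) s
    simp [h] at this

/-- If a representative Z has a nonzero entry off the diagonal, that entry of [h, Z] - α(h)Z, a
scalar matrix, vanishes and determines α. If Z is diagonal, it commutes with the Cartan subalgebra
and α would be zero. -/
theorem exists_rootOf_eq [CharZero F] {α : Module.Dual F (pslCartan F 2)}
    (hα : α ∈ rootsA11 F) : ∃ r s, r ≠ s ∧ α = rootOf r s := by
  obtain ⟨h0, hne⟩ := hα
  obtain ⟨x, hx, hx0⟩ := Submodule.exists_mem_ne_zero_of_ne_bot hne
  obtain ⟨Z, hZ, rfl⟩ := pslMk_surjective x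
  have h1 := hx ⟨pslH₁ F, pslH₁_mem⟩
  have h2 := hx ⟨pslH₂ F, pslH₂_mem⟩
  change pslMk (superComm F (Matrix.diagonal (wt₁ F)) Z) (supertrace_superComm _ _) = _ at h1
  rw [pslMk_smul, pslMk_eq_iff] at h1
  change pslMk (superComm F (Matrix.diagonal (wt₂ F)) Z) (supertrace_superComm _ _) = _ at h2
  rw [pslMk_smul, pslMk_eq_iff] at h2
  obtain ⟨c1, h1⟩ := h1
  obtain ⟨c2, h2⟩ := h2
  by_cases hd : ∃ r s, r ≠ s ∧ Z r s ≠ 0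
  · obtain ⟨r, s, hrs, hz⟩ := hd
    refine ⟨r, s, hrs, dual_ext ?_ ?_⟩
    · have h := congrFun (congrFun h1 r) s
      rw [Matrix.sub_apply, superComm_diagonal, Matrix.smul_apply, Matrix.smul_apply,
        Matrix.one_apply_ne hrs, smul_zero, smul_eq_mul, ← sub_mul] at h
      rw [rootOf_H₁]
      exact (sub_eq_zero.1 ((mul_eq_zero.1 h).resolve_right hz)).symm
    · have h := congrFun (congrFun h2 r) s
      rw [Matrix.sub_apply, superComm_diagonal, Matrix.smul_apply, Matrix.smul_apply,
        Matrix.one_apply_ne hrs, smul_zero, smul_eq_mul, ← sub_mul] at h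
      rw [rootOf_H₂]
      exact (sub_eq_zero.1 ((mul_eq_zero.1 h).resolve_right hz)).symm
  · push Not at hd
    have hcomm : ∀ d : Fin 2 ⊕ Fin 2 → F, superComm F (Matrix.diagonal d) Z = 0 := by
      intro d
      ext r s
      rw [superComm_diagonal]
      by_cases hrs : r = s
      · simp [hrs]
      · simp [hd r s hrs]
    have key : ∀ h : pslCartan F 2, α h = 0 := by
      rintro ⟨y, hy⟩
      have h := hx ⟨y, hy⟩
      obtain ⟨d, hd', rfl⟩ := mem_pslCartan hy
      rw [pslMk_op, pslMk_congr _ (hcomm d)] at h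
      exact (smul_eq_zero.1 h.symm).resolve_right hx0
    exact absurd (LinearMap.ext key) h0

/-! #### The short grading of `psl(2, 2)` -/

/-- The position of an index in its block. -/
def blockPos : Fin 2 ⊕ Fin 2 → Fin 2 := Sum.elim id id

/-- The block of an index. -/
def blockIdx : Fin 2 ⊕ Fin 2 → Fin 1 ⊕ Fin 1 := Sum.map (fun _ => 0) fun _ => 0

/-- The embedding of `M_{1,1}(F)` as the matrices with rows in position `a` and columns in
position `b`. -/
def blockEmb (a b : Fin 2) : Matrix (Fin 1 ⊕ Fin 1) (Fin 1 ⊕ Fin 1) F →ₗ[F]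
    Matrix (Fin 2 ⊕ Fin 2) (Fin 2 ⊕ Fin 2) F where
  toFun X := Matrix.of fun r s =>
    if blockPos r = a ∧ blockPos s = b then X (blockIdx r) (blockIdx s) else 0
  map_add' X Y := by
    ext r s
    simp only [Matrix.of_apply, Matrix.add_apply]
    split_ifs <;> simp
  map_smul' c X := by
    ext r s
    simp only [Matrix.of_apply, Matrix.smul_apply, RingHom.id_apply]
    split_ifs <;> simp

theorem blockEmb_apply (a b : Fin 2) (X : Matrix (Fin 1 ⊕ Fin 1) (Fin 1 ⊕ Fin 1) F)
    (r s : Fin 2 ⊕ Fin 2) : blockEmb a b X r s =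
      if blockPos r = a ∧ blockPos s = b then X (blockIdx r) (blockIdx s) else 0 := rfl

theorem parity_blockIdx (r : Fin 2 ⊕ Fin 2) : parity (blockIdx r) = parity r := by
  obtain r | r := r <;> rfl

theorem blockEmb_mem {i : ZMod 2} (a b : Fin 2) {X : Matrix (Fin 1 ⊕ Fin 1) (Fin 1 ⊕ Fin 1) F}
    (hX : X ∈ sgr F i) : blockEmb a b X ∈ sgr F i := by
  intro r s h
  rw [blockEmb_apply]
  split_ifs
  · exact hX _ _ (by rwa [parity_blockIdx, parity_blockIdx])
  · rfl

theorem supertrace_blockEmb {a b : Fin 2} (h : a ≠ b)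
    (X : Matrix (Fin 1 ⊕ Fin 1) (Fin 1 ⊕ Fin 1) F) : supertrace F 2 2 (blockEmb a b X) = 0 := by
  rw [supertrace_eq]
  refine Finset.sum_eq_zero fun r _ => ?_
  rw [blockEmb_apply, if_neg (fun hr => h (hr.1.symm.trans hr.2)), mul_zero]

theorem blockEmb_injective (a b : Fin 2) : Function.Injective (blockEmb (F := F) a b) := by
  intro X Y h
  ext (r | r) (s | s)
  · have := congrFun (congrFun h (.inl a)) (.inl b)
    rw [Subsingleton.elim r 0, Subsingleton.elim s 0]
    simpa [blockEmb_apply, blockPos, blockIdx] using this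
  · have := congrFun (congrFun h (.inl a)) (.inr b)
    rw [Subsingleton.elim r 0, Subsingleton.elim s 0]
    simpa [blockEmb_apply, blockPos, blockIdx] using this
  · have := congrFun (congrFun h (.inr a)) (.inl b)
    rw [Subsingleton.elim r 0, Subsingleton.elim s 0]
    simpa [blockEmb_apply, blockPos, blockIdx] using this
  · have := congrFun (congrFun h (.inr a)) (.inr b)
    rw [Subsingleton.elim r 0, Subsingleton.elim s 0]
    simpa [blockEmb_apply, blockPos, blockIdx] using this

/-- Grouping indices by their position within a block identifies M_{2,2}(F) with the 2 × 2 matrices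
over M_{1,1}(F); under this, `blockEmb a b X` is E_{ab} ⊗ X. The positions (0,1) and (1,0) carry the
outer parts of the short grading. -/
theorem blockEmb_mul (a b c d : Fin 2) (X Y : Matrix (Fin 1 ⊕ Fin 1) (Fin 1 ⊕ Fin 1) F) :
    blockEmb a b X * blockEmb c d Y = if b = c then blockEmb a d (X * Y) else 0 := by
  have key : ∀ r s t, blockEmb a b X r t * blockEmb c d Y t s =
      if blockPos r = a ∧ blockPos s = d ∧ b = c ∧ blockPos t = b then
        X (blockIdx r) (blockIdx t) * Y (blockIdx t) (blockIdx s) else 0 := by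
    intro r s t
    rw [blockEmb_apply, blockEmb_apply]
    grind
  ext r s
  simp only [Matrix.mul_apply, key, Fintype.sum_sum_type]
  by_cases h : b = c
  · subst h
    rw [if_pos rfl, blockEmb_apply, Matrix.mul_apply, Fintype.sum_sum_type]
    by_cases h' : blockPos r = a ∧ blockPos s = d
    · rw [if_pos h']
      simp only [h'.1, h'.2, true_and]
      fin_cases b <;> simp [blockPos, blockIdx]
    · rw [if_neg h']
      simp only [← and_assoc, h', false_and, if_false, Finset.sum_const_zero, add_zero]
  · simp [h]

/-- The triple products of the short grading of `gl(2, 2)`. -/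
theorem blockEmb_triple [CharZero F] {a b : Fin 2} (hab : a ≠ b) {i j : ZMod 2}
    {x y : Matrix (Fin 1 ⊕ Fin 1) (Fin 1 ⊕ Fin 1) F} (hx : x ∈ sgr F i) (hy : y ∈ sgr F j)
    (z : Matrix (Fin 1 ⊕ Fin 1) (Fin 1 ⊕ Fin 1) F) :
    superComm F (superComm F (blockEmb a b x) (blockEmb b a y)) (blockEmb a b z) =
      (2 : F) • blockEmb a b (superSymm F (superSymm F x y) z + superSymm F x (superSymm F y z)
        - koszul F i j • superSymm F y (superSymm F x z)) := by
  refine Superspace.homogeneous_induction (F := F) (p := fun z =>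
    superComm F (superComm F (blockEmb a b x) (blockEmb b a y)) (blockEmb a b z) =
      (2 : F) • blockEmb a b (superSymm F (superSymm F x y) z + superSymm F x (superSymm F y z)
        - koszul F i j • superSymm F y (superSymm F x z)))
    (fun k z hz => ?_) (fun u v hu hv => ?_) z
  · have m := @superSymm_mem F (Matrix (Fin 1 ⊕ Fin 1) (Fin 1 ⊕ Fin 1) F) _ _ _ _ matrix_mul_mem
    have hx' := blockEmb_mem a b hx
    have hy' := blockEmb_mem b a hy
    have hz' := blockEmb_mem a b hz
    rw [superComm_apply (superComm_mem matrix_mul_mem hx' hy') hz', superComm_apply hx' hy',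
      superSymm_apply (m hx hy) hz, superSymm_apply hx (m hy hz), superSymm_apply hy (m hx hz),
      superSymm_apply hx hy, superSymm_apply hy hz, superSymm_apply hx hz]
    have hba : b ≠ a := hab.symm
    simp only [sub_mul, mul_sub, smul_mul_assoc, mul_smul_comm, blockEmb_mul, hba, if_true,
      if_false, add_mul, mul_add, mul_assoc, smul_zero, sub_zero, zero_sub,
      smul_add, smul_sub, map_add, map_sub, map_smul, smul_smul]
    rcases zmod2_eq i with rfl | rfl <;> rcases zmod2_eq j with rfl | rfl <;>
    rcases zmod2_eq k with rfl | rfl <;>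
    simp only [show (1 + 1 : ZMod 2) = 0 from rfl, koszul_zero_left, koszul_zero_right,
      koszul_one_one, add_zero, _root_.zero_add, one_smul, neg_smul] <;> module
  · rw [map_add, map_add, hu, hv]
    simp only [map_add, smul_add, smul_sub, map_sub]
    abel

theorem superSymm_one_left {m n : ℕ} [CharZero F]
    (X : Matrix (Fin m ⊕ Fin n) (Fin m ⊕ Fin n) F) : superSymm F 1 X = X := by
  refine Superspace.homogeneous_induction (F := F) (p := fun X => superSymm F 1 X = X)
    (fun i X hX => ?_) (fun a b ha hb => by rw [map_add, ha, hb]) X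
  rw [superSymm_apply one_mem_grade hX, koszul_zero_left, one_smul, one_mul, mul_one]
  module

theorem superSymm_one_right {m n : ℕ} [CharZero F]
    (X : Matrix (Fin m ⊕ Fin n) (Fin m ⊕ Fin n) F) : superSymm F X 1 = X := by
  refine Superspace.homogeneous_induction (F := F) (p := fun X => superSymm F X 1 = X)
    (fun i X hX => ?_) (fun a b ha hb => by rw [map_add, LinearMap.add_apply, ha, hb]) X
  rw [superSymm_apply hX one_mem_grade, koszul_zero_right, one_smul, one_mul, mul_one]
  module

theorem blockEmb_mul_op [CharZero F] (x z : Matrix (Fin 1 ⊕ Fin 1) (Fin 1 ⊕ Fin 1) F) :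
    superComm F (superComm F (blockEmb 0 1 x) (blockEmb 1 0 1)) (blockEmb 0 1 z) =
      (2 : F) • blockEmb 0 1 (superSymm F x z) := by
  refine Superspace.homogeneous_induction (F := F) (p := fun x =>
    superComm F (superComm F (blockEmb 0 1 x) (blockEmb 1 0 1)) (blockEmb 0 1 z) =
      (2 : F) • blockEmb 0 1 (superSymm F x z)) (fun i x hx => ?_) (fun u v hu hv => ?_) x
  · rw [blockEmb_triple (by decide) hx one_mem_grade z, superSymm_one_right, superSymm_one_left,
      superSymm_one_left, koszul_zero_right, one_smul, add_sub_cancel_right]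
  · simp only [map_add, LinearMap.add_apply, hu, hv, smul_add]

theorem superComm_diagonal_single {m n : ℕ} (d : Fin m ⊕ Fin n → F) (r s : Fin m ⊕ Fin n) (c : F) :
    superComm F (Matrix.diagonal d) (Matrix.single r s c) =
      (d r - d s) • Matrix.single r s c := by
  ext a b
  rw [superComm_diagonal, Matrix.smul_apply, Matrix.single_apply]
  split_ifs with hab
  · obtain ⟨rfl, rfl⟩ := hab
    simp
  · simp

theorem single_even {m n : ℕ} {r s : Fin m ⊕ Fin n} (h : parity r = parity s) (c : F) :
    (Matrix.single r s c) ∈ sgr F 0 := by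
  intro a b hab
  rw [Matrix.single_apply, if_neg]
  rintro ⟨rfl, rfl⟩
  rw [h, parity_add_self] at hab
  exact hab rfl

theorem superComm_single_even {m n : ℕ} {r s r' s' : Fin m ⊕ Fin n} (h : parity r = parity s)
    (h' : parity r' = parity s') : superComm F (Matrix.single r s (1 : F)) (Matrix.single r' s' 1) =
      (if s = r' then Matrix.single r s' 1 else 0) - if s' = r then Matrix.single r' s 1 else 0 := by
  rw [superComm_apply (single_even h 1) (single_even h' 1), koszul_zero_left, one_smul]
  congr 1
  · split_ifs with hs
    · subst hs
      simp
    · rw [Matrix.single_mul_single_of_ne _ _ _ _ hs]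
  · split_ifs with hs
    · subst hs
      simp
    · rw [Matrix.single_mul_single_of_ne _ _ _ _ hs]

theorem diagonal_wt₁ : Matrix.diagonal (wt₁ F) =
    Matrix.single (.inl 0) (.inl 0) 1 - Matrix.single (.inl 1) (.inl 1) 1 := by
  ext (r | r) (s | s) <;> fin_cases r <;> fin_cases s <;> simp [wt₁]

theorem diagonal_wt₂ : Matrix.diagonal (wt₂ F) =
    Matrix.single (.inr 0) (.inr 0) 1 - Matrix.single (.inr 1) (.inr 1) 1 := by
  ext (r | r) (s | s) <;> fin_cases r <;> fin_cases s <;> simp [wt₂]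

theorem blockEmb_one (a b : Fin 2) : blockEmb a b (1 : Matrix (Fin 1 ⊕ Fin 1) (Fin 1 ⊕ Fin 1) F) =
    Matrix.single (.inl a) (.inl b) 1 + Matrix.single (.inr a) (.inr b) 1 := by
  ext (r | r) (s | s) <;>
    simp [blockEmb_apply, blockPos, blockIdx, Matrix.single_apply, Matrix.one_apply, eq_comm]

/-- The operators `[Z, ·]` on the upper right blocks determine a block diagonal `Z` up to
scalars. -/
theorem exists_scalar_of_comm {Z : Matrix (Fin 2 ⊕ Fin 2) (Fin 2 ⊕ Fin 2) F}
    (hZ : ∀ r s, blockPos r ≠ blockPos s → Z r s = 0)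
    (h : ∀ m, superComm F Z (blockEmb 0 1 m) = 0) : ∃ c : F, Z = c • 1 := by
  -- Three test matrices suffice: the identity makes the two diagonal corners of Z coincide, E₁₁
  -- kills the off-diagonal entries of that common corner, and E₁₂ equates its diagonal entries.
  have h1 := fun i j => congrFun (congrFun (h 1) i) j
  have h2 := fun i j => congrFun (congrFun (h (Matrix.single (.inl 0) (.inl 0) 1)) i) j
  have h3 := fun i j => congrFun (congrFun (h (Matrix.single (.inl 0) (.inr 0) 1)) i) j
  simp only [superComm_entry, Fintype.sum_sum_type, Fin.sum_univ_two, blockEmb_apply, blockPos,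
    blockIdx, Matrix.one_apply, Matrix.single_apply, Matrix.zero_apply] at h1 h2 h3
  have a1 := h1 (.inl 0) (.inl 1)
  have a2 := h1 (.inl 0) (.inr 1)
  have a3 := h1 (.inr 0) (.inl 1)
  have a4 := h1 (.inr 0) (.inr 1)
  have a5 := h2 (.inl 0) (.inr 1)
  have a6 := h2 (.inr 0) (.inl 1)
  have a7 := h3 (.inl 0) (.inr 1)
  simp [parity, show (1 + 1 : ZMod 2) = 0 from rfl] at a1 a2 a3 a4 a5 a6 a7
  refine ⟨Z (.inl 0) (.inl 0), ?_⟩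
  clear h h1 h2 h3
  ext (r | r) (s | s) <;> fin_cases r <;> fin_cases s <;> simp
  all_goals first
  | exact hZ _ _ (by decide)
  | (clear hZ; grind)

theorem superComm_wt_blockEmb (x : Matrix (Fin 1 ⊕ Fin 1) (Fin 1 ⊕ Fin 1) F) :
    superComm F (Matrix.diagonal (wt₁ F) + Matrix.diagonal (wt₂ F)) (blockEmb 0 1 x) =
      (2 : F) • blockEmb 0 1 x := by
  ext r s
  rw [Matrix.diagonal_add, superComm_diagonal, Matrix.smul_apply, blockEmb_apply]
  split_ifs with h
  · obtain ⟨hr, hs⟩ := h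
    congr 1
    obtain r | r := r <;> obtain s | s := s <;> fin_cases r <;> fin_cases s <;>
      simp [blockPos, wt₁, wt₂] at hr hs ⊢ <;> norm_num
  · simp

end Matrices
end

noncomputable section
set_option linter.unusedSectionVars false

/-! ### Joint weight spaces -/

section RootW

variable {F : Type*} [Field F] {L : Type*} [AddCommGroup L] [Module F L] [Superalgebra F L]

/-- The joint weight space of `h₁, h₂` for the values of the root `Z ↦ Z_{rr} - Z_{ss}`. -/
def rootW (h₁ h₂ : L) (r s : Fin 2 ⊕ Fin 2) : Submodule F L :=
  adWeight F h₁ (wt₁ F r - wt₁ F s) ⊓ adWeight F h₂ (wt₂ F r - wt₂ F s)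

theorem rootW_self (h₁ h₂ : L) (r : Fin 2 ⊕ Fin 2) :
    rootW (F := F) h₁ h₂ r r = adWeight F h₁ 0 ⊓ adWeight F h₂ 0 := by
  rw [rootW, sub_self, sub_self]

/-- Twelve index pairs r ≠ s yield only eight weights: each odd root of A(1,1) comes from two pairs,
so `rootOf` is not injective on pairs. -/
theorem wt_cases (r s : Fin 2 ⊕ Fin 2) : r = s ∨
    (wt₁ F r - wt₁ F s = 2 ∧ wt₂ F r - wt₂ F s = 0) ∨
    (wt₁ F r - wt₁ F s = -2 ∧ wt₂ F r - wt₂ F s = 0) ∨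
    (wt₁ F r - wt₁ F s = 0 ∧ wt₂ F r - wt₂ F s = 2) ∨
    (wt₁ F r - wt₁ F s = 0 ∧ wt₂ F r - wt₂ F s = -2) ∨
    (wt₁ F r - wt₁ F s = 1 ∧ wt₂ F r - wt₂ F s = 1) ∨
    (wt₁ F r - wt₁ F s = 1 ∧ wt₂ F r - wt₂ F s = -1) ∨
    (wt₁ F r - wt₁ F s = -1 ∧ wt₂ F r - wt₂ F s = 1) ∨
    (wt₁ F r - wt₁ F s = -1 ∧ wt₂ F r - wt₂ F s = -1) := by
  have e1 : (1 : F) + 1 = 2 := by norm_num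
  have e2 : (-1 : F) - 1 = -2 := by norm_num
  obtain r | r := r <;> obtain s | s := s <;> fin_cases r <;> fin_cases s <;>
    simp [wt₁, wt₂, e1, e2]

/-- The conversion between the weight spaces of an even lift and those of `h₁, h₂`. -/
theorem mem_weightSpaceA11 [CharZero F] {G : Subsuperalgebra F L}
    {π : SuperHom F G.carrier (PSLSuper F 2)} {B : Submodule F G.carrier} (hB : IsEvenLift π B)
    {h₁ h₂ : G.carrier} (hh₁ : h₁ ∈ B) (hh₂ : h₂ ∈ B) (hπ₁ : π h₁ = pslH₁ F)
    (hπ₂ : π h₂ = pslH₂ F) (α : Module.Dual F (pslCartan F 2)) :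
    weightSpaceA11 π B α = adWeight F h₁.1 (α ⟨pslH₁ F, pslH₁_mem⟩) ⊓
      adWeight F h₂.1 (α ⟨pslH₂ F, pslH₂_mem⟩) := by
  have key : ∀ (y : PSLSuper F 2) (hy : y ∈ pslCartan F 2) (t : PSLSuper F 2)
      (ht : t ∈ pslCartan F 2), y = t → α ⟨y, hy⟩ = α ⟨t, ht⟩ := by
    rintro y hy t ht rfl
    rfl
  ext x
  constructor
  · intro hx
    refine ⟨?_, ?_⟩
    · have h := hx h₁ hh₁ (hπ₁ ▸ pslH₁_mem)
      rwa [key _ _ _ pslH₁_mem hπ₁] at h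
    · have h := hx h₂ hh₂ (hπ₂ ▸ pslH₂_mem)
      rwa [key _ _ _ pslH₂_mem hπ₂] at h
  · rintro ⟨hx1, hx2⟩ t htB ht
    obtain ⟨a, b, hab⟩ := pslCartan_span ht
    have e : t = a • h₁ + b • h₂ := by
      refine hB.bijOn.injOn htB (B.add_mem (B.smul_mem _ hh₁) (B.smul_mem _ hh₂)) ?_
      rw [map_add, map_smul, map_smul, hπ₁, hπ₂, hab]
    have e2 : (⟨π t, ht⟩ : pslCartan F 2) = a • ⟨pslH₁ F, pslH₁_mem⟩ + b • ⟨pslH₂ F, pslH₂_mem⟩ :=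
      Subtype.ext hab
    rw [e2, map_add, map_smul, map_smul, e]
    change sop F (a • h₁.1 + b • h₂.1) x = _
    rw [map_add, map_smul, map_smul, LinearMap.add_apply, LinearMap.smul_apply,
      LinearMap.smul_apply, mem_adWeight.1 hx1, mem_adWeight.1 hx2]
    module

theorem weightSpaceA11_rootOf [CharZero F] {G : Subsuperalgebra F L}
    {π : SuperHom F G.carrier (PSLSuper F 2)} {B : Submodule F G.carrier} (hB : IsEvenLift π B)
    {h₁ h₂ : G.carrier} (hh₁ : h₁ ∈ B) (hh₂ : h₂ ∈ B) (hπ₁ : π h₁ = pslH₁ F)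
    (hπ₂ : π h₂ = pslH₂ F) (r s : Fin 2 ⊕ Fin 2) :
    weightSpaceA11 π B (rootOf r s) = rootW h₁.1 h₂.1 r s := by
  rw [mem_weightSpaceA11 hB hh₁ hh₂ hπ₁ hπ₂, rootOf_H₁, rootOf_H₂, rootW]

theorem rootOf_self (r : Fin 2 ⊕ Fin 2) : rootOf r r = (0 : Module.Dual F (pslCartan F 2)) := by
  ext ⟨x, hx⟩
  obtain ⟨Z, hZ, rfl⟩ := pslMk_surjective x
  change diagDiff r r (pslMk Z hZ) = 0
  rw [diagDiff_mk, sub_self]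

theorem rootOf_neg (r s : Fin 2 ⊕ Fin 2) :
    -rootOf r s = (rootOf s r : Module.Dual F (pslCartan F 2)) := by
  ext ⟨x, hx⟩
  obtain ⟨Z, hZ, rfl⟩ := pslMk_surjective x
  change -diagDiff r s (pslMk Z hZ) = diagDiff s r (pslMk Z hZ)
  rw [diagDiff_mk, diagDiff_mk, neg_sub]

end RootW

/-! ### The short grading of an `A(1,1)`-graded Lie superalgebra -/

section Short

variable {F : Type*} [Field F] [CharZero F] {L : Type*} [AddCommGroup L] [Module F L]
  [Superalgebra F L] [IsLieSuperalgebra F L]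

/-- Two commuting even `sl₂`-triples whose joint weights on `L` are the roots of type `A(1,1)`,
with `L₀` generated by the other weight spaces, form a short triple. -/
theorem exists_shortTriple {e₁ h₁ f₁ e₂ h₂ f₂ e h f : L} (e₁0 : e₁ ∈ sgr F 0) (h₁0 : h₁ ∈ sgr F 0)
    (e₂0 : e₂ ∈ sgr F 0) (h₂0 : h₂ ∈ sgr F 0)
    (e0 : e ∈ sgr F 0) (f0 : f ∈ sgr F 0) (h12 : h = h₁ + h₂)
    (ef₁ : sop F e₁ f₁ = h₁) (ef₂ : sop F e₂ f₂ = h₂) (he : sop F h e = (2 : F) • e)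
    (hf : sop F h f = (-2 : F) • f) (ef : sop F e f = h)
    (he₁ : sop F h e₁ = (2 : F) • e₁) (hf₁ : sop F h f₁ = (-2 : F) • f₁)
    (he₂ : sop F h e₂ = (2 : F) • e₂) (hf₂ : sop F h f₂ = (-2 : F) • f₂)
    (h₁e₁ : sop F h₁ e₁ = (2 : F) • e₁) (h₂e₂ : sop F h₂ e₂ = (2 : F) • e₂)
    (htop : ∀ Q : Submodule F L, (∀ r s, rootW h₁ h₂ r s ≤ Q) → Q = ⊤)
    (hzero : ∀ Q : Submodule F L, (∀ r s, r ≠ s →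
      Submodule.map₂ (sop F) (rootW h₁ h₂ r s) (rootW h₁ h₂ s r) ≤ Q) →
        ∀ r, rootW h₁ h₂ r r ≤ Q) :
    ∃ T : ShortTriple F L, T.e = e ∧ T.h = h ∧ T.f = f := by
  have h0 : h ∈ sgr F 0 := h12 ▸ Submodule.add_mem _ h₁0 h₂0
  have hle : ∀ {a b c : F}, a + b = c → adWeight F h₁ a ⊓ adWeight F h₂ b ≤ adWeight F h c := by
    rintro a b _ rfl x ⟨hx1, hx2⟩
    rw [mem_adWeight, h12, map_add, LinearMap.add_apply, mem_adWeight.1 hx1, mem_adWeight.1 hx2,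
      add_smul]
  -- Besides the zero weight itself, only the odd weights (1, -1) and (-1, 1) restrict to zero on h.
  have hW : ∀ r s, r = s ∨ rootW h₁ h₂ r s ≤ adWeight F h 2 ∨ rootW h₁ h₂ r s ≤ adWeight F h (-2)
      ∨ rootW h₁ h₂ r s ≤ adWeight F h₁ 1 ⊓ adWeight F h₂ (-1)
      ∨ rootW h₁ h₂ r s ≤ adWeight F h₁ (-1) ⊓ adWeight F h₂ 1 := by
    intro r s
    rcases wt_cases (F := F) r s with h | h | h | h | h | h | h | h | h
    · exact Or.inl h
    all_goals rw [rootW, h.1, h.2]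
    · exact Or.inr (Or.inl (hle (by norm_num)))
    · exact Or.inr (Or.inr (Or.inl (hle (by norm_num))))
    · exact Or.inr (Or.inl (hle (by norm_num)))
    · exact Or.inr (Or.inr (Or.inl (hle (by norm_num))))
    · exact Or.inr (Or.inl (hle (by norm_num)))
    · exact Or.inr (Or.inr (Or.inr (Or.inl le_rfl)))
    · exact Or.inr (Or.inr (Or.inr (Or.inr le_rfl)))
    · exact Or.inr (Or.inr (Or.inl (hle (by norm_num))))
  have hsum : ∀ r s, rootW h₁ h₂ r s ≤ adWeight F h 0 ∨ rootW h₁ h₂ r s ≤ adWeight F h 2 ∨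
      rootW h₁ h₂ r s ≤ adWeight F h (-2) := by
    intro r s
    rcases hW r s with rfl | h | h | h | h
    · rw [rootW_self]
      exact Or.inl (hle (by norm_num))
    · exact Or.inr (Or.inl h)
    · exact Or.inr (Or.inr h)
    · exact Or.inl (h.trans (hle (by norm_num)))
    · exact Or.inl (h.trans (hle (by norm_num)))
  have cube : ∀ x, sop F h (sop F h (sop F h x)) = (4 : F) • sop F h x := by
    have := htop (LinearMap.eqLocus (sop F h ∘ₗ sop F h ∘ₗ sop F h) ((4 : F) • sop F h)) ?_
    · intro x
      exact (this ▸ Submodule.mem_top : x ∈ LinearMap.eqLocus _ _)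
    · intro r s x hx
      change sop F h (sop F h (sop F h x)) = (4 : F) • sop F h x
      rcases hsum r s with h | h | h <;>
      · rw [mem_adWeight.1 (h hx)]
        simp only [map_smul, mem_adWeight.1 (h hx), smul_smul]
        norm_num
  -- If all eigenvalues of ad g lie in {0, ±1, ±2}, then X⁵ - 5X³ + 4X annihilates it; at 3 this
  -- polynomial takes the value 120, so there is no weight 3.
  have quint : ∀ g : L, (∀ r s, ∃ c : F, (c = 0 ∨ c = 1 ∨ c = -1 ∨ c = 2 ∨ c = -2) ∧
      rootW h₁ h₂ r s ≤ adWeight F g c) → ∀ x ∈ adWeight F g 3, x = 0 := by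
    intro g hg x hx
    have h := htop (LinearMap.eqLocus (sop F g ∘ₗ sop F g ∘ₗ sop F g ∘ₗ sop F g ∘ₗ sop F g
      + (4 : F) • sop F g) ((5 : F) • (sop F g ∘ₗ sop F g ∘ₗ sop F g))) ?_
    · have h' : x ∈ LinearMap.eqLocus (sop F g ∘ₗ sop F g ∘ₗ sop F g ∘ₗ sop F g ∘ₗ sop F g
        + (4 : F) • sop F g) ((5 : F) • (sop F g ∘ₗ sop F g ∘ₗ sop F g)) := h ▸ Submodule.mem_top
      rw [LinearMap.mem_eqLocus] at h'
      simp only [LinearMap.add_apply, LinearMap.comp_apply, LinearMap.smul_apply, map_smul,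
        mem_adWeight.1 hx, smul_smul, ← add_smul] at h'
      rw [← sub_eq_zero, ← sub_smul, smul_eq_zero] at h'
      exact h'.resolve_left (by norm_num)
    · intro r s x hx
      obtain ⟨c, hc, hle⟩ := hg r s
      have hx' := mem_adWeight.1 (hle hx)
      rw [LinearMap.mem_eqLocus]
      simp only [LinearMap.add_apply, LinearMap.comp_apply, LinearMap.smul_apply, map_smul,
        hx', smul_smul, ← add_smul]
      congr 1
      rcases hc with rfl | rfl | rfl | rfl | rfl <;> norm_num
  have q₁ : ∀ x ∈ adWeight F h₁ 3, x = 0 := quint h₁ fun r s => by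
    refine ⟨_, ?_, inf_le_left⟩
    rcases wt_cases (F := F) r s with h | h | h | h | h | h | h | h | h <;> simp [h]
  have q₂ : ∀ x ∈ adWeight F h₂ 3, x = 0 := quint h₂ fun r s => by
    refine ⟨_, ?_, inf_le_right⟩
    rcases wt_cases (F := F) r s with h | h | h | h | h | h | h | h | h <;> simp [h]
  set Q := Submodule.map₂ (sop F) (adWeight F h 2) (adWeight F h (-2)) with hQ
  -- Here [e₁, x] would have h₁-weight 3, so it is zero and x = [h₁, x] = [e₁, [f₁, x]], a bracket
  -- of h-weights 2 and -2. The weight (-1, 1) is treated alike with the second triple.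
  have hcross₁ : adWeight F h₁ 1 ⊓ adWeight F h₂ (-1) ≤ Q := by
    intro x hx
    have hxe : sop F e₁ x = 0 := q₁ _ (by
      have := adWeight_op h₁0 (mem_adWeight.2 h₁e₁) hx.1
      norm_num at this
      exact this)
    have e : sop F e₁ (sop F f₁ x) = x := by
      rw [LieSuper.jacobi_even e₁0, ef₁, hxe, map_zero, add_zero, mem_adWeight.1 hx.1, one_smul]
    rw [← e]
    refine Submodule.apply_mem_map₂ _ he₁ ?_
    have := adWeight_op h0 (mem_adWeight.2 hf₁) (hle (by norm_num : (1 : F) + -1 = 0) hx)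
    rwa [add_zero] at this
  have hcross₂ : adWeight F h₁ (-1) ⊓ adWeight F h₂ 1 ≤ Q := by
    intro x hx
    have hxe : sop F e₂ x = 0 := q₂ _ (by
      have := adWeight_op h₂0 (mem_adWeight.2 h₂e₂) hx.2
      norm_num at this
      exact this)
    have e : sop F e₂ (sop F f₂ x) = x := by
      rw [LieSuper.jacobi_even e₂0, ef₂, hxe, map_zero, add_zero, mem_adWeight.1 hx.2, one_smul]
    rw [← e]
    refine Submodule.apply_mem_map₂ _ he₂ ?_
    have := adWeight_op h0 (mem_adWeight.2 hf₂) (hle (by norm_num : (-1 : F) + 1 = 0) hx)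
    rwa [add_zero] at this
  have hg := fun c => adWeight_graded (F := F) h0 c
  have hQ0 : ∀ a ∈ adWeight F h 0, ∀ q ∈ Q, sop F a q ∈ Q := by
    intro a ha q hq
    suffices hsub : Q ≤ Q.comap (sop F a) from hsub hq
    refine Submodule.map₂_le.2 fun b hb c hc => ?_
    rw [Submodule.mem_comap]
    refine LieSuper.op_mem_of_jacobi (hg 0) (hg 2) ?_ ?_ (hg (-2)) ha hb hc
    · intro a ha b hb c hc
      refine Submodule.apply_mem_map₂ _ ?_ hc
      have := adWeight_op h0 ha hb
      rwa [_root_.zero_add] at this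
    · intro a ha b hb c hc
      refine Submodule.apply_mem_map₂ _ hb ?_
      have := adWeight_op h0 ha hc
      rwa [_root_.zero_add] at this
  -- Condition (3) reduces this to the brackets [L_α, L₋α]. If α(h) = ±2 they lie in Q by
  -- definition; if α(h) = 0 then L_α ⊆ Q by the cross cases, and Q is stable under the weight 0
  -- space.
  have hself : ∀ r, rootW h₁ h₂ r r ≤ Q := by
    refine hzero Q fun r s hrs => Submodule.map₂_le.2 fun a ha b hb => ?_
    -- The case split on h-weights is by inclusion, so a zero space could satisfy several cases; a
    -- nonzero a pins the weight of the pair (r, s), and then (s, r) has the opposite weight.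
    have hneg : ∀ {c : F}, rootW h₁ h₂ r s ≤ adWeight F h c → rootW h₁ h₂ s r ≤ adWeight F h (-c)
        ∨ a = 0 := by
      intro c hc
      by_cases ha0 : a = 0
      · exact Or.inr ha0
      left
      have h1 : (wt₁ F r - wt₁ F s) + (wt₂ F r - wt₂ F s) = c := by
        have h1 := mem_adWeight.1 (hle rfl ha)
        rw [mem_adWeight.1 (hc ha), ← sub_eq_zero, ← sub_smul, smul_eq_zero] at h1
        exact (sub_eq_zero.1 (h1.resolve_right ha0)).symm
      exact hle (by rw [← h1]; ring)
    rcases hW r s with h' | h' | h' | h' | h'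
    · exact absurd h' hrs
    · rcases hneg h' with h'' | h''
      · exact Submodule.apply_mem_map₂ _ (h' ha) (h'' hb)
      · simp [h'']
    · rcases hneg h' with h'' | h''
      · rw [neg_neg] at h''
        exact LieSuper.op_mem_of_swap (hg (-2)) (hg 2)
          (fun b hb a ha => Submodule.apply_mem_map₂ _ hb ha) (h' ha) (h'' hb)
      · simp [h'']
    all_goals
      have hc : rootW h₁ h₂ r s ≤ adWeight F h 0 := h'.trans (hle (by norm_num))
      rcases hneg hc with h'' | h''
      · rw [neg_zero] at h''
        exact LieSuper.op_mem_of_swap ((hg 0).inf ((hg 2).map₂ (hg (-2)))) (hg 0)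
          (fun b hb a ha => hQ0 b hb a ha.2) ⟨hc ha, (by first | exact hcross₁ (h' ha) | exact hcross₂ (h' ha))⟩ (h'' hb)
      · simp [h'']
  have zero_le : adWeight F h 0 ≤ Q := by
    -- The operator 4 - (ad h)² is four times the projection to weight 0. It sends every joint
    -- weight space into Q, hence all of L.
    have hp := htop (Q.comap ((4 : F) • LinearMap.id - sop F h ∘ₗ sop F h)) ?_
    · intro x hx
      have h1 : x ∈ Q.comap ((4 : F) • LinearMap.id - sop F h ∘ₗ sop F h) :=
        hp ▸ Submodule.mem_top
      rw [Submodule.mem_comap] at h1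
      simp only [LinearMap.sub_apply, LinearMap.smul_apply, LinearMap.id_apply,
        LinearMap.comp_apply, mem_adWeight.1 hx, zero_smul, map_zero, sub_zero] at h1
      exact (Submodule.smul_mem_iff _ (by norm_num)).1 h1
    · intro r s x hx
      rw [Submodule.mem_comap]
      simp only [LinearMap.sub_apply, LinearMap.smul_apply, LinearMap.id_apply,
        LinearMap.comp_apply]
      rcases hW r s with rfl | h' | h' | h' | h'
      · have hx0 := hself r hx
        rw [rootW_self] at hx
        simpa [mem_adWeight.1 (hle (add_zero 0) hx)] using Q.smul_mem 4 hx0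
      · rw [mem_adWeight.1 (h' hx), map_smul, mem_adWeight.1 (h' hx), smul_smul, ← sub_smul]
        norm_num
      · rw [mem_adWeight.1 (h' hx), map_smul, mem_adWeight.1 (h' hx), smul_smul, ← sub_smul]
        norm_num
      · simpa [mem_adWeight.1 (hle (by norm_num : (1 : F) + -1 = 0) (h' hx))] using
          Q.smul_mem 4 (hcross₁ (h' hx))
      · simpa [mem_adWeight.1 (hle (by norm_num : (-1 : F) + 1 = 0) (h' hx))] using
          Q.smul_mem 4 (hcross₂ (h' hx))
  exact ⟨⟨e, h, f, e0, h0, f0, he, hf, ef, cube, zero_le⟩, rfl, rfl, rfl⟩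

end Short
end

noncomputable section
set_option linter.unusedSectionVars false

/-! ### `A(1,1)`-graded Lie superalgebras are centrally isogenous to `TKK(J)` -/

section Psl

variable {F : Type*} [Field F]

theorem pslH₁_op_pslE (r s : Fin 2 ⊕ Fin 2) (h : r ≠ s) :
    sop F (pslH₁ F) (pslE F r s h) = (wt₁ F r - wt₁ F s) • pslE F r s h := by
  rw [pslE, pslH₁, pslMk_op, pslMk_smul]
  exact pslMk_congr _ (superComm_diagonal_single _ r s 1)

theorem pslH₂_op_pslE (r s : Fin 2 ⊕ Fin 2) (h : r ≠ s) :
    sop F (pslH₂ F) (pslE F r s h) = (wt₂ F r - wt₂ F s) • pslE F r s h := by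
  rw [pslE, pslH₂, pslMk_op, pslMk_smul]
  exact pslMk_congr _ (superComm_diagonal_single _ r s 1)

variable (F) in
/-- `e₁ = E₁₂`. -/
def pslE₁ : PSLSuper F 2 := pslE F (.inl 0) (.inl 1) (by decide)

variable (F) in
/-- `f₁ = E₂₁`. -/
def pslF₁ : PSLSuper F 2 := pslE F (.inl 1) (.inl 0) (by decide)

variable (F) in
/-- `e₂ = E₃₄`. -/
def pslE₂ : PSLSuper F 2 := pslE F (.inr 0) (.inr 1) (by decide)

variable (F) in
/-- `f₂ = E₄₃`. -/
def pslF₂ : PSLSuper F 2 := pslE F (.inr 1) (.inr 0) (by decide)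

theorem pslE_even {r s : Fin 2 ⊕ Fin 2} (h : r ≠ s) (hp : parity r = parity s) :
    pslE F r s h ∈ sgr F 0 := pslMk_mem _ (single_even hp 1)

theorem pslH₁_even : pslH₁ F ∈ sgr F 0 := by
  refine pslMk_mem _ ?_
  rw [diagonal_wt₁]
  exact Submodule.sub_mem _ (single_even rfl 1) (single_even rfl 1)

theorem pslH₂_even : pslH₂ F ∈ sgr F 0 := by
  refine pslMk_mem _ ?_
  rw [diagonal_wt₂]
  exact Submodule.sub_mem _ (single_even rfl 1) (single_even rfl 1)

theorem pslE₁_op_pslF₁ : sop F (pslE₁ F) (pslF₁ F) = pslH₁ F := by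
  rw [pslE₁, pslF₁, pslE, pslE, pslMk_op, pslH₁]
  refine pslMk_congr _ ?_
  rw [superComm_single_even (by rfl) (by rfl), if_pos rfl, if_pos rfl, diagonal_wt₁]

theorem pslE₂_op_pslF₂ : sop F (pslE₂ F) (pslF₂ F) = pslH₂ F := by
  rw [pslE₂, pslF₂, pslE, pslE, pslMk_op, pslH₂]
  refine pslMk_congr _ ?_
  rw [superComm_single_even (by rfl) (by rfl), if_pos rfl, if_pos rfl, diagonal_wt₂]

theorem pslE_op_eq_zero {r s r' s' : Fin 2 ⊕ Fin 2} (h : r ≠ s) (h' : r' ≠ s')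
    (hp : parity r = parity s) (hp' : parity r' = parity s') (h1 : s ≠ r') (h2 : s' ≠ r) :
    sop F (pslE F r s h) (pslE F r' s' h') = 0 := by
  rw [pslE, pslE, pslMk_op]
  refine (pslMk_congr _ ?_).trans (show pslMk 0 (map_zero _) = 0 from rfl)
  rw [superComm_single_even hp hp', if_neg h1, if_neg h2, sub_zero]

variable (F) in
/-- The embedding of `M_{1,1}(F)` as the upper right blocks, modulo scalars. -/
def pslPos : Matrix (Fin 1 ⊕ Fin 1) (Fin 1 ⊕ Fin 1) F →ₗ[F] PSLSuper F 2 where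
  toFun m := pslMk (blockEmb 0 1 m) (supertrace_blockEmb (by decide) m)
  map_add' m n := by
    rw [pslMk_add]
    exact pslMk_congr _ (map_add _ m n)
  map_smul' c m := by
    rw [RingHom.id_apply, pslMk_smul]
    exact pslMk_congr _ (map_smul _ c m)

theorem pslPos_injective : Function.Injective (pslPos F) := by
  refine (injective_iff_map_eq_zero _).2 fun m hm => ?_
  obtain ⟨c, hc⟩ := (pslMk_eq_zero_iff (supertrace_blockEmb (by decide) m)).1 hm
  have h := congrFun (congrFun hc (.inl 0)) (.inl 0)
  rw [blockEmb_apply, if_neg (by decide), Matrix.smul_apply, Matrix.one_apply_eq, smul_eq_mul,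
    mul_one] at h
  rw [← h, zero_smul] at hc
  exact blockEmb_injective 0 1 (hc.trans (map_zero _).symm)

theorem pslPos_one : pslPos F 1 = pslE₁ F + pslE₂ F := by
  rw [pslE₁, pslE₂, pslE, pslE, pslMk_add]
  exact pslMk_congr _ (blockEmb_one 0 1)

theorem pslPos_op [CharZero F] (x z : Matrix (Fin 1 ⊕ Fin 1) (Fin 1 ⊕ Fin 1) F) :
    sop F (sop F (pslPos F x) (pslF₁ F + pslF₂ F)) (pslPos F z) =
      (2 : F) • pslPos F (superSymm F x z) := by
  have hf : pslF₁ F + pslF₂ F = pslMk (blockEmb 1 0 1) (supertrace_blockEmb (by decide) 1) := by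
    rw [pslF₁, pslF₂, pslE, pslE, pslMk_add]
    exact pslMk_congr _ (blockEmb_one 1 0).symm
  rw [hf]
  change sop F (sop F (pslMk _ _) _) (pslMk _ _) = (2 : F) • pslMk _ _
  rw [pslMk_op, pslMk_op, pslMk_smul]
  exact pslMk_congr _ (blockEmb_mul_op x z)

theorem pslH_op_pslPos (x : Matrix (Fin 1 ⊕ Fin 1) (Fin 1 ⊕ Fin 1) F) :
    sop F (pslH₁ F + pslH₂ F) (pslPos F x) = (2 : F) • pslPos F x := by
  rw [pslH₁, pslH₂, pslMk_add]
  change sop F _ (pslMk _ _) = (2 : F) • pslMk _ _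
  rw [pslMk_op, pslMk_smul]
  exact pslMk_congr _ (superComm_wt_blockEmb x)

end Psl

section Forward

variable {F : Type*} [Field F] [CharZero F] {L : Type*} [AddCommGroup L] [Module F L]
  [Superalgebra F L] [IsLieSuperalgebra F L]

/-- If the short triple `T` lies in a cover `G ⊆ L` of `psl(2, 2)` and lifts the standard one, then
the Jordan superalgebra of `T` contains `M_{1,1}(F)⁺`. -/
theorem containsM11_of_lift (T : ShortTriple F L) {G : Subsuperalgebra F L}
    {π : SuperHom F G.carrier (PSLSuper F 2)} (hπ : IsCover π) {e h f : G.carrier}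
    (hTe : T.e = e.1) (hTh : T.h = h.1) (hTf : T.f = f.1)
    (he : π e = pslE₁ F + pslE₂ F) (hh : π h = pslH₁ F + pslH₂ F)
    (hf : π f = pslF₁ F + pslF₂ F) : ContainsM11 F T.J := by
  obtain ⟨s, hs, hs0⟩ := exists_even_section π hπ.surjective
  -- Applying ad h / 2 to an arbitrary lift removes its kernel component and gives the lift of
  -- weight 2.
  let Φ : Matrix (Fin 1 ⊕ Fin 1) (Fin 1 ⊕ Fin 1) F →ₗ[F] G.carrier :=
    (2⁻¹ : F) • (sop F h ∘ₗ s ∘ₗ pslPos F)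
  have hΦ : ∀ m, Φ m = (2⁻¹ : F) • sop F h (s (pslPos F m)) := fun m => rfl
  have hπΦ : ∀ m, π (Φ m) = pslPos F m := by
    intro m
    rw [hΦ, map_smul, π.map_op, hs, hh, pslH_op_pslPos, smul_smul, inv_mul_cancel₀ two_ne_zero,
      one_smul]
  have hw : ∀ m, sop F h (Φ m) = (2 : F) • Φ m := by
    intro m
    rw [hπ.op_central (x' := h) (y' := s (pslPos F m)) rfl (by rw [hπΦ, hs]), hΦ, smul_smul,
      mul_inv_cancel₀ two_ne_zero, one_smul]
  -- Weight 2 vectors of the cover are determined by their images, so the unit and the product can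
  -- be checked in psl(2,2).
  have huniq : ∀ x y : G.carrier, sop F h x = (2 : F) • x → sop F h y = (2 : F) • y →
      π x = π y → x = y := by
    intro x y hx hy hxy
    have h2 := hπ.op_central (x := h) rfl hxy
    rw [hx, hy] at h2
    exact smul_right_injective _ (two_ne_zero (α := F)) h2
  have hval : ∀ m, (Φ m).1 ∈ adWeight F T.h 2 := fun m => by
    rw [mem_adWeight, hTh]
    exact congrArg Subtype.val (hw m)
  let φ : Matrix (Fin 1 ⊕ Fin 1) (Fin 1 ⊕ Fin 1) F →ₗ[F] T.J :=
    (G.carrier.subtype ∘ₗ Φ).codRestrict (adWeight F T.h 2) hval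
  have hφ : ∀ m, T.val (φ m) = (Φ m).1 := fun m => rfl
  have hone : φ 1 = T.one := by
    refine T.val_injective ?_
    rw [hφ, T.val_one, hTe]
    refine congrArg Subtype.val (huniq _ _ (hw 1) ?_ ?_)
    · have := T.he
      rw [hTe, hTh] at this
      exact Subtype.ext this
    · rw [hπΦ, pslPos_one, he]
  have heven : h ∈ sgr F 0 := by
    have := T.h_even
    rw [hTh] at this
    exact this
  have hmul : ∀ m n, φ (superSymm F m n) = sop F (φ m) (φ n) := by
    intro m n
    refine T.val_injective ?_
    have e : T.val (sop F (φ m) (φ n)) = ((2⁻¹ : F) • sop F (sop F (Φ m) f) (Φ n)).1 := by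
      rw [T.val_op, T.t_apply, hTf, hφ, hφ, map_smul, LinearMap.smul_apply]
      rfl
    have hwt := T.val_weight (sop F (φ m) (φ n))
    rw [e, mem_adWeight, hTh] at hwt
    rw [e, hφ]
    refine congrArg Subtype.val (huniq _ _ (hw _) (Subtype.ext hwt) ?_)
    rw [map_smul, π.map_op, π.map_op, hπΦ, hπΦ, hπΦ, hf, pslPos_op, smul_smul,
      inv_mul_cancel₀ two_ne_zero, one_smul]
  refine ⟨⟨φ, ?_, hmul⟩, ?_, ?_⟩
  · intro i x hx
    refine T.val_mem.2 ?_
    have h1 : s (pslPos F x) ∈ sgr F i := hs0 i _ (pslMk_mem _ (blockEmb_mem 0 1 hx))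
    have h2 := Superalgebra.op_mem (F := F) heven h1
    rw [_root_.zero_add] at h2
    exact Submodule.smul_mem (sgr F i) (2⁻¹ : F) h2
  · intro m n hmn
    have h1 : Φ m = Φ n := Subtype.ext (congrArg T.val hmn)
    refine pslPos_injective ?_
    rw [← hπΦ m, ← hπΦ n, h1]
  · intro a
    have hone' : (φ (1 : Matrix (Fin 1 ⊕ Fin 1) (Fin 1 ⊕ Fin 1) F)) = T.one := hone
    change sop F (φ (1 : Matrix (Fin 1 ⊕ Fin 1) (Fin 1 ⊕ Fin 1) F)) a = a ∧
      sop F a (φ (1 : Matrix (Fin 1 ⊕ Fin 1) (Fin 1 ⊕ Fin 1) F)) = a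
    rw [hone']
    exact ⟨T.one_op a, T.op_one a⟩

/-- As π is injective on the subalgebra B, the relations of the two sl₂-triples of psl(2,2) hold
verbatim for their lifts in B. The diagonal triple e₁ + e₂, h₁ + h₂, f₁ + f₂ then meets the
hypotheses of `exists_shortTriple`. -/
theorem exists_lift_triple {G : Subsuperalgebra F L}
    {π : SuperHom F G.carrier (PSLSuper F 2)} {B : Submodule F G.carrier} (hB : IsEvenLift π B)
    (htop : (⨆ α : ↥(insert 0 (rootsA11 F)), weightSpaceA11 π B α.1) = ⊤)
    (hzero : weightSpaceA11 π B 0 = ⨆ α ∈ rootsA11 F,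
      Submodule.map₂ (sop F) (weightSpaceA11 π B α) (weightSpaceA11 π B (-α))) :
    ∃ (T : ShortTriple F L) (e h f : G.carrier), T.e = e.1 ∧ T.h = h.1 ∧ T.f = f.1 ∧
      π e = pslE₁ F + pslE₂ F ∧ π h = pslH₁ F + pslH₂ F ∧ π f = pslF₁ F + pslF₂ F := by
  obtain ⟨e₁, e₁B, he₁⟩ := hB.bijOn.surjOn
    (pslE_even (F := F) (r := .inl 0) (s := .inl 1) (by decide) rfl)
  obtain ⟨f₁, f₁B, hf₁⟩ := hB.bijOn.surjOn
    (pslE_even (F := F) (r := .inl 1) (s := .inl 0) (by decide) rfl)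
  obtain ⟨e₂, e₂B, he₂⟩ := hB.bijOn.surjOn
    (pslE_even (F := F) (r := .inr 0) (s := .inr 1) (by decide) rfl)
  obtain ⟨f₂, f₂B, hf₂⟩ := hB.bijOn.surjOn
    (pslE_even (F := F) (r := .inr 1) (s := .inr 0) (by decide) rfl)
  obtain ⟨h₁, h₁B, hh₁⟩ := hB.bijOn.surjOn (pslH₁_even (F := F))
  obtain ⟨h₂, h₂B, hh₂⟩ := hB.bijOn.surjOn (pslH₂_even (F := F))
  have hrel : ∀ {x y z : G.carrier}, x ∈ B → y ∈ B → z ∈ B → sop F (π x) (π y) = π z →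
      sop F x.1 y.1 = z.1 := by
    intro x y z hx hy hz h
    refine congrArg Subtype.val (hB.bijOn.injOn (hB.op_mem x hx y hy) hz ?_)
    rw [π.map_op, h]
  have hsm : ∀ {x y : G.carrier} (c : F), x ∈ B → y ∈ B → sop F (π x) (π y) = c • π y →
      sop F x.1 y.1 = c • y.1 := by
    intro x y c hx hy h
    exact hrel hx hy (B.smul_mem c hy) (by rw [h, map_smul])
  have hz : ∀ {x y : G.carrier}, x ∈ B → y ∈ B → sop F (π x) (π y) = 0 →
      sop F x.1 y.1 = 0 := by
    intro x y hx hy h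
    exact hrel hx hy B.zero_mem (by rw [h, map_zero])
  have hB0 : ∀ {x : G.carrier}, x ∈ B → x.1 ∈ sgr F 0 := fun hx => hB.le_even hx
  have e1 : (1 : F) - -1 = 2 := by norm_num
  have e2 : (-1 : F) - 1 = -2 := by norm_num
  have e1' : (1 : F) + 1 = 2 := by norm_num
  have r11 : sop F h₁.1 e₁.1 = (2 : F) • e₁.1 := hsm 2 h₁B e₁B (by
    rw [hh₁, he₁, pslH₁_op_pslE]; simp [wt₁, e1'])
  have r12 : sop F h₁.1 e₂.1 = 0 := hz h₁B e₂B (by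
    rw [hh₁, he₂, pslH₁_op_pslE]; simp [wt₁])
  have r21 : sop F h₂.1 e₁.1 = 0 := hz h₂B e₁B (by
    rw [hh₂, he₁, pslH₂_op_pslE]; simp [wt₂])
  have r22 : sop F h₂.1 e₂.1 = (2 : F) • e₂.1 := hsm 2 h₂B e₂B (by
    rw [hh₂, he₂, pslH₂_op_pslE]; simp [wt₂, e1'])
  have s11 : sop F h₁.1 f₁.1 = (-2 : F) • f₁.1 := hsm (-2) h₁B f₁B (by
    rw [hh₁, hf₁, pslH₁_op_pslE]; simp [wt₁, e2])
  have s12 : sop F h₁.1 f₂.1 = 0 := hz h₁B f₂B (by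
    rw [hh₁, hf₂, pslH₁_op_pslE]; simp [wt₁])
  have s21 : sop F h₂.1 f₁.1 = 0 := hz h₂B f₁B (by
    rw [hh₂, hf₁, pslH₂_op_pslE]; simp [wt₂])
  have s22 : sop F h₂.1 f₂.1 = (-2 : F) • f₂.1 := hsm (-2) h₂B f₂B (by
    rw [hh₂, hf₂, pslH₂_op_pslE]; simp [wt₂, e2])
  have t11 : sop F e₁.1 f₁.1 = h₁.1 := hrel e₁B f₁B h₁B (by
    rw [he₁, hf₁, hh₁]; exact pslE₁_op_pslF₁)
  have t22 : sop F e₂.1 f₂.1 = h₂.1 := hrel e₂B f₂B h₂B (by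
    rw [he₂, hf₂, hh₂]; exact pslE₂_op_pslF₂)
  have t12 : sop F e₁.1 f₂.1 = 0 := hz e₁B f₂B (by
    rw [he₁, hf₂]; exact pslE_op_eq_zero _ _ rfl rfl (by decide) (by decide))
  have t21 : sop F e₂.1 f₁.1 = 0 := hz e₂B f₁B (by
    rw [he₂, hf₁]; exact pslE_op_eq_zero _ _ rfl rfl (by decide) (by decide))
  have hW := weightSpaceA11_rootOf hB h₁B h₂B hh₁ hh₂
  have htop' : ∀ Q : Submodule F L, (∀ r s, rootW h₁.1 h₂.1 r s ≤ Q) → Q = ⊤ := by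
    intro Q hQ
    rw [eq_top_iff, ← htop]
    refine iSup_le fun ⟨α, hα⟩ => ?_
    rcases hα with rfl | hα
    · rw [← rootOf_self (.inl 0), hW]
      exact hQ _ _
    · obtain ⟨r, s, -, rfl⟩ := exists_rootOf_eq hα
      rw [hW]
      exact hQ r s
  have hzero' : ∀ Q : Submodule F L, (∀ r s, r ≠ s →
      Submodule.map₂ (sop F) (rootW h₁.1 h₂.1 r s) (rootW h₁.1 h₂.1 s r) ≤ Q) →
        ∀ r, rootW h₁.1 h₂.1 r r ≤ Q := by
    intro Q hQ r
    rw [← hW, rootOf_self, hzero]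
    refine iSup₂_le fun α hα => ?_
    obtain ⟨r, s, hrs, rfl⟩ := exists_rootOf_eq hα
    rw [rootOf_neg, hW, hW]
    exact hQ r s hrs
  obtain ⟨T, hTe, hTh, hTf⟩ := exists_shortTriple (F := F) (e₁ := e₁.1) (h₁ := h₁.1) (f₁ := f₁.1)
    (e₂ := e₂.1) (h₂ := h₂.1) (f₂ := f₂.1) (e := e₁.1 + e₂.1) (h := h₁.1 + h₂.1)
    (f := f₁.1 + f₂.1) (hB0 e₁B) (hB0 h₁B) (hB0 e₂B) (hB0 h₂B)
    (Submodule.add_mem _ (hB0 e₁B) (hB0 e₂B)) (Submodule.add_mem _ (hB0 f₁B) (hB0 f₂B)) rfl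
    t11 t22 (by simp [r11, r12, r21, r22]) (by simp [s11, s12, s21, s22, add_comm])
    (by simp [t11, t12, t21, t22]) (by simp [r11, r21]) (by simp [s11, s21])
    (by simp [r12, r22]) (by simp [s12, s22]) r11 r22 htop' hzero'
  · refine ⟨T, e₁ + e₂, h₁ + h₂, f₁ + f₂, hTe, hTh, hTf, ?_, ?_, ?_⟩
    · rw [map_add, he₁, he₂]; rfl
    · rw [map_add, hh₁, hh₂]
    · rw [map_add, hf₁, hf₂]; rfl

end Forward

theorem exists_tkk_of_isA11Graded {F : Type u} [Field F] [CharZero F] {L : Type v}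
    [AddCommGroup L] [Module F L] [Superalgebra F L] [IsLieSuperalgebra F L]
    (hL : IsA11Graded F L) :
    ∃ (J : Type v) (_ : AddCommGroup J) (_ : Module F J) (_ : Superalgebra F J)
        (_ : IsJordanSuperalgebra F J), ContainsM11 F J ∧ CentrallyIsogenous F L (TKK F J) := by
  obtain ⟨-, G, π, B, hπ, hB, -, htop, hzero⟩ := hL
  obtain ⟨T, e, h, f, hTe, hTh, hTf, he, hh, hf⟩ := exists_lift_triple hB htop hzero
  exact ⟨T.J, inferInstance, inferInstance, inferInstance, inferInstance,
    containsM11_of_lift T hπ hTe hTh hTf he hh hf, centrallyIsogenous_of_cover T.toTKK T.toTKK_isCover⟩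

end

noncomputable section
set_option linter.unusedSectionVars false

/-! ### Homomorphisms and products -/

section Factor

variable {F : Type*} [Field F]

/-- The composite of q with any even section of p is multiplicative, since q does not notice changes
within the kernel of p. -/
theorem SuperHom.exists_factor {A B C : Type*} [AddCommGroup A] [Module F A] [Superalgebra F A]
    [AddCommGroup B] [Module F B] [Superalgebra F B] [AddCommGroup C] [Module F C]
    [Superalgebra F C] (p : SuperHom F A B) (hp : Function.Surjective p) (q : SuperHom F A C)
    (h : ∀ a, p a = 0 → q a = 0) : ∃ r : SuperHom F B C, ∀ a, r (p a) = q a := by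
  obtain ⟨s, hs, hs0⟩ := exists_even_section p hp
  have key : ∀ a, q (s (p a)) = q a := by
    intro a
    have := h (s (p a) - a) (by rw [map_sub, hs, sub_self])
    rwa [map_sub, sub_eq_zero] at this
  refine ⟨⟨q.toLinearMap ∘ₗ s, fun hx => q.map_grade (hs0 _ _ hx), fun x y => ?_⟩, key⟩
  rw [LinearMap.comp_apply, LinearMap.comp_apply, LinearMap.comp_apply, ← q.map_op, ← key (sop F _ _),
    p.map_op, hs, hs]

/-- The product of two superalgebras. -/
instance {A B : Type*} [AddCommGroup A] [Module F A] [Superalgebra F A]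
    [AddCommGroup B] [Module F B] [Superalgebra F B] : Superalgebra F (A × B) where
  op := LinearMap.mk₂ F (fun x y => (sop F x.1 y.1, sop F x.2 y.2))
    (fun x y z => by simp) (fun c x y => by simp) (fun x y z => by simp) (fun c x y => by simp)
  op_mem hx hy := ⟨Superalgebra.op_mem (F := F) hx.1 hy.1, Superalgebra.op_mem (F := F) hx.2 hy.2⟩

theorem prod_sop {A B : Type*} [AddCommGroup A] [Module F A] [Superalgebra F A]
    [AddCommGroup B] [Module F B] [Superalgebra F B] (x y : A × B) :
    sop F x y = (sop F x.1 y.1, sop F x.2 y.2) := rfl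

instance {A B : Type*} [AddCommGroup A] [Module F A] [Superalgebra F A] [IsLieSuperalgebra F A]
    [AddCommGroup B] [Module F B] [Superalgebra F B] [IsLieSuperalgebra F B] :
    IsLieSuperalgebra F (A × B) where
  skew hx hy := Prod.ext (IsLieSuperalgebra.skew hx.1 hy.1) (IsLieSuperalgebra.skew hx.2 hy.2)
  jacobi hx hy hz := Prod.ext (IsLieSuperalgebra.jacobi hx.1 hy.1 hz.1)
    (IsLieSuperalgebra.jacobi hx.2 hy.2 hz.2)

instance {A : Type*} [AddCommGroup A] [Module F A] [Superalgebra F A] [IsLieSuperalgebra F A]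
    (S : Subsuperalgebra F A) : IsLieSuperalgebra F S.carrier where
  skew hx hy := Subtype.ext (IsLieSuperalgebra.skew (F := F) (L := A) hx hy)
  jacobi hx hy hz := Subtype.ext (IsLieSuperalgebra.jacobi (F := F) (L := A) hx hy hz)

theorem IsGradedSub.sup {V : Type*} [AddCommGroup V] [Module F V] [Superspace F V]
    {A B : Submodule F V} (hA : IsGradedSub A) (hB : IsGradedSub B) : IsGradedSub (A ⊔ B) := by
  intro i x hx
  obtain ⟨a, ha, b, hb, rfl⟩ := Submodule.mem_sup.1 hx
  rw [map_add]
  exact Submodule.add_mem_sup (hA i ha) (hB i hb)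

theorem IsGradedSub.range {V W : Type*} [AddCommGroup V] [Module F V] [Superspace F V]
    [AddCommGroup W] [Module F W] [Superspace F W] {f : V →ₗ[F] W}
    (hf : ∀ (i : ZMod 2) (x : V), x ∈ sgr F i → f x ∈ sgr F i) :
    IsGradedSub (LinearMap.range f) := by
  rw [LinearMap.range_eq_map]
  exact IsGradedSub.top.map hf

/-- The vector c • x = [h, x] depends only on the image of x. This rigidity of nonzero weights is
what lifts relations exactly and not merely up to central elements. -/
theorem IsCentralExtension.eq_of_weight {E M : Type*} [AddCommGroup E] [Module F E]
    [Superalgebra F E] [AddCommGroup M] [Module F M] [Superalgebra F M] {ε : SuperHom F E M}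
    (hε : IsCentralExtension ε) {h x y : E} {c : F} (hc : c ≠ 0) (hx : sop F h x = c • x)
    (hy : sop F h y = c • y) (hxy : ε x = ε y) : x = y := by
  have h2 := hε.op_central (x := h) rfl hxy
  rw [hx, hy] at h2
  exact smul_right_injective _ hc h2

end Factor

/-! ### Subsuperalgebras `X + [X, Y] + Y` -/

section ShortSub

variable {F : Type*} [Field F] {E : Type*} [AddCommGroup E] [Module F E] [Superalgebra F E]
  [IsLieSuperalgebra F E]

/-- Graded subspaces `X, Y` with `[X, X] = 0 = [Y, Y]`, `[[X, Y], X] ⊆ X` and `[[X, Y], Y] ⊆ Y`. -/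
structure IsShortPair (X Y : Submodule F E) : Prop where
  graded_left : IsGradedSub X
  graded_right : IsGradedSub Y
  left_left : ∀ x ∈ X, ∀ x' ∈ X, sop F x x' = 0
  right_right : ∀ y ∈ Y, ∀ y' ∈ Y, sop F y y' = 0
  act_left : ∀ x ∈ X, ∀ y ∈ Y, ∀ x' ∈ X, sop F (sop F x y) x' ∈ X
  act_right : ∀ x ∈ X, ∀ y ∈ Y, ∀ y' ∈ Y, sop F (sop F x y) y' ∈ Y

namespace IsShortPair

variable {X Y : Submodule F E}

theorem zero_left (hXY : IsShortPair X Y) {z x : E} (hz : z ∈ Submodule.map₂ (sop F) X Y) (hx : x ∈ X) :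
    sop F z x ∈ X := by
  suffices h : Submodule.map₂ (sop F) X Y ≤ X.comap ((sop F).flip x) from h hz
  exact Submodule.map₂_le.2 fun a ha b hb => hXY.act_left a ha b hb x hx

theorem zero_right (hXY : IsShortPair X Y) {z y : E} (hz : z ∈ Submodule.map₂ (sop F) X Y) (hy : y ∈ Y) :
    sop F z y ∈ Y := by
  suffices h : Submodule.map₂ (sop F) X Y ≤ Y.comap ((sop F).flip y) from h hz
  exact Submodule.map₂_le.2 fun a ha b hb => hXY.act_right a ha b hb y hy

theorem zero_zero (hXY : IsShortPair X Y) {z w : E} (hz : z ∈ Submodule.map₂ (sop F) X Y)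
    (hw : w ∈ Submodule.map₂ (sop F) X Y) : sop F z w ∈ Submodule.map₂ (sop F) X Y := by
  suffices h : Submodule.map₂ (sop F) X Y ≤ (Submodule.map₂ (sop F) X Y).comap (sop F z) from h hw
  refine Submodule.map₂_le.2 fun a ha b hb => ?_
  rw [Submodule.mem_comap]
  refine LieSuper.op_mem_of_jacobi (hXY.graded_left.map₂ hXY.graded_right) hXY.graded_left ?_ ?_
    hXY.graded_right hz ha hb
  · intro z hz a ha b hb
    exact Submodule.apply_mem_map₂ _ (hXY.zero_left hz ha) hb
  · intro z hz a ha b hb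
    exact Submodule.apply_mem_map₂ _ ha (hXY.zero_right hz hb)

/-- The subsuperalgebra `X + [X, Y] + Y`. -/
def sub (hXY : IsShortPair X Y) : Subsuperalgebra F E where
  carrier := X ⊔ Submodule.map₂ (sop F) X Y ⊔ Y
  proj_mem i _ hx := ((hXY.graded_left.sup (hXY.graded_left.map₂ hXY.graded_right)).sup
    hXY.graded_right) i hx
  op_mem {x y} hx hy := by
    have gX := hXY.graded_left
    have gY := hXY.graded_right
    have gZ := gX.map₂ gY
    have iX : X ≤ X ⊔ Submodule.map₂ (sop F) X Y ⊔ Y := le_sup_left.trans le_sup_left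
    have iZ : Submodule.map₂ (sop F) X Y ≤ X ⊔ Submodule.map₂ (sop F) X Y ⊔ Y :=
      le_sup_right.trans le_sup_left
    have iY : Y ≤ X ⊔ Submodule.map₂ (sop F) X Y ⊔ Y := le_sup_right
    obtain ⟨u, hu, y₁, hy₁, rfl⟩ := Submodule.mem_sup.1 hx
    obtain ⟨x₁, hx₁, z₁, hz₁, rfl⟩ := Submodule.mem_sup.1 hu
    obtain ⟨u', hu', y₂, hy₂, rfl⟩ := Submodule.mem_sup.1 hy
    obtain ⟨x₂, hx₂, z₂, hz₂, rfl⟩ := Submodule.mem_sup.1 hu'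
    simp only [map_add, LinearMap.add_apply, hXY.left_left x₁ hx₁ x₂ hx₂,
      hXY.right_right y₁ hy₁ y₂ hy₂]
    refine Submodule.add_mem _ (Submodule.add_mem _ (Submodule.add_mem _ (Submodule.add_mem _
      (Submodule.zero_mem _) (iX (hXY.zero_left hz₁ hx₂))) ?_) (Submodule.add_mem _
      (Submodule.add_mem _ ?_ (iZ (hXY.zero_zero hz₁ hz₂))) ?_)) (Submodule.add_mem _
      (Submodule.add_mem _ (iZ (Submodule.apply_mem_map₂ _ hx₁ hy₂))
        (iY (hXY.zero_right hz₁ hy₂))) (Submodule.zero_mem _))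
    · exact iZ (LieSuper.op_mem_of_swap gY gX
        (fun b hb a ha => Submodule.apply_mem_map₂ _ hb ha) hy₁ hx₂)
    · exact iX (LieSuper.op_mem_of_swap gX gZ (fun b hb a ha => hXY.zero_left hb ha) hx₁ hz₂)
    · exact iY (LieSuper.op_mem_of_swap gY gZ (fun b hb a ha => hXY.zero_right hb ha) hy₁ hz₂)

theorem mem_sub (hXY : IsShortPair X Y) {w : E} : w ∈ hXY.sub.carrier ↔
    ∃ x ∈ X, ∃ z ∈ Submodule.map₂ (sop F) X Y, ∃ y ∈ Y, x + z + y = w := by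
  change w ∈ X ⊔ Submodule.map₂ (sop F) X Y ⊔ Y ↔ _
  constructor
  · intro h
    obtain ⟨u, hu, y, hy, rfl⟩ := Submodule.mem_sup.1 h
    obtain ⟨x, hx, z, hz, rfl⟩ := Submodule.mem_sup.1 hu
    exact ⟨x, hx, z, hz, y, hy, rfl⟩
  · rintro ⟨x, hx, z, hz, y, hy, rfl⟩
    exact Submodule.add_mem_sup (Submodule.add_mem_sup hx hz) hy

theorem left_le (hXY : IsShortPair X Y) : X ≤ hXY.sub.carrier := le_sup_left.trans le_sup_left

theorem right_le (hXY : IsShortPair X Y) : Y ≤ hXY.sub.carrier := le_sup_right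

theorem zero_le (hXY : IsShortPair X Y) : Submodule.map₂ (sop F) X Y ≤ hXY.sub.carrier := le_sup_right.trans le_sup_left

/-- The element h of [X, Y] acts invertibly on X and on Y, so both consist of brackets, as does the
middle part. -/
theorem sub_perfect (hXY : IsShortPair X Y) [CharZero F] {h : E} (hh : h ∈ Submodule.map₂ (sop F) X Y)
    (h2 : ∀ x ∈ X, sop F h x = (2 : F) • x) (h3 : ∀ y ∈ Y, sop F h y = (-2 : F) • y) :
    IsPerfectSuper F hXY.sub.carrier := by
  have hle : hXY.sub.carrier ≤
      (Submodule.map₂ (sop F (A := hXY.sub.carrier)) ⊤ ⊤).map hXY.sub.carrier.subtype := by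
    have hop : ∀ a ∈ hXY.sub.carrier, ∀ b ∈ hXY.sub.carrier, sop F a b ∈
        (Submodule.map₂ (sop F (A := hXY.sub.carrier)) ⊤ ⊤).map hXY.sub.carrier.subtype :=
      fun a ha b hb => ⟨sop F (⟨a, ha⟩ : hXY.sub.carrier) ⟨b, hb⟩,
        Submodule.apply_mem_map₂ _ Submodule.mem_top Submodule.mem_top, rfl⟩
    refine sup_le (sup_le (fun x hx => ?_) (Submodule.map₂_le.2 fun x hx y hy =>
      hop x (hXY.left_le hx) y (hXY.right_le hy))) (fun y hy => ?_)
    · have e := hop h (hXY.zero_le hh) x (hXY.left_le hx)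
      rw [h2 x hx] at e
      exact (Submodule.smul_mem_iff _ (by norm_num)).1 e
    · have e := hop h (hXY.zero_le hh) y (hXY.right_le hy)
      rw [h3 y hy] at e
      exact (Submodule.smul_mem_iff _ (by norm_num)).1 e
  refine Submodule.eq_top_iff'.2 fun w => ?_
  obtain ⟨w', hw', e⟩ := hle w.2
  rwa [← Subtype.ext e]

/-- If `X` and `Y` cover a perfect `L` modulo the kernel of a central extension, then
`L = X + [X, Y] + Y`. -/
theorem sub_eq_top (hXY : IsShortPair X Y) {M : Type*} [AddCommGroup M] [Module F M] [Superalgebra F M]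
    {ρ : SuperHom F E M} (hρ : IsCover ρ) (h : ∀ k : M, ∃ s ∈ hXY.sub.carrier, ρ s = k) :
    hXY.sub.carrier = ⊤ := by
  rw [eq_top_iff, ← hρ.perfect]
  refine Submodule.map₂_le.2 fun a _ b _ => ?_
  obtain ⟨s, hs, hsa⟩ := h (ρ a)
  obtain ⟨t, ht, htb⟩ := h (ρ b)
  rw [hρ.op_central hsa.symm htb.symm]
  exact hXY.sub.op_mem hs ht

end IsShortPair

end ShortSub

/-! ### Unital Jordan superalgebras -/

section Unital

variable {F J : Type*} [Field F] [AddCommGroup J] [Module F J] [Superalgebra F J]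
  [IsJordanSuperalgebra F J]

/-- For a unit o the commutator term drops out and ψ(a ⊗ o) is (L_a, -L_a). Evaluated at o it
recovers a, and for a = o it is half the grading element. -/
theorem tkkPsi_one_right {o : J} (ho : o ∈ sgr F 0) (hl : ∀ a, sop F o a = a)
    (hr : ∀ a, sop F a o = a) (a z : J) :
    (tkkPsi F J a o).1 z = sop F a z ∧ (tkkPsi F J a o).2 z = -sop F a z := by
  refine Superspace.homogeneous_induction (F := F) (p := fun a =>
    (tkkPsi F J a o).1 z = sop F a z ∧ (tkkPsi F J a o).2 z = -sop F a z)
    (fun i a ha => ?_) (fun a b ha hb => ?_) a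
  · rw [(tkkPsi_apply ha ho z z).1, (tkkPsi_apply ha ho z z).2]
    simp [hl, hr]
  · simp only [map_add, LinearMap.add_apply, Prod.fst_add, Prod.snd_add, ha.1, ha.2, hb.1, hb.2]
    exact ⟨trivial, by abel⟩

theorem tkkPsi_one_left {o : J} (ho : o ∈ sgr F 0) (hl : ∀ a, sop F o a = a)
    (a z : J) : (tkkPsi F J o a).1 z = sop F a z := by
  refine Superspace.homogeneous_induction (F := F) (p := fun a =>
    (tkkPsi F J o a).1 z = sop F a z) (fun i a ha => ?_) (fun a b ha hb => ?_) a
  · rw [(tkkPsi_apply ho ha z z).1]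
    simp [hl]
  · simp only [map_add, LinearMap.add_apply, Prod.fst_add, ha, hb]

/-- The centre of `TKK(J)` vanishes if `J` is unital. -/
theorem TKK.eq_zero_of_central {o : J} (ho : o ∈ sgr F 0) (hl : ∀ a, sop F o a = a)
    (hr : ∀ a, sop F a o = a) {X : TKK F J} (hX : ∀ Y, sop F X Y = 0) : X = 0 := by
  have h1 : ∀ Y, sop F (TKK.inPos F X.pos) Y + sop F (TKK.inZero X.zero) Y
      + sop F (TKK.inNeg F X.neg) Y = 0 := by
    intro Y
    rw [← LinearMap.add_apply, ← map_add, ← LinearMap.add_apply, ← map_add, TKK.decomp, hX]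
  have hp : X.pos = 0 := by
    have h := h1 (TKK.inNeg F o)
    rw [TKK.op_pos_neg, TKK.op_zero_neg, TKK.op_neg_neg] at h
    have h' : (tkkPsiZero F J X.pos o + 0 + 0) = (0 : tkkZero F J) := congrArg TKK.zero h
    rw [add_zero, add_zero] at h'
    have h2 := congrArg (fun S : tkkZero F J => S.1.1 o) h'
    change (tkkPsi F J X.pos o).1 o = 0 at h2
    rwa [(tkkPsi_one_right ho hl hr _ _).1, hr] at h2
  have hn : X.neg = 0 := by
    have h := h1 (TKK.inPos F o)
    have hs : sop F (TKK.inNeg F X.neg) (TKK.inPos F o) = - TKK.inZero (tkkPsiZero F J o X.neg) := by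
      rw [← TKK.op_pos_neg, LieSuper.skew_even (TKK.inPos_mem ho), _root_.neg_neg]
    rw [TKK.op_pos_pos, TKK.op_zero_pos, hs] at h
    have h' : (0 + 0 + -tkkPsiZero F J o X.neg) = (0 : tkkZero F J) := congrArg TKK.zero h
    rw [add_zero, _root_.zero_add, neg_eq_zero] at h'
    have h2 := congrArg (fun S : tkkZero F J => S.1.1 o) h'
    change (tkkPsi F J o X.neg).1 o = 0 at h2
    rwa [tkkPsi_one_left ho hl, hr] at h2
  have hz : X.zero = 0 := by
    rw [hp, hn, map_zero, map_zero] at h1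
    simp only [map_zero, LinearMap.zero_apply, _root_.zero_add, add_zero] at h1
    refine Subtype.ext (Prod.ext (LinearMap.ext fun z => ?_) (LinearMap.ext fun z => ?_))
    · have h := h1 (TKK.inPos F z)
      rw [TKK.op_zero_pos] at h
      exact congrArg TKK.pos h
    · have h := h1 (TKK.inNeg F z)
      rw [TKK.op_zero_neg] at h
      exact congrArg TKK.neg h
  exact TKK.ext hp hz hn

/-- A Lie superalgebra centrally isogenous to a centreless `M` covers `M`. -/
theorem CentrallyIsogenous.exists_cover {F : Type u} [Field F] {L M : Type v} [AddCommGroup L]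
    [Module F L] [Superalgebra F L] [AddCommGroup M] [Module F M] [Superalgebra F M]
    (h : CentrallyIsogenous F L M) (hM : ∀ X : M, (∀ Y, sop F X Y = 0) → X = 0) :
    ∃ ρ : SuperHom F L M, IsCover ρ := by
  obtain ⟨hL, hLp, -, -, U, _, _, _, π₁, π₂, h₁, h₂⟩ := h
  -- The kernel of π₁ is central in U, so π₂ maps it into the centre of M, which is zero; hence π₂
  -- factors through L.
  obtain ⟨ρ, hρ⟩ := SuperHom.exists_factor π₁ h₁.surjective π₂ (by
    intro u hu
    refine hM _ fun Y => ?_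
    obtain ⟨w, rfl⟩ := h₂.surjective Y
    rw [← π₂.map_op, h₁.central u hu, map_zero])
  refine ⟨ρ, ⟨hL, fun y => ?_, fun x hx y => ?_⟩, hLp⟩
  · obtain ⟨u, rfl⟩ := h₂.surjective y
    exact ⟨π₁ u, hρ u⟩
  · obtain ⟨u, rfl⟩ := h₁.surjective x
    obtain ⟨w, rfl⟩ := h₁.surjective y
    rw [hρ] at hx
    rw [← π₁.map_op, h₂.central u hx, map_zero]

/-! #### The Peirce decomposition -/

variable {u : J}

/-- The linearized Jordan identity at u, u, u, a gives 2L³ - 3L² + L = 0 for L = L_u, the polynomial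
with roots 1, 1/2 and 0. -/
theorem peirce_cubic (hu : u ∈ sgr F 0) (huu : sop F u u = u) (a : J) :
    (2 : F) • sop F u (sop F u (sop F u a)) = (3 : F) • sop F u (sop F u a) - sop F u a := by
  refine Superspace.homogeneous_induction (F := F) (p := fun a =>
    (2 : F) • sop F u (sop F u (sop F u a)) = (3 : F) • sop F u (sop F u a) - sop F u a)
    (fun i a ha => ?_) (fun a b ha hb => ?_) a
  · have m := @Superalgebra.op_mem F J _ _ _ _
    have c := @IsJordanSuperalgebra.comm F J _ _ _ _ _
    have h := IsJordanSuperalgebra.jordan hu hu hu ha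
    have hua : sop F u a ∈ sgr F i := by
      have := m hu ha
      rwa [_root_.zero_add] at this
    have huua : sop F u (sop F u a) ∈ sgr F i := by
      have := m hu hua
      rwa [_root_.zero_add] at this
    have c1 := c ha hu
    have c2 := c hua hu
    have c3 := c huua hu
    simp only [koszul_zero_right, one_smul] at c1 c2 c3
    simp only [sassoc, huu, c1, c2, c3, koszul_zero_left, koszul_zero_right, add_zero, one_smul,
      mul_one] at h
    linear_combination (norm := module) h
  · simp only [map_add, smul_add, ha, hb]
    module

variable (F) in
/-- The Peirce space of `u` for the eigenvalue `c`. -/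
def peirceSpace (u : J) (c : F) : Submodule F J := LinearMap.eqLocus (sop F u) (c • LinearMap.id)

theorem mem_peirceSpace {c : F} {a : J} : a ∈ peirceSpace F u c ↔ sop F u a = c • a := Iff.rfl

theorem peirceSpace_graded (hu : u ∈ sgr F 0) (c : F) : IsGradedSub (peirceSpace F u c) := by
  intro i x hx
  have hp := Superspace.proj_map (f := sop F u) (fun i x hx => by
    simpa using Superalgebra.op_mem (F := F) hu hx) i x
  rw [mem_peirceSpace, ← hp, mem_peirceSpace.1 hx, map_smul]

/-- The components come from the interpolation polynomials 2X² - X, 4(X - X²) and 1 - 3X + 2X² at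
the nodes 1, 1/2, 0. -/
theorem peirce_decomp [CharZero F] (hu : u ∈ sgr F 0) (huu : sop F u u = u) (a : J) :
    ∃ a₁ ∈ peirceSpace F u 1, ∃ a₂ ∈ peirceSpace F u 2⁻¹, ∃ a₀ ∈ peirceSpace F u 0, a₁ + a₂ + a₀ = a := by
  have h := peirce_cubic hu huu a
  refine ⟨(2 : F) • sop F u (sop F u a) - sop F u a, ?_,
    (4 : F) • (sop F u a - sop F u (sop F u a)), ?_,
    a - (3 : F) • sop F u a + (2 : F) • sop F u (sop F u a), ?_, by module⟩
  · rw [mem_peirceSpace, map_sub, map_smul, h]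
    module
  · rw [mem_peirceSpace, map_smul, map_sub]
    linear_combination (norm := module) (-2 : F) • h
  · rw [mem_peirceSpace, map_add, map_sub, map_smul, map_smul]
    linear_combination (norm := module) h

/-- From ux = x and ub = 0 the identity `lmul_comm_lmul` gives [L_u, L_v] = [L_x, L_b] with v = xb.
Evaluating at u yields u(uv) = uv - v, which is incompatible with the Peirce cubic unless v = 0;
then [L_x, L_b] = 0 as well, and both terms of ψ vanish. -/
theorem peirce_orthogonal [CharZero F] (hu : u ∈ sgr F 0) (huu : sop F u u = u) {i j : ZMod 2}
    {x b : J} (hx : x ∈ sgr F i) (hb : b ∈ sgr F j) (hx1 : x ∈ peirceSpace F u 1)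
    (hb0 : b ∈ peirceSpace F u 0) : tkkPsi F J x b = 0 ∧ tkkPsi F J b x = 0 := by
  have m := @Superalgebra.op_mem F J _ _ _ _
  have c := @IsJordanSuperalgebra.comm F J _ _ _ _ _
  rw [mem_peirceSpace, one_smul] at hx1
  rw [mem_peirceSpace, _root_.zero_smul] at hb0
  have h := lmul_comm_lmul hu hx hb
  rw [hx1, hb0, map_zero, map_zero, smul_zero, sub_zero] at h
  have hv := congrArg (fun T : Module.End F J => T u) h
  simp only [comm_lmul hu (m hx hb), comm_lmul hx hb] at hv
  have c1 := c hx hu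
  have c2 := c hb hu
  have c3 := c (m hx hb) hu
  have c4 := c hb hx
  simp only [koszul_zero_right, one_smul] at c1 c2 c3
  rw [c1, c2, hx1, hb0, map_zero, huu, koszul_zero_left, one_smul, zero_sub, c4, smul_smul,
    koszul_comm j i, koszul_mul_self, one_smul, c3] at hv
  have hc := peirce_cubic hu huu (sop F x b)
  generalize hvv : sop F x b = v at *
  have e1 : sop F u (sop F u v) = sop F u v - v := by linear_combination (norm := module) hv
  have e2 : sop F u v = (2⁻¹ : F) • v := by
    rw [e1, map_sub, e1] at hc
    linear_combination (norm := module) (-(2⁻¹ : F)) • hc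
  have hv0 : v = 0 := by
    rw [e2, map_smul, e2] at e1
    have : (3 / 4 : F) • v = 0 := by linear_combination (norm := module) e1
    exact (smul_eq_zero.1 this).resolve_left (by norm_num)
  subst hv0
  have hcomm : superComm F (sop F x : Module.End F J) (sop F b) = 0 := by
    rw [← h, map_zero, map_zero]
  constructor
  · simp only [tkkPsi, LinearMap.mk₂_apply, hvv, hcomm, map_zero, neg_zero, add_zero]
    rfl
  · rw [superComm_skew (lmul_mem hx) (lmul_mem hb), neg_eq_zero, smul_eq_zero] at hcomm
    have hk : koszul F i j ≠ 0 := left_ne_zero_of_mul (b := koszul F i j) (by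
      rw [koszul_mul_self]; exact one_ne_zero)
    simp only [tkkPsi, LinearMap.mk₂_apply, hcomm.resolve_left hk, c4, smul_zero, map_zero,
      neg_zero, add_zero]
    rfl

end Unital
end

noncomputable section
set_option linter.unusedSectionVars false

/-! ### Covers of `TKK(J)` -/

section TKKLift

variable {F : Type*} [Field F] {L : Type*} [AddCommGroup L] [Module F L] [Superalgebra F L]
  {J : Type*} [AddCommGroup J] [Module F J] [Superalgebra F J] [IsJordanSuperalgebra F J]

/-- Lifts of `J₁` and `J₋₁` along `ρ : L → TKK(J)` that satisfy the same triple relations. -/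
structure TKKLift (ρ : SuperHom F L (TKK F J)) where
  x : J →ₗ[F] L
  y : J →ₗ[F] L
  x_mem : ∀ (i : ZMod 2) (a : J), a ∈ sgr F i → x a ∈ sgr F i
  y_mem : ∀ (i : ZMod 2) (a : J), a ∈ sgr F i → y a ∈ sgr F i
  map_x : ∀ a, ρ (x a) = TKK.inPos F a
  map_y : ∀ a, ρ (y a) = TKK.inNeg F a
  xx : ∀ a b, sop F (x a) (x b) = 0
  yy : ∀ a b, sop F (y a) (y b) = 0
  xyx : ∀ a b c, sop F (sop F (x a) (y b)) (x c) = x ((tkkPsi F J a b).1 c)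
  xyy : ∀ a b c, sop F (sop F (x a) (y b)) (y c) = y ((tkkPsi F J a b).2 c)

theorem exists_tkkZero_two {o : J} (ho : o ∈ sgr F 0)
    (hl : ∀ a, sop F o a = a) (hr : ∀ a, sop F a o = a) : ∃ S : tkkZero F J, S ∈ sgr F 0 ∧
      (∀ a, S.1.1 a = (2 : F) • a) ∧ ∀ a, S.1.2 a = (-2 : F) • a := by
  have h0 : tkkPsiZero F J o o ∈ sgr F (0 + 0) := tkkPsiZero_mem ho ho
  rw [add_zero] at h0
  refine ⟨(2 : F) • tkkPsiZero F J o o, Submodule.smul_mem _ _ h0,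
    fun a => ?_, fun a => ?_⟩
  · change (2 : F) • (tkkPsi F J o o).1 a = _
    rw [(tkkPsi_one_right ho hl hr o a).1, hl]
  · change (2 : F) • (tkkPsi F J o o).2 a = _
    rw [(tkkPsi_one_right ho hl hr o a).2, hl]
    module

variable [CharZero F] [IsLieSuperalgebra F L]

/-- Let h lift the element of J₀ acting by 2 on J₁ and by -2 on J₋₁. Normalizing arbitrary lifts by
±(ad h)/2 produces eigenvectors of weight ±2. Each required relation compares elements of equal
nonzero weight (±4 or ±2) with the same image, so `eq_of_weight` applies. -/
theorem exists_tkkLift {ρ : SuperHom F L (TKK F J)} (hρ : IsCover ρ) {o : J} (ho : o ∈ sgr F 0)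
    (hl : ∀ a, sop F o a = a) (hr : ∀ a, sop F a o = a) : Nonempty (TKKLift ρ) := by
  obtain ⟨s, hs, hs0⟩ := exists_even_section ρ hρ.surjective
  obtain ⟨S, hS0, hS1, hS2⟩ := exists_tkkZero_two ho hl hr
  obtain ⟨h, hρh, h0⟩ : ∃ h : L, ρ h = TKK.inZero S ∧ h ∈ sgr F 0 :=
    ⟨s (TKK.inZero S), hs _, hs0 0 _ (TKK.inZero_mem hS0)⟩
  have hkp : ∀ a, sop F (TKK.inZero S) (TKK.inPos F a) = (2 : F) • TKK.inPos F a := fun a => by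
    rw [TKK.op_zero_pos, hS1, map_smul]
  have hkn : ∀ a, sop F (TKK.inZero S) (TKK.inNeg F a) = (-2 : F) • TKK.inNeg F a := fun a => by
    rw [TKK.op_zero_neg, hS2, map_smul]
  let x : J →ₗ[F] L := (2⁻¹ : F) • (sop F h ∘ₗ s ∘ₗ TKK.inPos F)
  let y : J →ₗ[F] L := (-2⁻¹ : F) • (sop F h ∘ₗ s ∘ₗ TKK.inNeg F)
  have xdef : ∀ a, x a = (2⁻¹ : F) • sop F h (s (TKK.inPos F a)) := fun a => rfl
  have ydef : ∀ a, y a = (-2⁻¹ : F) • sop F h (s (TKK.inNeg F a)) := fun a => rfl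
  have map_x : ∀ a, ρ (x a) = TKK.inPos F a := fun a => by
    rw [xdef, map_smul, ρ.map_op, hρh, hs, hkp, smul_smul, inv_mul_cancel₀ two_ne_zero, one_smul]
  have map_y : ∀ a, ρ (y a) = TKK.inNeg F a := fun a => by
    rw [ydef, map_smul, ρ.map_op, hρh, hs, hkn, smul_smul, neg_mul_neg,
      inv_mul_cancel₀ two_ne_zero, one_smul]
  have xw : ∀ a, x a ∈ adWeight F h 2 := fun a => by
    rw [mem_adWeight, hρ.op_central (x' := h) (y' := s (TKK.inPos F a)) rfl
      (by rw [map_x, hs]), xdef, smul_smul, mul_inv_cancel₀ two_ne_zero, one_smul]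
  have yw : ∀ a, y a ∈ adWeight F h (-2) := fun a => by
    rw [mem_adWeight, hρ.op_central (x' := h) (y' := s (TKK.inNeg F a)) rfl
      (by rw [map_y, hs]), ydef, smul_smul, neg_mul_neg, mul_inv_cancel₀ two_ne_zero, one_smul]
  have xyw : ∀ a b, sop F (x a) (y b) ∈ adWeight F h 0 := fun a b => by
    have := adWeight_op h0 (xw a) (yw b)
    rwa [add_neg_cancel] at this
  have x_mem : ∀ (i : ZMod 2) (a : J), a ∈ sgr F i → x a ∈ sgr F i := fun i a ha => by
    have := Superalgebra.op_mem (F := F) h0 (hs0 i _ (TKK.inPos_mem ha))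
    rw [_root_.zero_add] at this
    exact Submodule.smul_mem (sgr F i) _ this
  have y_mem : ∀ (i : ZMod 2) (a : J), a ∈ sgr F i → y a ∈ sgr F i := fun i a ha => by
    have := Superalgebra.op_mem (F := F) h0 (hs0 i _ (TKK.inNeg_mem ha))
    rw [_root_.zero_add] at this
    exact Submodule.smul_mem (sgr F i) _ this
  refine ⟨⟨x, y, x_mem, y_mem, map_x, map_y, fun a b => ?_, fun a b => ?_, fun a b c => ?_,
    fun a b c => ?_⟩⟩
  · refine hρ.eq_of_weight (c := 2 + 2) (by norm_num) (adWeight_op h0 (xw a) (xw b)) (by simp) ?_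
    rw [ρ.map_op, map_x, map_x, TKK.op_pos_pos, map_zero]
  · refine hρ.eq_of_weight (c := -2 + -2) (by norm_num) (adWeight_op h0 (yw a) (yw b)) (by simp) ?_
    rw [ρ.map_op, map_y, map_y, TKK.op_neg_neg, map_zero]
  · refine hρ.eq_of_weight (c := 0 + 2) (by norm_num) (adWeight_op h0 (xyw a b) (xw c))
      (by rw [_root_.zero_add]; exact xw _) ?_
    rw [ρ.map_op, ρ.map_op, map_x, map_x, map_x, map_y, TKK.op_pos_neg, TKK.op_zero_pos]
    rfl
  · refine hρ.eq_of_weight (c := 0 + -2) (by norm_num) (adWeight_op h0 (xyw a b) (yw c))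
      (by rw [_root_.zero_add]; exact yw _) ?_
    rw [ρ.map_op, ρ.map_op, map_x, map_y, map_y, map_y, TKK.op_pos_neg, TKK.op_zero_neg]
    rfl

namespace TKKLift

variable {ρ : SuperHom F L (TKK F J)} (Λ : TKKLift ρ)

theorem x_injective : Function.Injective Λ.x := fun a b h => by
  have := congrArg ρ h
  rw [Λ.map_x, Λ.map_x] at this
  exact congrArg TKK.pos this

theorem isShortPair : IsShortPair (LinearMap.range Λ.x) (LinearMap.range Λ.y) where
  graded_left := IsGradedSub.range Λ.x_mem
  graded_right := IsGradedSub.range Λ.y_mem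
  left_left := by
    rintro _ ⟨a, rfl⟩ _ ⟨b, rfl⟩
    exact Λ.xx a b
  right_right := by
    rintro _ ⟨a, rfl⟩ _ ⟨b, rfl⟩
    exact Λ.yy a b
  act_left := by
    rintro _ ⟨a, rfl⟩ _ ⟨b, rfl⟩ _ ⟨c, rfl⟩
    exact ⟨_, (Λ.xyx a b c).symm⟩
  act_right := by
    rintro _ ⟨a, rfl⟩ _ ⟨b, rfl⟩ _ ⟨c, rfl⟩
    exact ⟨_, (Λ.xyy a b c).symm⟩

/-- TKK(J) is J₁ + [J₁, J₋₁] + J₋₁, so the lifted short pair meets every fibre of ρ, and perfectness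
of L does the rest. -/
theorem sub_eq_top (hρ : IsCover ρ) : Λ.isShortPair.sub.carrier = ⊤ := by
  refine Λ.isShortPair.sub_eq_top hρ fun k => ?_
  suffices h : (⊤ : Submodule F (TKK F J)) ≤ Λ.isShortPair.sub.carrier.map ρ.toLinearMap from
    h Submodule.mem_top
  intro k _
  rw [← TKK.decomp k]
  refine Submodule.add_mem _ (Submodule.add_mem _ ?_ ?_) ?_
  · exact ⟨_, Λ.isShortPair.left_le ⟨k.pos, rfl⟩, Λ.map_x _⟩
  · have hle : tkkZero F J ≤ ((Λ.isShortPair.sub.carrier.map ρ.toLinearMap).comap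
        TKK.inZero).map (tkkZero F J).subtype := by
      refine Submodule.map₂_le.2 fun a _ b _ => ?_
      refine ⟨tkkPsiZero F J a b, ⟨sop F (Λ.x a) (Λ.y b), Λ.isShortPair.zero_le
        (Submodule.apply_mem_map₂ _ ⟨a, rfl⟩ ⟨b, rfl⟩), ?_⟩, rfl⟩
      rw [ρ.map_op, Λ.map_x, Λ.map_y, TKK.op_pos_neg]
    obtain ⟨S, hS, e⟩ := hle k.zero.2
    rwa [← Subtype.ext e]
  · exact ⟨_, Λ.isShortPair.right_le ⟨k.neg, rfl⟩, Λ.map_y _⟩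

/-- The lift of `(2L_u, -2L_u)`. -/
def h (u : J) : L := (2 : F) • sop F (Λ.x u) (Λ.y u)

theorem h_even {u : J} (hu : u ∈ sgr F 0) : Λ.h u ∈ sgr F 0 :=
  Submodule.smul_mem _ _ (Superalgebra.op_mem (F := F) (Λ.x_mem 0 u hu) (Λ.y_mem 0 u hu))

/-- For an even idempotent the commutator [L_u, L_u] vanishes and ψ(u ⊗ u) reduces to (L_u, -L_u).
Peirce spaces thus become weight spaces with doubled eigenvalues. -/
theorem h_x {u : J} (hu : u ∈ sgr F 0) (huu : sop F u u = u) (a : J) :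
    sop F (Λ.h u) (Λ.x a) = (2 : F) • Λ.x (sop F u a) := by
  rw [h, map_smul, LinearMap.smul_apply, Λ.xyx, (tkkPsi_apply hu hu a a).1, huu]
  simp

theorem h_y {u : J} (hu : u ∈ sgr F 0) (huu : sop F u u = u) (a : J) :
    sop F (Λ.h u) (Λ.y a) = (-2 : F) • Λ.y (sop F u a) := by
  rw [h, map_smul, LinearMap.smul_apply, Λ.xyy, (tkkPsi_apply hu hu a a).2, huu]
  simp

theorem x_weight {u : J} (hu : u ∈ sgr F 0) (huu : sop F u u = u) {a : J} {c : F}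
    (ha : a ∈ peirceSpace F u c) : Λ.x a ∈ adWeight F (Λ.h u) (2 * c) := by
  rw [mem_adWeight, Λ.h_x hu huu, mem_peirceSpace.1 ha, map_smul, smul_smul]

theorem y_weight {u : J} (hu : u ∈ sgr F 0) (huu : sop F u u = u) {a : J} {c : F}
    (ha : a ∈ peirceSpace F u c) : Λ.y a ∈ adWeight F (Λ.h u) (-2 * c) := by
  rw [mem_adWeight, Λ.h_y hu huu, mem_peirceSpace.1 ha, map_smul, smul_smul]

/-- The image ψ(a ⊗ b) is zero by Peirce orthogonality, and the bracket has weight 2 or -2 for the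
lift of u; a nonzero weight with zero image forces zero. -/
theorem op_xy_eq_zero (hρ : IsCover ρ) {u : J} (hu : u ∈ sgr F 0) (huu : sop F u u = u) {a b : J}
    (hab : a ∈ peirceSpace F u 1 ∧ b ∈ peirceSpace F u 0 ∨
      a ∈ peirceSpace F u 0 ∧ b ∈ peirceSpace F u 1) : sop F (Λ.x a) (Λ.y b) = 0 := by
  have hψ : tkkPsi F J a b = 0 := by
    have hg := fun c => peirceSpace_graded (F := F) hu c
    rw [← Superspace.proj_add F a, ← Superspace.proj_add F b]
    simp only [map_add, LinearMap.add_apply]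
    have key : ∀ i j, tkkPsi F J (Superspace.proj F i a) (Superspace.proj F j b) = 0 := by
      intro i j
      rcases hab with ⟨ha, hb⟩ | ⟨ha, hb⟩
      · exact (peirce_orthogonal hu huu (Superspace.proj_mem F i a) (Superspace.proj_mem F j b)
          (hg 1 i ha) (hg 0 j hb)).1
      · exact (peirce_orthogonal hu huu (Superspace.proj_mem F j b) (Superspace.proj_mem F i a)
          (hg 1 j hb) (hg 0 i ha)).2
    simp [key]
  have hρ0 : ρ (sop F (Λ.x a) (Λ.y b)) = ρ 0 := by
    rw [ρ.map_op, Λ.map_x, Λ.map_y, TKK.op_pos_neg, map_zero]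
    exact congrArg TKK.inZero (Subtype.ext hψ) |>.trans (map_zero _)
  have h0 := Λ.h_even hu
  rcases hab with ⟨ha, hb⟩ | ⟨ha, hb⟩
  · refine hρ.eq_of_weight (c := 2 * 1 + -2 * 0) (by norm_num)
      (adWeight_op h0 (Λ.x_weight hu huu ha) (Λ.y_weight hu huu hb)) (by simp) hρ0
  · refine hρ.eq_of_weight (c := 2 * 0 + -2 * 1) (by norm_num)
      (adWeight_op h0 (Λ.x_weight hu huu ha) (Λ.y_weight hu huu hb)) (by simp) hρ0

end TKKLift

end TKKLift
end

noncomputable section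
set_option linter.unusedSectionVars false

/-! ### The root grading of a cover of `TKK(J)` -/

section Independent

variable {F : Type*} [Field F] [CharZero F] {L : Type*} [AddCommGroup L] [Module F L]
  [Superalgebra F L]

/-- The functional `α ↦ α(h₁) + 5 α(h₂)` separates the roots. -/
theorem wt_injective {r s r' s' : Fin 2 ⊕ Fin 2}
    (h : wt₁ F r - wt₁ F s + 5 * (wt₂ F r - wt₂ F s) =
      wt₁ F r' - wt₁ F s' + 5 * (wt₂ F r' - wt₂ F s')) :
    wt₁ F r - wt₁ F s = wt₁ F r' - wt₁ F s' ∧ wt₂ F r - wt₂ F s = wt₂ F r' - wt₂ F s' := by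
  -- Both weights lie between -2 and 2, so they are the balanced base 5 digits of the sum. The
  -- finite check is made over ℤ and transferred by characteristic zero.
  let v₁ : Fin 2 ⊕ Fin 2 → ℤ := Sum.elim ![1, -1] 0
  let v₂ : Fin 2 ⊕ Fin 2 → ℤ := Sum.elim 0 ![1, -1]
  have e₁ : ∀ r, wt₁ F r = (v₁ r : ℤ) := by
    rintro (r | r) <;> fin_cases r <;> simp [wt₁, v₁]
  have e₂ : ∀ r, wt₂ F r = (v₂ r : ℤ) := by
    rintro (r | r) <;> fin_cases r <;> simp [wt₂, v₂]
  simp only [e₁, e₂] at h ⊢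
  have h' : v₁ r - v₁ s + 5 * (v₂ r - v₂ s) = v₁ r' - v₁ s' + 5 * (v₂ r' - v₂ s') := by
    exact_mod_cast h
  have key : v₁ r - v₁ s = v₁ r' - v₁ s' ∧ v₂ r - v₂ s = v₂ r' - v₂ s' := by
    clear h e₁ e₂
    revert r s r' s'
    decide
  exact ⟨by exact_mod_cast key.1, by exact_mod_cast key.2⟩

theorem exists_rootOf_eq_of_mem_insert {α : Module.Dual F (pslCartan F 2)}
    (hα : α ∈ insert 0 (rootsA11 F)) : ∃ r s, α = rootOf r s := by
  rcases hα with rfl | hα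
  · exact ⟨.inl 0, .inl 0, (rootOf_self _).symm⟩
  · obtain ⟨r, s, -, rfl⟩ := exists_rootOf_eq hα
    exact ⟨r, s, rfl⟩

/-- All weight spaces lie in eigenspaces of the single operator ad(h₁ + 5h₂), and distinct weights
give distinct eigenvalues. -/
theorem weightSpaceA11_indep {G : Subsuperalgebra F L}
    {π : SuperHom F G.carrier (PSLSuper F 2)} {B : Submodule F G.carrier} (hB : IsEvenLift π B)
    {h₁ h₂ : G.carrier} (hh₁ : h₁ ∈ B) (hh₂ : h₂ ∈ B) (hπ₁ : π h₁ = pslH₁ F)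
    (hπ₂ : π h₂ = pslH₂ F) :
    iSupIndep (fun α : ↥(insert 0 (rootsA11 F)) => weightSpaceA11 π B α.1) := by
  let D : Module.End F L := sop F (h₁.1 + (5 : F) • h₂.1)
  let ev : ↥(insert 0 (rootsA11 F)) → F := fun α =>
    α.1 ⟨pslH₁ F, pslH₁_mem⟩ + 5 * α.1 ⟨pslH₂ F, pslH₂_mem⟩
  have hev : Function.Injective ev := by
    rintro ⟨α, hα⟩ ⟨β, hβ⟩ h
    obtain ⟨r, s, rfl⟩ := exists_rootOf_eq_of_mem_insert hα
    obtain ⟨r', s', rfl⟩ := exists_rootOf_eq_of_mem_insert hβ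
    simp only [ev, rootOf_H₁, rootOf_H₂] at h
    obtain ⟨e1, e2⟩ := wt_injective h
    exact Subtype.ext (dual_ext (by rw [rootOf_H₁, rootOf_H₁, e1])
      (by rw [rootOf_H₂, rootOf_H₂, e2]))
  refine (D.eigenspaces_iSupIndep.comp hev).mono fun α x hx => ?_
  rw [mem_weightSpaceA11 hB hh₁ hh₂ hπ₁ hπ₂] at hx
  rw [Function.comp_apply, Module.End.mem_eigenspace_iff]
  simp only [D, ev, map_add, map_smul, LinearMap.add_apply, LinearMap.smul_apply,
    mem_adWeight.1 hx.1, mem_adWeight.1 hx.2, smul_smul, add_smul]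

/-- It suffices for a root grading that the root spaces and their products span. -/
theorem isA11Graded_of_span [IsLieSuperalgebra F L] {G : Subsuperalgebra F L}
    {π : SuperHom F G.carrier (PSLSuper F 2)} {B : Submodule F G.carrier} (hπ : IsCover π)
    (hB : IsEvenLift π B) {h₁ h₂ : G.carrier} (hh₁ : h₁ ∈ B) (hh₂ : h₂ ∈ B)
    (hπ₁ : π h₁ = pslH₁ F) (hπ₂ : π h₂ = pslH₂ F)
    (hspan : ∀ Q : Submodule F L, (∀ r s, r ≠ s → rootW h₁.1 h₂.1 r s ≤ Q) →
      (∀ r s, r ≠ s → Submodule.map₂ (sop F) (rootW h₁.1 h₂.1 r s) (rootW h₁.1 h₂.1 s r) ≤ Q) →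
        Q = ⊤) : IsA11Graded F L := by
  have hW := weightSpaceA11_rootOf hB hh₁ hh₂ hπ₁ hπ₂
  have hind := weightSpaceA11_indep hB hh₁ hh₂ hπ₁ hπ₂
  set Q₀ : Submodule F L := ⨆ α ∈ rootsA11 F,
    Submodule.map₂ (sop F) (weightSpaceA11 π B α) (weightSpaceA11 π B (-α)) with hQ₀
  set V : Submodule F L := ⨆ α ∈ rootsA11 F, weightSpaceA11 π B α with hV
  have htop : V ⊔ Q₀ = ⊤ := by
    refine hspan _ (fun r s hrs => ?_) (fun r s hrs => ?_)
    · rw [← hW]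
      exact (le_iSup₂_of_le (f := fun α (_ : α ∈ rootsA11 F) => weightSpaceA11 π B α)
        (rootOf r s) (rootOf_mem hrs) le_rfl).trans le_sup_left
    · rw [← hW, ← hW, ← rootOf_neg r s]
      exact (le_iSup₂_of_le (f := fun α (_ : α ∈ rootsA11 F) => Submodule.map₂ (sop F)
        (weightSpaceA11 π B α) (weightSpaceA11 π B (-α))) (rootOf r s) (rootOf_mem hrs)
        le_rfl).trans le_sup_right
  have hQ₀le : Q₀ ≤ weightSpaceA11 π B 0 := by
    refine iSup₂_le fun α hα => Submodule.map₂_le.2 fun a ha b hb => ?_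
    rw [mem_weightSpaceA11 hB hh₁ hh₂ hπ₁ hπ₂] at ha hb ⊢
    have h1 := adWeight_op (show h₁.1 ∈ sgr F 0 from hB.le_even hh₁) ha.1 hb.1
    have h2 := adWeight_op (show h₂.1 ∈ sgr F 0 from hB.le_even hh₂) ha.2 hb.2
    rw [LinearMap.neg_apply, add_neg_cancel] at h1 h2
    exact ⟨h1, h2⟩
  refine ⟨inferInstance, G, π, B, hπ, hB, hind, ?_, ?_⟩
  · rw [eq_top_iff, ← htop]
    refine sup_le (iSup₂_le fun α hα => ?_) (hQ₀le.trans ?_)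
    · exact le_iSup (fun α : ↥(insert 0 (rootsA11 F)) => weightSpaceA11 π B α.1)
        ⟨α, Set.mem_insert_of_mem _ hα⟩
    · exact le_iSup (fun α : ↥(insert 0 (rootsA11 F)) => weightSpaceA11 π B α.1)
        ⟨0, Set.mem_insert _ _⟩
  -- Write a weight 0 element as w + q with w in the sum of the root spaces and q in the sum of the
  -- products; then w has weight 0 too, and independence kills it.
  · refine le_antisymm (fun x hx => ?_) hQ₀le
    obtain ⟨w, hw, q, hq, rfl⟩ := Submodule.mem_sup.1 (htop ▸ Submodule.mem_top : x ∈ V ⊔ Q₀)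
    have hw0 : w ∈ weightSpaceA11 π B 0 := by
      have := Submodule.sub_mem _ hx (hQ₀le hq)
      rwa [add_sub_cancel_right] at this
    have hdis := hind ⟨0, Set.mem_insert _ _⟩
    have hVle : V ≤ ⨆ j : ↥(insert 0 (rootsA11 F)), ⨆ (_ : j ≠ ⟨0, Set.mem_insert _ _⟩),
        weightSpaceA11 π B j.1 := by
      refine iSup₂_le fun α hα => ?_
      exact le_iSup₂_of_le (f := fun (j : ↥(insert 0 (rootsA11 F)))
        (_ : j ≠ ⟨0, Set.mem_insert _ _⟩) => weightSpaceA11 π B j.1)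
        ⟨α, Set.mem_insert_of_mem _ hα⟩ (fun h => hα.1 (congrArg Subtype.val h)) le_rfl
    have hw00 : w = 0 := Submodule.disjoint_def.1 hdis w hw0 (hVle hw)
    rwa [hw00, _root_.zero_add]

end Independent

section Span

variable {F : Type*} [Field F] [CharZero F] {L : Type*} [AddCommGroup L] [Module F L]
  [Superalgebra F L] [IsLieSuperalgebra F L]
  {J : Type*} [AddCommGroup J] [Module F J] [Superalgebra F J] [IsJordanSuperalgebra F J]
  {ρ : SuperHom F L (TKK F J)}

/-- The Peirce decomposition for complementary idempotents `u₁, u₂` induces a root grading. -/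
theorem TKKLift.rootW_span (Λ : TKKLift ρ) (hρ : IsCover ρ) {u₁ u₂ : J} (hu₁ : u₁ ∈ sgr F 0)
    (hu₂ : u₂ ∈ sgr F 0) (huu₁ : sop F u₁ u₁ = u₁) (huu₂ : sop F u₂ u₂ = u₂)
    (hsum : ∀ a, sop F u₁ a + sop F u₂ a = a) (Q : Submodule F L)
    (hQ : ∀ r s, r ≠ s → rootW (Λ.h u₁) (Λ.h u₂) r s ≤ Q)
    (hQ' : ∀ r s, r ≠ s → Submodule.map₂ (sop F) (rootW (Λ.h u₁) (Λ.h u₂) r s)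
      (rootW (Λ.h u₁) (Λ.h u₂) s r) ≤ Q) : Q = ⊤ := by
  have h₁0 := Λ.h_even hu₁
  have h₂0 := Λ.h_even hu₂
  -- The idempotents are complementary, so L_{u₂} = 1 - L_{u₁} and one Peirce decomposition
  -- diagonalizes both.
  have hp : ∀ {c : F} {a : J}, a ∈ peirceSpace F u₁ c → a ∈ peirceSpace F u₂ (1 - c) := by
    intro c a ha
    rw [mem_peirceSpace, eq_sub_of_add_eq' (hsum a), mem_peirceSpace.1 ha]
    module
  have hx : ∀ {c : F} {a : J}, a ∈ peirceSpace F u₁ c → Λ.x a ∈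
      adWeight F (Λ.h u₁) (2 * c) ⊓ adWeight F (Λ.h u₂) (2 * (1 - c)) := fun ha =>
    ⟨Λ.x_weight hu₁ huu₁ ha, Λ.x_weight hu₂ huu₂ (hp ha)⟩
  have hy : ∀ {c : F} {a : J}, a ∈ peirceSpace F u₁ c → Λ.y a ∈
      adWeight F (Λ.h u₁) (-2 * c) ⊓ adWeight F (Λ.h u₂) (-2 * (1 - c)) := fun ha =>
    ⟨Λ.y_weight hu₁ huu₁ ha, Λ.y_weight hu₂ huu₂ (hp ha)⟩
  have hxy : ∀ {c d : F} {a b : J}, a ∈ peirceSpace F u₁ c → b ∈ peirceSpace F u₁ d →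
      sop F (Λ.x a) (Λ.y b) ∈ adWeight F (Λ.h u₁) (2 * c + -2 * d) ⊓
        adWeight F (Λ.h u₂) (2 * (1 - c) + -2 * (1 - d)) := fun ha hb =>
    ⟨adWeight_op h₁0 (hx ha).1 (hy hb).1, adWeight_op h₂0 (hx ha).2 (hy hb).2⟩
  have conv : ∀ {c d : F} {z : L} (r s : Fin 2 ⊕ Fin 2), z ∈ adWeight F (Λ.h u₁) c ⊓
      adWeight F (Λ.h u₂) d → wt₁ F r - wt₁ F s = c → wt₂ F r - wt₂ F s = d →
      z ∈ rootW (F := F) (Λ.h u₁) (Λ.h u₂) r s := by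
    rintro c d z r s hz rfl rfl
    exact hz
  have e2 : (-1 - 1 : F) = -2 := by norm_num
  have e3 : (1 + 1 : F) = 2 := by norm_num
  have e4 : (2 : F) * (1 - 2⁻¹) = 1 := by norm_num
  have e5 : (2 : F) * 2⁻¹ = 1 := by norm_num
  -- Peirce eigenvalues 1, 1/2, 0 correspond to joint weights (2, 0), (1, 1), (0, 2) on the lift of
  -- J₁ and to their negatives on that of J₋₁.
  have x1 : ∀ {a}, a ∈ peirceSpace F u₁ 1 → Λ.x a ∈ rootW (F := F) (Λ.h u₁) (Λ.h u₂) (.inl 0) (.inl 1) :=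
    fun ha => conv _ _ (hx ha) (by simp [wt₁, e3]) (by simp [wt₂])
  have x2 : ∀ {a}, a ∈ peirceSpace F u₁ 2⁻¹ → Λ.x a ∈ rootW (F := F) (Λ.h u₁) (Λ.h u₂) (.inl 0) (.inr 1) :=
    fun ha => conv _ _ (hx ha) (by simp [wt₁]) (by simp [wt₂, e4])
  have x0 : ∀ {a}, a ∈ peirceSpace F u₁ 0 → Λ.x a ∈ rootW (F := F) (Λ.h u₁) (Λ.h u₂) (.inr 0) (.inr 1) :=
    fun ha => conv _ _ (hx ha) (by simp [wt₁]) (by simp [wt₂, e3])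
  have y1 : ∀ {a}, a ∈ peirceSpace F u₁ 1 → Λ.y a ∈ rootW (F := F) (Λ.h u₁) (Λ.h u₂) (.inl 1) (.inl 0) :=
    fun ha => conv _ _ (hy ha) (by simp [wt₁, e2]) (by simp [wt₂])
  have y2 : ∀ {a}, a ∈ peirceSpace F u₁ 2⁻¹ → Λ.y a ∈ rootW (F := F) (Λ.h u₁) (Λ.h u₂) (.inr 1) (.inl 0) :=
    fun ha => conv _ _ (hy ha) (by simp [wt₁]) (by simp [wt₂, e4])
  have y0 : ∀ {a}, a ∈ peirceSpace F u₁ 0 → Λ.y a ∈ rootW (F := F) (Λ.h u₁) (Λ.h u₂) (.inr 1) (.inr 0) :=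
    fun ha => conv _ _ (hy ha) (by simp [wt₁]) (by simp [wt₂, e2])
  have n1 : (1 : F) - 2⁻¹ = 2⁻¹ := by norm_num
  rw [eq_top_iff, ← Λ.sub_eq_top hρ]
  refine sup_le (sup_le ?_ ?_) ?_
  · rintro _ ⟨a, rfl⟩
    obtain ⟨a₁, ha₁, a₂, ha₂, a₀, ha₀, rfl⟩ := peirce_decomp hu₁ huu₁ a
    rw [map_add, map_add]
    exact Submodule.add_mem _ (Submodule.add_mem _ (hQ _ _ (by decide) (x1 ha₁))
      (hQ _ _ (by decide) (x2 ha₂))) (hQ _ _ (by decide) (x0 ha₀))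
  · refine Submodule.map₂_le.2 ?_
    rintro _ ⟨a, rfl⟩ _ ⟨b, rfl⟩
    obtain ⟨a₁, ha₁, a₂, ha₂, a₀, ha₀, rfl⟩ := peirce_decomp hu₁ huu₁ a
    obtain ⟨b₁, hb₁, b₂, hb₂, b₀, hb₀, rfl⟩ := peirce_decomp hu₁ huu₁ b
    -- Of the nine products of Peirce components, three have weight zero and are products of
    -- opposite root spaces, four have the odd weights ±(1, -1), and the remaining two, of weights
    -- ±(2, -2), vanish.
    have p11 := hQ' _ _ (by decide) (Submodule.apply_mem_map₂ _ (x1 ha₁) (y1 hb₁))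
    have p22 := hQ' _ _ (by decide) (Submodule.apply_mem_map₂ _ (x2 ha₂) (y2 hb₂))
    have p00 := hQ' _ _ (by decide) (Submodule.apply_mem_map₂ _ (x0 ha₀) (y0 hb₀))
    have p12 := hQ (.inl 0) (.inr 0) (by decide) (conv _ _ (hxy ha₁ hb₂)
      (by simp [wt₁]; norm_num) (by simp [wt₂, n1]))
    have p20 := hQ (.inl 0) (.inr 0) (by decide) (conv _ _ (hxy ha₂ hb₀)
      (by simp [wt₁]) (by simp [wt₂, e4]; norm_num))
    have p21 := hQ (.inr 0) (.inl 0) (by decide) (conv _ _ (hxy ha₂ hb₁)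
      (by simp [wt₁]; norm_num) (by simp [wt₂, e4]))
    have p02 := hQ (.inr 0) (.inl 0) (by decide) (conv _ _ (hxy ha₀ hb₂)
      (by simp [wt₁]) (by simp [wt₂, e4]; norm_num))
    have p10 := Λ.op_xy_eq_zero hρ hu₁ huu₁ (Or.inl ⟨ha₁, hb₀⟩)
    have p01 := Λ.op_xy_eq_zero hρ hu₁ huu₁ (Or.inr ⟨ha₀, hb₁⟩)
    simp only [map_add, LinearMap.add_apply, p10, p01]
    exact Submodule.add_mem _ (Submodule.add_mem _ (Submodule.add_mem _ (Submodule.add_mem _ p11 p21)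
      (Submodule.zero_mem _)) (Submodule.add_mem _ (Submodule.add_mem _ p12 p22) p02))
      (Submodule.add_mem _ (Submodule.add_mem _ (Submodule.zero_mem _) p20) p00)
  · rintro _ ⟨a, rfl⟩
    obtain ⟨a₁, ha₁, a₂, ha₂, a₀, ha₀, rfl⟩ := peirce_decomp hu₁ huu₁ a
    rw [map_add, map_add]
    exact Submodule.add_mem _ (Submodule.add_mem _ (hQ _ _ (by decide) (y1 ha₁))
      (hQ _ _ (by decide) (y2 ha₂))) (hQ _ _ (by decide) (y0 ha₀))

end Span
end

noncomputable section
set_option linter.unusedSectionVars false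

/-! ### Lifting the even part of `psl(2, 2)` to a cover -/

section SL2

variable {F : Type*} [Field F] {E : Type*} [AddCommGroup E] [Module F E] [Superalgebra F E]
  [IsLieSuperalgebra F E]

theorem LieSuper.op_self_even [CharZero F] {x : E} (hx : x ∈ sgr F 0) : sop F x x = 0 := by
  have h := LieSuper.skew_even hx x
  have h2 : (2 : F) • sop F x x = 0 := by
    linear_combination (norm := module) h
  exact (smul_eq_zero.1 h2).resolve_left two_ne_zero

/-- The span of an even `sl₂`-triple is closed under the bracket and perfect. -/
theorem sl2_span [CharZero F] {e h f : E} (e0 : e ∈ sgr F 0) (h0 : h ∈ sgr F 0)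
    (f0 : f ∈ sgr F 0) (he : sop F h e = (2 : F) • e) (hf : sop F h f = (-2 : F) • f)
    (ef : sop F e f = h) :
    Submodule.map₂ (sop F) (Submodule.span F {e, h, f}) (Submodule.span F {e, h, f}) =
      Submodule.span F {e, h, f} := by
  have me : e ∈ Submodule.span F {e, h, f} := Submodule.subset_span (by simp)
  have mh : h ∈ Submodule.span F {e, h, f} := Submodule.subset_span (by simp)
  have mf : f ∈ Submodule.span F {e, h, f} := Submodule.subset_span (by simp)
  refine le_antisymm ?_ (Submodule.span_le.2 ?_)
  · rw [Submodule.map₂_span_span, Submodule.span_le]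
    rintro _ ⟨x, hx, y, hy, rfl⟩
    change sop F x y ∈ Submodule.span F {e, h, f}
    have eh : sop F e h = (-2 : F) • e := by
      rw [LieSuper.skew_even e0, he]
      module
    have fh : sop F f h = (2 : F) • f := by
      rw [LieSuper.skew_even f0, hf]
      module
    have fe : sop F f e = -h := by rw [LieSuper.skew_even f0, ef]
    rcases hx with rfl | rfl | rfl <;> rcases hy with rfl | rfl | rfl
    · simp [LieSuper.op_self_even e0]
    · rw [eh]
      exact Submodule.smul_mem _ _ me
    · rw [ef]
      exact mh
    · rw [he]
      exact Submodule.smul_mem _ _ me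
    · simp [LieSuper.op_self_even h0]
    · rw [hf]
      exact Submodule.smul_mem _ _ mf
    · rw [fe]
      exact Submodule.neg_mem _ mh
    · rw [fh]
      exact Submodule.smul_mem _ _ mf
    · simp [LieSuper.op_self_even f0]
  · rintro x hx
    rcases hx with rfl | rfl | rfl
    · have := Submodule.apply_mem_map₂ (sop F) mh me
      rw [he] at this
      exact (Submodule.smul_mem_iff _ two_ne_zero).1 this
    · have := Submodule.apply_mem_map₂ (sop F) me mf
      rwa [ef] at this
    · have := Submodule.apply_mem_map₂ (sop F) mh mf
      rw [hf] at this
      exact (Submodule.smul_mem_iff _ (neg_ne_zero.2 two_ne_zero)).1 this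

/-- Even `sl₂`-triples lift along central extensions. -/
theorem IsCentralExtension.exists_sl2_lift [CharZero F] {M : Type*} [AddCommGroup M] [Module F M]
    [Superalgebra F M] {ε : SuperHom F E M} (hε : IsCentralExtension ε) {e f : E}
    (e0 : e ∈ sgr F 0) (f0 : f ∈ sgr F 0)
    (he : sop F (sop F (ε e) (ε f)) (ε e) = (2 : F) • ε e)
    (hf : sop F (sop F (ε e) (ε f)) (ε f) = (-2 : F) • ε f) :
    ∃ e' ∈ sgr F 0, ∃ f' ∈ sgr F 0, ε e' = ε e ∧ ε f' = ε f ∧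
      sop F (sop F e f) e' = (2 : F) • e' ∧ sop F (sop F e f) f' = (-2 : F) • f' ∧
      sop F e' f' = sop F e f := by
  have h0 : sop F e f ∈ sgr F 0 := by
    have := Superalgebra.op_mem (F := F) e0 f0
    rwa [add_zero] at this
  have hmem : ∀ {x : E}, x ∈ sgr F 0 → sop F (sop F e f) x ∈ sgr F 0 := fun hx => by
    have := Superalgebra.op_mem (F := F) h0 hx
    rwa [add_zero] at this
  have e1 : ε ((2⁻¹ : F) • sop F (sop F e f) e) = ε e := by
    rw [map_smul, ε.map_op, ε.map_op, he, smul_smul, inv_mul_cancel₀ two_ne_zero, one_smul]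
  have f1 : ε ((-2⁻¹ : F) • sop F (sop F e f) f) = ε f := by
    rw [map_smul, ε.map_op, ε.map_op, hf, smul_smul, neg_mul_neg, inv_mul_cancel₀ two_ne_zero,
      one_smul]
  -- With h = [e, f] fixed, e and f are replaced by [h, e]/2 and -[h, f]/2. This changes them only
  -- within the kernel, so the bracket of the new pair is still h exactly.
  refine ⟨_, Submodule.smul_mem _ (2⁻¹ : F) (hmem e0), _, Submodule.smul_mem _ (-2⁻¹ : F) (hmem f0),
    e1, f1, ?_, ?_, hε.op_central e1 f1⟩
  · rw [hε.op_central (x := sop F e f) rfl e1, smul_smul, mul_inv_cancel₀ two_ne_zero, one_smul]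
  · rw [hε.op_central (x := sop F e f) rfl f1, smul_smul, neg_mul_neg,
      mul_inv_cancel₀ two_ne_zero, one_smul]

end SL2

section EvenLift

variable {F : Type*} [Field F] [CharZero F]

theorem supertrace_fromBlocks {a b c a' b' c' : F} : supertrace F 2 2
    (Matrix.fromBlocks !![b, a; c, -b] 0 0 !![b', a'; c', -b']) = 0 := by
  simp [supertrace_two]

theorem fromBlocks_even (P Q : Matrix (Fin 2) (Fin 2) F) :
    Matrix.fromBlocks P 0 0 Q ∈ sgr F 0 := by
  rintro (r | r) (s | s) h
  · exact absurd rfl h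
  · rfl
  · rfl
  · exact absurd rfl h

theorem psl_triples (a b c a' b' c' : F) :
    a • pslE₁ F + b • pslH₁ F + c • pslF₁ F + (a' • pslE₂ F + b' • pslH₂ F + c' • pslF₂ F) =
      pslMk (Matrix.fromBlocks !![b, a; c, -b] 0 0 !![b', a'; c', -b']) supertrace_fromBlocks := by
  simp only [pslE₁, pslF₁, pslE₂, pslF₂, pslE, pslH₁, pslH₂, pslMk_smul, pslMk_add]
  refine pslMk_congr _ ?_
  ext (r | r) (s | s) <;> fin_cases r <;> fin_cases s <;> simp [wt₁, wt₂]

theorem psl_triples_op (a b c a' b' c' : F) :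
    sop F (a • pslE₁ F + b • pslH₁ F + c • pslF₁ F)
      (a' • pslE₂ F + b' • pslH₂ F + c' • pslF₂ F) = 0 := by
  have h1 := psl_triples a b c 0 0 0
  have h2 := psl_triples 0 0 0 a' b' c'
  simp only [_root_.zero_smul, add_zero, _root_.zero_add] at h1 h2
  rw [h1, h2, pslMk_op]
  refine (pslMk_congr _ ?_).trans (show pslMk 0 (map_zero _) = 0 from rfl)
  have z : (!![0, 0; 0, -0] : Matrix (Fin 2) (Fin 2) F) = 0 := by
    ext i j
    fin_cases i <;> fin_cases j <;> simp
  rw [superComm_apply (fromBlocks_even _ _) (fromBlocks_even _ _), Matrix.fromBlocks_multiply,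
    Matrix.fromBlocks_multiply, z]
  simp

/-- A scalar matrix whose diagonal blocks are traceless is zero in characteristic zero, so sl₂ ⊕ sl₂
embeds in psl(2,2). -/
theorem psl_triples_eq_zero {a b c a' b' c' : F}
    (h : a • pslE₁ F + b • pslH₁ F + c • pslF₁ F + (a' • pslE₂ F + b' • pslH₂ F + c' • pslF₂ F) = 0) :
    a = 0 ∧ b = 0 ∧ c = 0 ∧ a' = 0 ∧ b' = 0 ∧ c' = 0 := by
  rw [psl_triples, pslMk_eq_zero_iff] at h
  obtain ⟨k, hk⟩ := h
  have g := fun r s => congrFun (congrFun hk r) s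
  have g1 := g (.inl 0) (.inl 1)
  have g2 := g (.inl 0) (.inl 0)
  have g3 := g (.inl 1) (.inl 1)
  have g4 := g (.inl 1) (.inl 0)
  have g5 := g (.inr 0) (.inr 1)
  have g6 := g (.inr 0) (.inr 0)
  have g8 := g (.inr 1) (.inr 0)
  simp at g1 g2 g3 g4 g5 g6 g8
  have hk0 : k = 0 := by
    have : (2 : F) * k = 0 := by linear_combination -g2 - g3
    exact (mul_eq_zero.1 this).resolve_left two_ne_zero
  exact ⟨g1, g2.trans hk0, g4, g5, g6.trans hk0, g8⟩

/-- The two diagonal blocks have equal trace; subtracting half of it as a scalar matrix leaves a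
pair of traceless blocks. -/
theorem exists_psl_triples {x : PSLSuper F 2} (hx : x ∈ sgr F 0) : ∃ a b c a' b' c' : F,
    x = a • pslE₁ F + b • pslH₁ F + c • pslF₁ F +
      (a' • pslE₂ F + b' • pslH₂ F + c' • pslF₂ F) := by
  obtain ⟨Z, hZ, h0, rfl⟩ := mem_psl_grade hx
  refine ⟨Z (.inl 0) (.inl 1), (Z (.inl 0) (.inl 0) - Z (.inl 1) (.inl 1)) / 2,
    Z (.inl 1) (.inl 0), Z (.inr 0) (.inr 1), (Z (.inr 0) (.inr 0) - Z (.inr 1) (.inr 1)) / 2,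
    Z (.inr 1) (.inr 0), ?_⟩
  rw [psl_triples, pslMk_eq_iff]
  refine ⟨(Z (.inl 0) (.inl 0) + Z (.inl 1) (.inl 1)) / 2, ?_⟩
  rw [supertrace_two] at hZ
  have h1 : ∀ i j, Z (.inl i) (.inr j) = 0 := fun i j => h0 _ _ (by simp [parity])
  have h2 : ∀ i j, Z (.inr i) (.inl j) = 0 := fun i j => h0 _ _ (by simp [parity])
  ext (r | r) (s | s) <;> fin_cases r <;> fin_cases s <;> simp [h1, h2]
  · ring
  · ring
  · linear_combination (-(2⁻¹ : F)) * hZ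
  · linear_combination (-(2⁻¹ : F)) * hZ

variable {L : Type*} [AddCommGroup L] [Module F L] [Superalgebra F L] [IsLieSuperalgebra F L]

/-- The even part of `psl(2, 2)` lifts to a cover, and the lift contains the brackets of arbitrary
lifts of the root vectors. -/
theorem exists_evenLift {G : Subsuperalgebra F L} {π : SuperHom F G.carrier (PSLSuper F 2)}
    (hπ : IsCover π) {e₁ f₁ e₂ f₂ : G.carrier} (e₁0 : e₁ ∈ sgr F 0) (f₁0 : f₁ ∈ sgr F 0)
    (e₂0 : e₂ ∈ sgr F 0) (f₂0 : f₂ ∈ sgr F 0) (he₁ : π e₁ = pslE₁ F) (hf₁ : π f₁ = pslF₁ F)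
    (he₂ : π e₂ = pslE₂ F) (hf₂ : π f₂ = pslF₂ F) :
    ∃ B : Submodule F G.carrier, IsEvenLift π B ∧ sop F e₁ f₁ ∈ B ∧ sop F e₂ f₂ ∈ B := by
  have n1 : (1 : F) + 1 = 2 := by norm_num
  have n2 : (-1 : F) - 1 = -2 := by norm_num
  obtain ⟨e₁', e₁'0, f₁', f₁'0, he₁', hf₁', rhe₁, rhf₁, ref₁⟩ :=
    hπ.exists_sl2_lift e₁0 f₁0
      (by rw [he₁, hf₁, pslE₁_op_pslF₁, pslE₁, pslH₁_op_pslE]; simp [wt₁, n1])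
      (by rw [he₁, hf₁, pslE₁_op_pslF₁, pslF₁, pslH₁_op_pslE]; simp [wt₁, n2])
  obtain ⟨e₂', e₂'0, f₂', f₂'0, he₂', hf₂', rhe₂, rhf₂, ref₂⟩ :=
    hπ.exists_sl2_lift e₂0 f₂0
      (by rw [he₂, hf₂, pslE₂_op_pslF₂, pslE₂, pslH₂_op_pslE]; simp [wt₂, n1])
      (by rw [he₂, hf₂, pslE₂_op_pslF₂, pslF₂, pslH₂_op_pslE]; simp [wt₂, n2])
  have hh₁ : π (sop F e₁ f₁) = pslH₁ F := by rw [π.map_op, he₁, hf₁, pslE₁_op_pslF₁]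
  have hh₂ : π (sop F e₂ f₂) = pslH₂ F := by rw [π.map_op, he₂, hf₂, pslE₂_op_pslF₂]
  have h₁0 : sop F e₁ f₁ ∈ sgr F 0 := by
    have := Superalgebra.op_mem (F := F) e₁0 f₁0
    rwa [add_zero] at this
  have h₂0 : sop F e₂ f₂ ∈ sgr F 0 := by
    have := Superalgebra.op_mem (F := F) e₂0 f₂0
    rwa [add_zero] at this
  rw [he₁] at he₁'
  rw [hf₁] at hf₁'
  rw [he₂] at he₂'
  rw [hf₂] at hf₂'
  have hS₁ := sl2_span e₁'0 h₁0 f₁'0 rhe₁ rhf₁ ref₁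
  have hS₂ := sl2_span e₂'0 h₂0 f₂'0 rhe₂ rhf₂ ref₂
  generalize sop F e₁ f₁ = h₁ at *
  generalize sop F e₂ f₂ = h₂ at *
  set S₁ := Submodule.span F {e₁', h₁, f₁'} with dS₁
  set S₂ := Submodule.span F {e₂', h₂, f₂'} with dS₂
  have S₁0 : S₁ ≤ sgr F 0 := Submodule.span_le.2 (by
    rintro x (rfl | rfl | rfl) <;> assumption)
  have S₂0 : S₂ ≤ sgr F 0 := Submodule.span_le.2 (by
    rintro x (rfl | rfl | rfl) <;> assumption)
  have im₁ : ∀ x ∈ S₁, ∃ a b c : F, x = a • e₁' + b • h₁ + c • f₁' := fun x hx => by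
    obtain ⟨a, b, c, h⟩ := Submodule.mem_span_triple.1 hx
    exact ⟨a, b, c, h.symm⟩
  have im₂ : ∀ x ∈ S₂, ∃ a b c : F, x = a • e₂' + b • h₂ + c • f₂' := fun x hx => by
    obtain ⟨a, b, c, h⟩ := Submodule.mem_span_triple.1 hx
    exact ⟨a, b, c, h.symm⟩
  have mem₁ : ∀ a b c : F, a • e₁' + b • h₁ + c • f₁' ∈ S₁ := fun a b c =>
    Submodule.mem_span_triple.2 ⟨a, b, c, rfl⟩
  have mem₂ : ∀ a b c : F, a • e₂' + b • h₂ + c • f₂' ∈ S₂ := fun a b c =>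
    Submodule.mem_span_triple.2 ⟨a, b, c, rfl⟩
  have hπ₁ : ∀ a b c : F, π (a • e₁' + b • h₁ + c • f₁') =
      a • pslE₁ F + b • pslH₁ F + c • pslF₁ F := fun a b c => by
    rw [map_add, map_add, map_smul, map_smul, map_smul, he₁', hh₁, hf₁']
  have hπ₂ : ∀ a b c : F, π (a • e₂' + b • h₂ + c • f₂') =
      a • pslE₂ F + b • pslH₂ F + c • pslF₂ F := fun a b c => by
    rw [map_add, map_add, map_smul, map_smul, map_smul, he₂', hh₂, hf₂']
  -- Downstairs the two factors commute, so each [y, w] lies in the central kernel. Writing x ∈ S₁ =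
  -- [S₁, S₁] as a sum of brackets [y, z], the Jacobi identity expresses [[y, z], w] through
  -- brackets with central elements.
  have hcross : ∀ x ∈ S₁, ∀ w ∈ S₂, sop F x w = 0 := by
    intro x hx w hw
    have hc : ∀ y ∈ S₁, π (sop F y w) = 0 := by
      intro y hy
      obtain ⟨a, b, c, rfl⟩ := im₁ y hy
      obtain ⟨a', b', c', rfl⟩ := im₂ w hw
      rw [π.map_op, hπ₁, hπ₂, psl_triples_op]
    have hz : ∀ y : G.carrier, ∀ z ∈ S₁, sop F y (sop F z w) = 0 := fun y z hz => by
      rw [hπ.op_central (x := y) (y' := 0) rfl ((hc z hz).trans (map_zero _).symm), map_zero]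
    suffices hle : S₁ ≤ LinearMap.ker ((sop F).flip w) from hle hx
    rw [← hS₁]
    refine Submodule.map₂_le.2 fun y hy z hz' => ?_
    have hj := LieSuper.jacobi_even (S₁0 hy) z w
    rw [hz y z hz', hz z y hy, add_zero] at hj
    exact hj.symm
  have hcross' : ∀ w ∈ S₂, ∀ x ∈ S₁, sop F w x = 0 := fun w hw x hx => by
    rw [LieSuper.skew_even (S₂0 hw), hcross x hx w hw, neg_zero]
  have op₁ : ∀ x ∈ S₁, ∀ y ∈ S₁, sop F x y ∈ S₁ := fun x hx y hy => by
    have := Submodule.apply_mem_map₂ (sop F) hx hy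
    rwa [hS₁] at this
  have op₂ : ∀ x ∈ S₂, ∀ y ∈ S₂, sop F x y ∈ S₂ := fun x hx y hy => by
    have := Submodule.apply_mem_map₂ (sop F) hx hy
    rwa [hS₂] at this
  have inj : ∀ x ∈ S₁ ⊔ S₂, π x = 0 → x = 0 := by
    intro x hx h
    obtain ⟨x₁, hx₁, x₂, hx₂, rfl⟩ := Submodule.mem_sup.1 hx
    obtain ⟨a, b, c, rfl⟩ := im₁ x₁ hx₁
    obtain ⟨a', b', c', rfl⟩ := im₂ x₂ hx₂
    rw [map_add, hπ₁, hπ₂] at h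
    obtain ⟨rfl, rfl, rfl, rfl, rfl, rfl⟩ := psl_triples_eq_zero h
    simp
  refine ⟨S₁ ⊔ S₂, ⟨sup_le S₁0 S₂0, ?_, ?_, ?_, ?_⟩, ?_, ?_⟩
  · intro x hx y hy
    obtain ⟨x₁, hx₁, x₂, hx₂, rfl⟩ := Submodule.mem_sup.1 hx
    obtain ⟨y₁, hy₁, y₂, hy₂, rfl⟩ := Submodule.mem_sup.1 hy
    rw [map_add, map_add, LinearMap.add_apply, LinearMap.add_apply, hcross x₁ hx₁ y₂ hy₂,
      hcross' x₂ hx₂ y₁ hy₁, add_zero, _root_.zero_add]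
    exact Submodule.add_mem_sup (op₁ x₁ hx₁ y₁ hy₁) (op₂ x₂ hx₂ y₂ hy₂)
  · exact fun x hx => π.map_grade (sup_le S₁0 S₂0 hx)
  · intro x hx y hy hxy
    refine sub_eq_zero.1 (inj _ (Submodule.sub_mem _ hx hy) ?_)
    rw [map_sub, hxy, sub_self]
  · intro x hx
    obtain ⟨a, b, c, a', b', c', rfl⟩ := exists_psl_triples hx
    exact ⟨_, Submodule.add_mem_sup (mem₁ a b c) (mem₂ a' b' c'), by rw [map_add, hπ₁, hπ₂]⟩
  · exact Submodule.mem_sup_left (Submodule.subset_span (by simp))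
  · exact Submodule.mem_sup_right (Submodule.subset_span (by simp))

end EvenLift
end

noncomputable section
set_option linter.unusedSectionVars false

/-! ### The cover of `psl(2, 2)` in a cover of `TKK(J)` -/

section Images

variable {F : Type*} [Field F]

/-- The image of a subsuperalgebra. -/
def Subsuperalgebra.map {A B : Type*} [AddCommGroup A] [Module F A] [Superalgebra F A]
    [AddCommGroup B] [Module F B] [Superalgebra F B] (f : SuperHom F A B)
    (S : Subsuperalgebra F A) : Subsuperalgebra F B where
  carrier := S.carrier.map f.toLinearMap
  proj_mem i _ hx := IsGradedSub.map (A := S.carrier) (fun _ _ h => f.map_grade h)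
    (fun i _ h => S.proj_mem i h) i hx
  op_mem := by
    rintro _ _ ⟨x, hx, rfl⟩ ⟨y, hy, rfl⟩
    exact ⟨_, S.op_mem hx hy, f.map_op x y⟩

/-- The restriction of a homomorphism to a subsuperalgebra and its image. -/
def Subsuperalgebra.mapHom {A B : Type*} [AddCommGroup A] [Module F A] [Superalgebra F A]
    [AddCommGroup B] [Module F B] [Superalgebra F B] (f : SuperHom F A B)
    (S : Subsuperalgebra F A) : SuperHom F S.carrier (S.map f).carrier where
  toLinearMap := f.toLinearMap.restrict fun _ hx => ⟨_, hx, rfl⟩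
  map_grade {i x} hx := f.map_grade (i := i) (x := x.1) hx
  map_op x y := Subtype.ext (f.map_op x.1 y.1)

theorem Subsuperalgebra.mapHom_surjective {A B : Type*} [AddCommGroup A] [Module F A]
    [Superalgebra F A] [AddCommGroup B] [Module F B] [Superalgebra F B] (f : SuperHom F A B)
    (S : Subsuperalgebra F A) : Function.Surjective (S.mapHom f) := by
  rintro ⟨_, x, hx, rfl⟩
  exact ⟨⟨x, hx⟩, rfl⟩

variable (F) in
/-- The first projection of a product. -/
def SuperHom.fst (A B : Type*) [AddCommGroup A] [Module F A] [Superalgebra F A]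
    [AddCommGroup B] [Module F B] [Superalgebra F B] : SuperHom F (A × B) A where
  toLinearMap := LinearMap.fst F A B
  map_grade hx := hx.1
  map_op _ _ := rfl

/-- The homomorphism to `psl(2, 2)` from a subsuperalgebra of `L × sl(2, 2)`. -/
def pslSnd {L : Type*} [AddCommGroup L] [Module F L] [Superalgebra F L]
    (R : Subsuperalgebra F (L × GLSuper F 2 2))
    (hR : ∀ r ∈ R.carrier, supertrace F 2 2 r.2 = 0) : SuperHom F R.carrier (PSLSuper F 2) where
  toFun r := pslMk r.1.2 (hR r.1 r.2)
  map_add' _ _ := rfl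
  map_smul' _ _ := rfl
  map_grade {i x} hx := pslMk_mem (i := i) (Z := x.1.2) _ hx.2
  map_op _ _ := rfl

end Images

/-! ### Triple products of the off-diagonal blocks and generation of sl(2,2). -/

section BlockTriples

variable {F : Type*} [Field F]

theorem superSymm_comm {m n : ℕ} {i j : ZMod 2} {X Y : Matrix (Fin m ⊕ Fin n) (Fin m ⊕ Fin n) F}
    (hX : X ∈ sgr F i) (hY : Y ∈ sgr F j) :
    superSymm F X Y = koszul F i j • superSymm F Y X := by
  rw [superSymm_apply hX hY, superSymm_apply hY hX]
  rcases zmod2_eq i with rfl | rfl <;> rcases zmod2_eq j with rfl | rfl <;> simp [add_comm]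

theorem superComm_blockEmb_self {a b : Fin 2} (hab : a ≠ b)
    (x y : Matrix (Fin 1 ⊕ Fin 1) (Fin 1 ⊕ Fin 1) F) :
    superComm F (blockEmb a b x) (blockEmb a b y) = 0 := by
  ext r s
  rw [superComm_entry]
  refine Finset.sum_eq_zero fun t _ => ?_
  simp only [blockEmb_apply]
  grind

theorem superComm_blockEmb_apply_eq_zero {a b : Fin 2} (hab : a ≠ b)
    (x y : Matrix (Fin 1 ⊕ Fin 1) (Fin 1 ⊕ Fin 1) F) {r s : Fin 2 ⊕ Fin 2}
    (hrs : blockPos r ≠ blockPos s) :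
    superComm F (blockEmb a b x) (blockEmb b a y) r s = 0 := by
  rw [superComm_entry]
  refine Finset.sum_eq_zero fun t _ => ?_
  simp only [blockEmb_apply]
  grind

/-- `blockEmb_triple` with the two positions exchanged; swapping x and y by supersymmetry turns its
expression into the second component of ψ. -/
theorem blockEmb_triple_neg [CharZero F] {i j : ZMod 2}
    {x y : Matrix (Fin 1 ⊕ Fin 1) (Fin 1 ⊕ Fin 1) F} (hx : x ∈ sgr F i) (hy : y ∈ sgr F j)
    (z : Matrix (Fin 1 ⊕ Fin 1) (Fin 1 ⊕ Fin 1) F) :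
    superComm F (superComm F (blockEmb 0 1 x) (blockEmb 1 0 y)) (blockEmb 1 0 z) =
      (2 : F) • blockEmb 1 0 (-superSymm F (superSymm F x y) z + superSymm F x (superSymm F y z)
        - koszul F i j • superSymm F y (superSymm F x z)) := by
  rw [superComm_skew (blockEmb_mem 0 1 hx) (blockEmb_mem 1 0 hy), map_neg, map_smul,
    LinearMap.neg_apply, LinearMap.smul_apply, blockEmb_triple (by decide) hy hx z,
    superSymm_comm hy hx, koszul_comm j i]
  simp only [map_add, map_sub, map_smul, map_neg, LinearMap.smul_apply]
  rcases zmod2_eq i with rfl | rfl <;> rcases zmod2_eq j with rfl | rfl <;>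
  simp only [koszul_zero_left, koszul_zero_right, koszul_one_one, one_smul, neg_smul] <;> module

theorem blockEmb_add_eq_scalar [CharZero F] {m n : Matrix (Fin 1 ⊕ Fin 1) (Fin 1 ⊕ Fin 1) F}
    {Z : Matrix (Fin 2 ⊕ Fin 2) (Fin 2 ⊕ Fin 2) F} {c : F}
    (hZ : ∀ r s, blockPos r ≠ blockPos s → Z r s = 0)
    (h : blockEmb 0 1 m + Z + (2⁻¹ : F) • blockEmb 1 0 n = c • 1) :
    m = 0 ∧ Z = c • 1 ∧ n = 0 := by
  have hentry : ∀ r s, blockPos r ≠ blockPos s →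
      blockEmb 0 1 m r s + 2⁻¹ * blockEmb 1 0 n r s = 0 := by
    intro r s hrs
    have := congrFun (congrFun h r) s
    rw [Matrix.add_apply, Matrix.add_apply, Matrix.smul_apply, Matrix.smul_apply, hZ r s hrs,
      Matrix.one_apply_ne (fun e => hrs (congrArg _ e)), add_zero, smul_zero, smul_eq_mul] at this
    exact this
  have hm : m = 0 := by
    refine blockEmb_injective 0 1 ?_
    rw [map_zero]
    ext r s
    by_cases hrs : blockPos r = 0 ∧ blockPos s = 1
    · have := hentry r s (by rw [hrs.1, hrs.2]; decide)
      rwa [blockEmb_apply 1 0, if_neg (by rw [hrs.1]; simp), mul_zero, add_zero] at this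
    · rw [blockEmb_apply, if_neg hrs]
      rfl
  have hn : n = 0 := by
    refine blockEmb_injective 1 0 ?_
    rw [map_zero]
    ext r s
    by_cases hrs : blockPos r = 1 ∧ blockPos s = 0
    · have := hentry r s (by rw [hrs.1, hrs.2]; decide)
      rw [blockEmb_apply 0 1, if_neg (by rw [hrs.1]; simp), _root_.zero_add] at this
      exact (mul_eq_zero.1 this).resolve_left (inv_ne_zero two_ne_zero)
    · rw [blockEmb_apply, if_neg hrs]
      rfl
  subst hm hn
  rw [map_zero, map_zero, smul_zero, add_zero, _root_.zero_add] at h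
  exact ⟨rfl, h, rfl⟩

theorem blockEmb_single (r s : Fin 2 ⊕ Fin 2) (c : F) :
    blockEmb (blockPos r) (blockPos s) (Matrix.single (blockIdx r) (blockIdx s) c) =
      Matrix.single r s c := by
  obtain r | r := r <;> obtain s | s := s <;> ext (a | a) (b | b) <;>
    simp [blockEmb_apply, blockPos, blockIdx, Matrix.single_apply, eq_comm]

theorem superSymm_single_self [CharZero F] {m n : ℕ} (r : Fin m ⊕ Fin n) :
    superSymm F (Matrix.single r r (1 : F)) (Matrix.single r r 1) = Matrix.single r r 1 := by
  have h := single_even (F := F) (r := r) (s := r) rfl 1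
  rw [superSymm_apply h h, koszul_zero_left, one_smul,
    Matrix.single_mul_single_same, mul_one]
  module

theorem single_mem_grade {m n : ℕ} (r s : Fin m ⊕ Fin n) (c : F) :
    Matrix.single r s c ∈ sgr F (parity r + parity s) := by
  intro a b hab
  rw [Matrix.single_apply, if_neg]
  rintro ⟨rfl, rfl⟩
  exact hab rfl

theorem superComm_single_single {m n : ℕ} (r t s : Fin m ⊕ Fin n) :
    superComm F (Matrix.single r t (1 : F)) (Matrix.single t s 1) = Matrix.single r s 1 -
      koszul F (parity r + parity t) (parity t + parity s) •
        if s = r then Matrix.single t t 1 else 0 := by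
  rw [superComm_apply (single_mem_grade r t 1) (single_mem_grade t s 1),
    Matrix.single_mul_single_same, mul_one]
  split_ifs with hs
  · subst hs
    rw [Matrix.single_mul_single_same, mul_one]
  · rw [Matrix.single_mul_single_of_ne _ _ _ _ hs]

/-- The three combinations on the right are chosen because brackets [E_{rs}, E_{sr}] produce them:
differences inside a parity block, a sum across the two blocks. -/
theorem sum_smul_of_supertrace_zero {M : Type*} [AddCommGroup M] [Module F M]
    (E : Fin 2 ⊕ Fin 2 → M) {Z : Matrix (Fin 2 ⊕ Fin 2) (Fin 2 ⊕ Fin 2) F}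
    (hZ : supertrace F 2 2 Z = 0) : ∑ r, Z r r • E r =
      (-Z (.inl 1) (.inl 1)) • (E (.inl 0) - E (.inl 1))
        - Z (.inr 0) (.inr 0) • (E (.inr 1) - E (.inr 0))
        + (Z (.inl 0) (.inl 0) + Z (.inl 1) (.inl 1)) • (E (.inl 0) + E (.inr 1)) := by
  rw [supertrace_eq, Fintype.sum_sum_type, Fin.sum_univ_two, Fin.sum_univ_two] at hZ
  simp only [parity, Sum.elim_inl, Sum.elim_inr, koszul_zero_left, koszul_one_one] at hZ
  rw [Fintype.sum_sum_type, Fin.sum_univ_two, Fin.sum_univ_two,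
    show Z (.inr 1) (.inr 1) = Z (.inl 0) (.inl 0) + Z (.inl 1) (.inl 1) - Z (.inr 0) (.inr 0) by
      linear_combination -hZ]
  module

theorem matrix_eq_offDiag_add_diag (Z : Matrix (Fin 2 ⊕ Fin 2) (Fin 2 ⊕ Fin 2) F) :
    Z = ∑ r, ∑ s, (if r = s then 0 else Z r s • Matrix.single r s (1 : F)) +
      ∑ r, Z r r • Matrix.single r r (1 : F) := by
  have h : ∀ r s, Matrix.single r s (Z r s) = (if r = s then 0 else
      Z r s • Matrix.single r s (1 : F)) + if r = s then Z r s • Matrix.single r s (1 : F)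
        else 0 := by
    intro r s
    split_ifs <;> simp
  conv_lhs => rw [Matrix.matrix_eq_sum_single Z]
  simp only [h, Finset.sum_add_distrib, Finset.sum_ite_eq, Finset.mem_univ, if_true]

/-- The off-diagonal blocks generate `sl(2, 2)`. -/
theorem mem_of_blockEmb_mem {W : Submodule F (Matrix (Fin 2 ⊕ Fin 2) (Fin 2 ⊕ Fin 2) F)}
    (h01 : ∀ m, blockEmb 0 1 m ∈ W) (h10 : ∀ m, blockEmb 1 0 m ∈ W)
    (hop : ∀ a ∈ W, ∀ b ∈ W, superComm F a b ∈ W)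
    {Z : Matrix (Fin 2 ⊕ Fin 2) (Fin 2 ⊕ Fin 2) F} (hZ : supertrace F 2 2 Z = 0) : Z ∈ W := by
  have hne : ∀ r s : Fin 2 ⊕ Fin 2, blockPos r ≠ blockPos s → Matrix.single r s (1 : F) ∈ W := by
    intro r s hrs
    rw [← blockEmb_single r s]
    generalize blockPos r = a at hrs ⊢
    generalize blockPos s = b at hrs ⊢
    fin_cases a <;> fin_cases b
    · exact absurd rfl hrs
    · exact h01 _
    · exact h10 _
    · exact absurd rfl hrs
  have hoff : ∀ r s : Fin 2 ⊕ Fin 2, r ≠ s → Matrix.single r s (1 : F) ∈ W := by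
    intro r s hrs
    by_cases h : blockPos r = blockPos s
    -- When r and s occupy the same position, a detour through an index t in the other position
    -- gives E_{rs} = [E_{rt}, E_{ts}], a bracket of off-diagonal blocks.
    · have ht : ∃ t : Fin 2 ⊕ Fin 2, blockPos r ≠ blockPos t :=
        ⟨.inl (blockPos r + 1), by generalize blockPos r = a; fin_cases a <;> decide⟩
      obtain ⟨t, ht⟩ := ht
      have := hop _ (hne r t ht) _ (hne t s (h ▸ ht.symm))
      rwa [superComm_single_single, if_neg hrs.symm, smul_zero, sub_zero] at this
    · exact hne r s h
  have hdiag : ∀ r s : Fin 2 ⊕ Fin 2, r ≠ s → Matrix.single r r (1 : F) -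
      koszul F (parity r + parity s) (parity s + parity r) • Matrix.single s s 1 ∈ W := by
    intro r s hrs
    have := hop _ (hoff r s hrs) _ (hoff s r hrs.symm)
    rwa [superComm_single_single, if_pos rfl] at this
  have d1 := hdiag (.inl 0) (.inl 1) (by decide)
  have d2 := hdiag (.inr 1) (.inr 0) (by decide)
  have d3 := hdiag (.inl 0) (.inr 1) (by decide)
  simp only [parity, Sum.elim_inl, Sum.elim_inr, add_zero, _root_.zero_add, koszul_zero_left,
    show (1 + 1 : ZMod 2) = 0 from rfl, koszul_one_one, one_smul, neg_smul, sub_neg_eq_add]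
    at d1 d2 d3
  have hs : ∑ r, ∑ s, (if r = s then 0 else Z r s • Matrix.single r s (1 : F)) ∈ W := by
    refine W.sum_mem fun r _ => W.sum_mem fun s _ => ?_
    split_ifs with hrs
    · exact W.zero_mem
    · exact W.smul_mem _ (hoff r s hrs)
  rw [matrix_eq_offDiag_add_diag Z,
    sum_smul_of_supertrace_zero (fun r => Matrix.single r r (1 : F)) hZ]
  exact W.add_mem hs (W.add_mem (W.sub_mem (W.smul_mem _ d1) (W.smul_mem _ d2)) (W.smul_mem _ d3))

theorem superComm_blockEmb_one_neg [CharZero F] (k : Matrix (Fin 1 ⊕ Fin 1) (Fin 1 ⊕ Fin 1) F) :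
    superComm F (superComm F (blockEmb 0 1 1) (blockEmb 1 0 1)) (blockEmb 1 0 k) =
      (-2 : F) • blockEmb 1 0 k := by
  rw [blockEmb_triple_neg one_mem_grade one_mem_grade, superSymm_one_left, superSymm_one_left,
    superSymm_one_left, koszul_zero_left, one_smul, add_sub_cancel_right, map_neg, smul_neg,
    neg_smul]

end BlockTriples

/-! ### The graph of the correspondence between the lift of M_{1,1}⁺ and sl(2,2). -/

section Cover

variable {F : Type*} [Field F] {L : Type*} [AddCommGroup L] [Module F L]
  [Superalgebra F L] {J : Type*} [AddCommGroup J] [Module F J] [Superalgebra F J]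

/-- A homomorphism from `M_{1,1}(F)⁺` as a linear map on matrices. -/
def matLin (φ : SuperHom F (MPlus F 1 1) J) :
    Matrix (Fin 1 ⊕ Fin 1) (Fin 1 ⊕ Fin 1) F →ₗ[F] J := φ.toLinearMap

theorem matLin_mem (φ : SuperHom F (MPlus F 1 1) J) {i : ZMod 2}
    {m : Matrix (Fin 1 ⊕ Fin 1) (Fin 1 ⊕ Fin 1) F} (hm : m ∈ sgr F i) : matLin φ m ∈ sgr F i :=
  φ.map_grade (x := m) hm

theorem matLin_op (φ : SuperHom F (MPlus F 1 1) J)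
    (m n : Matrix (Fin 1 ⊕ Fin 1) (Fin 1 ⊕ Fin 1) F) :
    matLin φ (superSymm F m n) = sop F (matLin φ m) (matLin φ n) := φ.map_op m n

theorem matLin_one (φ : SuperHom F (MPlus F 1 1) J) : matLin φ 1 = φ 1 := rfl

variable (F L) in
/-- The second component of a pair as a matrix. -/
def sndMat : L × GLSuper F 2 2 →ₗ[F] Matrix (Fin 2 ⊕ Fin 2) (Fin 2 ⊕ Fin 2) F :=
  LinearMap.snd F L (GLSuper F 2 2)

theorem sndMat_op (r s : L × GLSuper F 2 2) :
    sndMat F L (sop F r s) = superComm F (sndMat F L r) (sndMat F L s) := rfl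

variable [IsJordanSuperalgebra F J] {ρ : SuperHom F L (TKK F J)}

namespace TKKLift

variable (Λ : TKKLift ρ) (φ : SuperHom F (MPlus F 1 1) J)

/-- The pairs of corresponding elements of `J₁` and the upper right blocks. -/
def pairPos : Matrix (Fin 1 ⊕ Fin 1) (Fin 1 ⊕ Fin 1) F →ₗ[F] L × GLSuper F 2 2 :=
  (Λ.x ∘ₗ matLin φ).prod (blockEmb 0 1)

/-- The pairs of corresponding elements of `J₋₁` and the lower left blocks. -/
def pairNeg : Matrix (Fin 1 ⊕ Fin 1) (Fin 1 ⊕ Fin 1) F →ₗ[F] L × GLSuper F 2 2 :=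
  -- The factor 1/2 cancels the 2 in `blockEmb_triple`, so that triple products match those of ψ.
  (Λ.y ∘ₗ matLin φ).prod ((2⁻¹ : F) • blockEmb 1 0)

theorem pairPos_apply (m : Matrix (Fin 1 ⊕ Fin 1) (Fin 1 ⊕ Fin 1) F) :
    Λ.pairPos φ m = (Λ.x (matLin φ m), blockEmb 0 1 m) := rfl

theorem pairNeg_apply (m : Matrix (Fin 1 ⊕ Fin 1) (Fin 1 ⊕ Fin 1) F) :
    Λ.pairNeg φ m = (Λ.y (matLin φ m), (2⁻¹ : F) • blockEmb 1 0 m) := rfl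

theorem sndMat_pairPos (m : Matrix (Fin 1 ⊕ Fin 1) (Fin 1 ⊕ Fin 1) F) :
    sndMat F L (Λ.pairPos φ m) = blockEmb 0 1 m := rfl

theorem sndMat_pairNeg (m : Matrix (Fin 1 ⊕ Fin 1) (Fin 1 ⊕ Fin 1) F) :
    sndMat F L (Λ.pairNeg φ m) = (2⁻¹ : F) • blockEmb 1 0 m := rfl

variable [CharZero F]

/-- On the lift of J₁ the triple product is given by ψ, on the upper right blocks by
`blockEmb_triple`. Both are the same expression in the product of M_{1,1}⁺, so one matrix serves in
both components. -/
theorem pair_triple_pos (m n k : Matrix (Fin 1 ⊕ Fin 1) (Fin 1 ⊕ Fin 1) F) :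
    sop F (sop F (Λ.pairPos φ m) (Λ.pairNeg φ n)) (Λ.pairPos φ k) ∈
      LinearMap.range (Λ.pairPos φ) := by
  refine Superspace.homogeneous_induction (F := F) (p := fun m =>
    sop F (sop F (Λ.pairPos φ m) (Λ.pairNeg φ n)) (Λ.pairPos φ k) ∈
      LinearMap.range (Λ.pairPos φ)) (fun i m hm => ?_) (fun a b ha hb => ?_) m
  · refine Superspace.homogeneous_induction (F := F) (p := fun n =>
      sop F (sop F (Λ.pairPos φ m) (Λ.pairNeg φ n)) (Λ.pairPos φ k) ∈
        LinearMap.range (Λ.pairPos φ)) (fun j n hn => ?_) (fun a b ha hb => ?_) n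
    · refine ⟨superSymm F (superSymm F m n) k + superSymm F m (superSymm F n k)
        - koszul F i j • superSymm F n (superSymm F m k), Prod.ext ?_ ?_⟩
      · change Λ.x _ = sop F (sop F (Λ.x _) (Λ.y _)) (Λ.x _)
        rw [Λ.xyx, (tkkPsi_apply (matLin_mem φ hm) (matLin_mem φ hn) _ 0).1]
        simp only [map_add, map_sub, map_smul, matLin_op]
      · change _ = superComm F (superComm F (blockEmb 0 1 m) ((2⁻¹ : F) • blockEmb 1 0 n))
          (blockEmb 0 1 k)
        rw [map_smul, map_smul, LinearMap.smul_apply, blockEmb_triple (by decide) hm hn k,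
          smul_smul, inv_mul_cancel₀ two_ne_zero, one_smul]
        rfl
    · simp only [map_add, LinearMap.add_apply]
      exact Submodule.add_mem _ ha hb
  · simp only [map_add, LinearMap.add_apply]
    exact Submodule.add_mem _ ha hb

theorem pair_triple_neg (m n k : Matrix (Fin 1 ⊕ Fin 1) (Fin 1 ⊕ Fin 1) F) :
    sop F (sop F (Λ.pairPos φ m) (Λ.pairNeg φ n)) (Λ.pairNeg φ k) ∈
      LinearMap.range (Λ.pairNeg φ) := by
  refine Superspace.homogeneous_induction (F := F) (p := fun m =>
    sop F (sop F (Λ.pairPos φ m) (Λ.pairNeg φ n)) (Λ.pairNeg φ k) ∈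
      LinearMap.range (Λ.pairNeg φ)) (fun i m hm => ?_) (fun a b ha hb => ?_) m
  · refine Superspace.homogeneous_induction (F := F) (p := fun n =>
      sop F (sop F (Λ.pairPos φ m) (Λ.pairNeg φ n)) (Λ.pairNeg φ k) ∈
        LinearMap.range (Λ.pairNeg φ)) (fun j n hn => ?_) (fun a b ha hb => ?_) n
    · refine ⟨-superSymm F (superSymm F m n) k + superSymm F m (superSymm F n k)
        - koszul F i j • superSymm F n (superSymm F m k), Prod.ext ?_ ?_⟩
      · change Λ.y _ = sop F (sop F (Λ.x _) (Λ.y _)) (Λ.y _)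
        rw [Λ.xyy, (tkkPsi_apply (matLin_mem φ hm) (matLin_mem φ hn) 0 _).2]
        simp only [map_add, map_sub, map_smul, map_neg, matLin_op]
      · change _ = superComm F (superComm F (blockEmb 0 1 m) ((2⁻¹ : F) • blockEmb 1 0 n))
          ((2⁻¹ : F) • blockEmb 1 0 k)
        rw [map_smul, map_smul, map_smul, LinearMap.smul_apply, blockEmb_triple_neg hm hn k,
          smul_smul (2⁻¹ : F) 2, inv_mul_cancel₀ two_ne_zero, one_smul]
        rfl
    · simp only [map_add, LinearMap.add_apply]
      exact Submodule.add_mem _ ha hb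
  · simp only [map_add, LinearMap.add_apply]
    exact Submodule.add_mem _ ha hb

variable [IsLieSuperalgebra F L]

theorem pair_isShortPair :
    IsShortPair (LinearMap.range (Λ.pairPos φ)) (LinearMap.range (Λ.pairNeg φ)) where
  graded_left := IsGradedSub.range fun i m hm =>
    ⟨Λ.x_mem i _ (matLin_mem φ hm), blockEmb_mem 0 1 hm⟩
  graded_right := IsGradedSub.range fun i m hm =>
    ⟨Λ.y_mem i _ (matLin_mem φ hm), Submodule.smul_mem (sgr F i) (2⁻¹ : F) (blockEmb_mem 1 0 hm)⟩
  left_left := by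
    rintro _ ⟨m, rfl⟩ _ ⟨n, rfl⟩
    exact Prod.ext (Λ.xx _ _) (superComm_blockEmb_self (by decide) m n)
  right_right := by
    rintro _ ⟨m, rfl⟩ _ ⟨n, rfl⟩
    refine Prod.ext (Λ.yy _ _) ?_
    change superComm F ((2⁻¹ : F) • blockEmb 1 0 m) ((2⁻¹ : F) • blockEmb 1 0 n) = 0
    rw [map_smul, map_smul, LinearMap.smul_apply, superComm_blockEmb_self (by decide) m n,
      smul_zero, smul_zero]
  act_left := by
    rintro _ ⟨m, rfl⟩ _ ⟨n, rfl⟩ _ ⟨k, rfl⟩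
    exact Λ.pair_triple_pos φ m n k
  act_right := by
    rintro _ ⟨m, rfl⟩ _ ⟨n, rfl⟩ _ ⟨k, rfl⟩
    exact Λ.pair_triple_neg φ m n k

/-- The pairs of corresponding elements of the subalgebra generated by the lift of
`M_{1,1}(F)⁺` and of `sl(2, 2)`. -/
def pairs : Subsuperalgebra F (L × GLSuper F 2 2) := (Λ.pair_isShortPair φ).sub

theorem pairs_supertrace (r : L × GLSuper F 2 2) (hr : r ∈ (Λ.pairs φ).carrier) :
    supertrace F 2 2 r.2 = 0 := by
  suffices h : (Λ.pairs φ).carrier ≤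
      LinearMap.ker ((supertrace F 2 2) ∘ₗ LinearMap.snd F L (GLSuper F 2 2)) from h hr
  refine sup_le (sup_le ?_ (Submodule.map₂_le.2 fun a _ b _ => supertrace_superComm _ _)) ?_
  · rintro _ ⟨m, rfl⟩
    exact supertrace_blockEmb (by decide) m
  · rintro _ ⟨m, rfl⟩
    change supertrace F 2 2 ((2⁻¹ : F) • blockEmb 1 0 m) = 0
    rw [map_smul, supertrace_blockEmb (by decide) m, smul_zero]

theorem pair_zero_snd {z : L × GLSuper F 2 2} (hz : z ∈ Submodule.map₂ (sop F)
    (LinearMap.range (Λ.pairPos φ)) (LinearMap.range (Λ.pairNeg φ))) {r s : Fin 2 ⊕ Fin 2}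
    (hrs : blockPos r ≠ blockPos s) : sndMat F L z r s = 0 := by
  suffices h : Submodule.map₂ (sop F)
      (LinearMap.range (Λ.pairPos φ)) (LinearMap.range (Λ.pairNeg φ)) ≤
      LinearMap.ker ((Matrix.entryLinearMap F F r s) ∘ₗ sndMat F L) from h hz
  refine Submodule.map₂_le.2 ?_
  rintro _ ⟨m, rfl⟩ _ ⟨n, rfl⟩
  change superComm F (blockEmb 0 1 m) ((2⁻¹ : F) • blockEmb 1 0 n) r s = 0
  rw [map_smul, Matrix.smul_apply, superComm_blockEmb_apply_eq_zero (by decide) m n hrs, smul_zero]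

theorem pair_zero_fst {z : L × GLSuper F 2 2} (hz : z ∈ Submodule.map₂ (sop F)
    (LinearMap.range (Λ.pairPos φ)) (LinearMap.range (Λ.pairNeg φ))) :
    ∃ S, ρ z.1 = TKK.inZero S := by
  suffices h : Submodule.map₂ (sop F)
      (LinearMap.range (Λ.pairPos φ)) (LinearMap.range (Λ.pairNeg φ)) ≤
      (LinearMap.range TKK.inZero).comap (ρ.toLinearMap ∘ₗ LinearMap.fst F L (GLSuper F 2 2)) by
    obtain ⟨S, hS⟩ := h hz
    exact ⟨S, hS.symm⟩
  refine Submodule.map₂_le.2 ?_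
  rintro _ ⟨m, rfl⟩ _ ⟨n, rfl⟩
  refine ⟨tkkPsiZero F J (matLin φ m) (matLin φ n), ?_⟩
  change _ = ρ (sop F (Λ.x _) (Λ.y _))
  rw [ρ.map_op, Λ.map_x, Λ.map_y, TKK.op_pos_neg]

variable {φ}

/-- The second component of a pair is determined up to scalars by the first. -/
theorem pairs_fst_eq_zero (hφ : Function.Injective φ) {r : L × GLSuper F 2 2}
    (hr : r ∈ (Λ.pairs φ).carrier) (h : r.1 = 0) : ∃ c : F, sndMat F L r = c • 1 := by
  obtain ⟨_, ⟨m, rfl⟩, z, hz, _, ⟨n, rfl⟩, rfl⟩ := (Λ.pair_isShortPair φ).mem_sub.1 hr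
  obtain ⟨S, hS⟩ := Λ.pair_zero_fst φ hz
  -- The components of the image in J₁ and J₋₁ force m = n = 0, since φ is injective; only z, with
  -- vanishing first component, remains.
  have hs : Λ.x (matLin φ m) + z.1 + Λ.y (matLin φ n) = 0 := h
  have hρ := congrArg ρ hs
  rw [map_add, map_add, Λ.map_x, Λ.map_y, hS, map_zero] at hρ
  have hm0 : matLin φ m = 0 := by
    have := congrArg TKK.pos hρ
    simpa [TKK.inPos_pos, TKK.inZero_pos, TKK.inNeg_pos] using this
  have hn0 : matLin φ n = 0 := by
    have := congrArg TKK.neg hρ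
    simpa [TKK.inPos_neg, TKK.inZero_neg, TKK.inNeg_neg] using this
  have hinj : Function.Injective (matLin φ) := hφ
  rw [hm0, hn0, map_zero, map_zero, _root_.zero_add, add_zero] at hs
  rw [hinj (hm0.trans (map_zero _).symm), hinj (hn0.trans (map_zero _).symm), map_zero, map_zero,
    _root_.zero_add, add_zero]
  -- As z has first component 0, bracketing it with a pair gives a pair with first component 0,
  -- hence the zero pair. So the matrix of z commutes with all upper right blocks.
  refine exists_scalar_of_comm (fun r s hrs => Λ.pair_zero_snd φ hz hrs) fun k => ?_
  obtain ⟨k', hk'⟩ := (Λ.pair_isShortPair φ).zero_left hz ⟨k, rfl⟩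
  have h1 : Λ.x (matLin φ k') = sop F z.1 (Λ.x (matLin φ k)) := congrArg Prod.fst hk'
  have h2 := congrArg (sndMat F L) hk'
  rw [sndMat_op, sndMat_pairPos, sndMat_pairPos] at h2
  rw [hs, map_zero, LinearMap.zero_apply] at h1
  have hk0 : k' = 0 := hinj (Λ.x_injective (by rw [h1, map_zero, map_zero]))
  rw [← h2, hk0, map_zero]

/-- If the second component of a pair is scalar, the first is central. -/
theorem pairs_central {r r' : L × GLSuper F 2 2}
    (hr : r ∈ (Λ.pairs φ).carrier) (hr' : r' ∈ (Λ.pairs φ).carrier) {c : F}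
    (h : sndMat F L r = c • 1) : sop F r.1 r'.1 = 0 := by
  have hP := Λ.pair_isShortPair φ
  obtain ⟨_, ⟨m, rfl⟩, z, hz, _, ⟨n, rfl⟩, rfl⟩ := hP.mem_sub.1 hr
  rw [map_add, map_add, sndMat_pairPos, sndMat_pairNeg] at h
  -- A scalar matrix has no off-diagonal blocks, so again only z remains.
  obtain ⟨rfl, hz2, rfl⟩ := blockEmb_add_eq_scalar (Z := sndMat F L z)
    (fun r s hrs => Λ.pair_zero_snd φ hz hrs) h
  rw [map_zero, map_zero, _root_.zero_add, add_zero]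
  -- The bracket of z with a pair is a pair with zero matrix, and since the blocks are embedded
  -- injectively its first component vanishes too. The element (z.1, 0) isolates this statement in
  -- L, and annihilating both generating spaces it annihilates everything.
  have ann_pos : ((z.1, 0) : L × GLSuper F 2 2) ∈
      LieSuper.annihilator F (LinearMap.range (Λ.pairPos φ)) := by
    rintro _ ⟨k, rfl⟩
    obtain ⟨k', hk'⟩ := hP.zero_left hz ⟨k, rfl⟩
    have h1 : Λ.x (matLin φ k') = sop F z.1 (Λ.x (matLin φ k)) := congrArg Prod.fst hk'
    have h2 := congrArg (sndMat F L) hk'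
    rw [sndMat_op, sndMat_pairPos, sndMat_pairPos, hz2, superComm_scalar_left] at h2
    rw [blockEmb_injective 0 1 (h2.trans (map_zero _).symm), map_zero, map_zero] at h1
    rw [prod_sop, pairPos_apply, ← h1, map_zero, LinearMap.zero_apply]
    rfl
  have ann_neg : ((z.1, 0) : L × GLSuper F 2 2) ∈
      LieSuper.annihilator F (LinearMap.range (Λ.pairNeg φ)) := by
    rintro _ ⟨k, rfl⟩
    obtain ⟨k', hk'⟩ := hP.zero_right hz ⟨k, rfl⟩
    have h1 : Λ.y (matLin φ k') = sop F z.1 (Λ.y (matLin φ k)) := congrArg Prod.fst hk'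
    have h2 := congrArg (sndMat F L) hk'
    rw [sndMat_op, sndMat_pairNeg, sndMat_pairNeg, hz2, superComm_scalar_left, smul_eq_zero] at h2
    rw [blockEmb_injective 1 0 ((h2.resolve_left (inv_ne_zero two_ne_zero)).trans
      (map_zero _).symm), map_zero, map_zero] at h1
    rw [prod_sop, pairNeg_apply, ← h1, map_zero, LinearMap.zero_apply]
    rfl
  have ann_zero := LieSuper.annihilator_map₂ hP.graded_left hP.graded_right ann_pos ann_neg
  obtain ⟨x, hx, w, hw, y, hy, rfl⟩ := hP.mem_sub.1 hr'
  have : sop F ((z.1, 0) : L × GLSuper F 2 2) (x + w + y) = 0 := by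
    rw [map_add, map_add, ann_pos x hx, ann_zero w hw, ann_neg y hy, add_zero, add_zero]
  exact congrArg Prod.fst this

theorem pair_ext {r s : L × GLSuper F 2 2} (h₁ : r.1 = s.1) (h₂ : sndMat F L r = sndMat F L s) :
    r = s := Prod.ext h₁ h₂

theorem pair_one_pos (hl : ∀ a, sop F (matLin φ 1) a = a) (hr : ∀ a, sop F a (matLin φ 1) = a)
    (k : Matrix (Fin 1 ⊕ Fin 1) (Fin 1 ⊕ Fin 1) F) :
    sop F (sop F (Λ.pairPos φ 1) (Λ.pairNeg φ 1)) (Λ.pairPos φ k) = Λ.pairPos φ k := by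
  refine pair_ext ?_ ?_
  · rw [prod_sop, prod_sop]
    simp only [pairPos_apply, pairNeg_apply]
    rw [Λ.xyx, (tkkPsi_one_right (matLin_mem φ one_mem_grade) hl hr _ _).1, hl]
  · rw [sndMat_op, sndMat_op, sndMat_pairPos, sndMat_pairNeg, sndMat_pairPos, map_smul, map_smul,
      LinearMap.smul_apply, blockEmb_mul_op, superSymm_one_left, smul_smul,
      inv_mul_cancel₀ two_ne_zero, one_smul]

theorem pair_one_neg (hl : ∀ a, sop F (matLin φ 1) a = a) (hr : ∀ a, sop F a (matLin φ 1) = a)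
    (k : Matrix (Fin 1 ⊕ Fin 1) (Fin 1 ⊕ Fin 1) F) :
    sop F (sop F (Λ.pairPos φ 1) (Λ.pairNeg φ 1)) (Λ.pairNeg φ k) = -Λ.pairNeg φ k := by
  refine pair_ext ?_ ?_
  · rw [prod_sop, prod_sop, Prod.fst_neg]
    simp only [pairPos_apply, pairNeg_apply]
    rw [Λ.xyy, (tkkPsi_one_right (matLin_mem φ one_mem_grade) hl hr _ _).2, hl, map_neg]
  · rw [sndMat_op, sndMat_op, map_neg, sndMat_pairPos, sndMat_pairNeg, sndMat_pairNeg, map_smul,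
      map_smul, map_smul, LinearMap.smul_apply, superComm_blockEmb_one_neg]
    module

theorem pairs_perfect (hl : ∀ a, sop F (matLin φ 1) a = a) (hr : ∀ a, sop F a (matLin φ 1) = a) :
    IsPerfectSuper F (Λ.pairs φ).carrier := by
  refine (Λ.pair_isShortPair φ).sub_perfect (h := (2 : F) •
    sop F (Λ.pairPos φ 1) (Λ.pairNeg φ 1)) (Submodule.smul_mem _ _
      (Submodule.apply_mem_map₂ _ ⟨1, rfl⟩ ⟨1, rfl⟩)) ?_ ?_
  · rintro _ ⟨k, rfl⟩
    rw [map_smul, LinearMap.smul_apply, Λ.pair_one_pos hl hr]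
  · rintro _ ⟨k, rfl⟩
    rw [map_smul, LinearMap.smul_apply, Λ.pair_one_neg hl hr, smul_neg, neg_smul]

theorem pairPos_mem (m : Matrix (Fin 1 ⊕ Fin 1) (Fin 1 ⊕ Fin 1) F) :
    Λ.pairPos φ m ∈ (Λ.pairs φ).carrier := (Λ.pair_isShortPair φ).left_le ⟨m, rfl⟩

theorem pairNeg_mem (m : Matrix (Fin 1 ⊕ Fin 1) (Fin 1 ⊕ Fin 1) F) :
    Λ.pairNeg φ m ∈ (Λ.pairs φ).carrier := (Λ.pair_isShortPair φ).right_le ⟨m, rfl⟩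

theorem exists_pair {Z : Matrix (Fin 2 ⊕ Fin 2) (Fin 2 ⊕ Fin 2) F} (hZ : supertrace F 2 2 Z = 0) :
    ∃ r ∈ (Λ.pairs φ).carrier, sndMat F L r = Z := by
  change Z ∈ (Λ.pairs φ).carrier.map (sndMat F L)
  refine mem_of_blockEmb_mem
    (W := (Λ.pairs φ).carrier.map (sndMat F L)) (fun m => ⟨_, Λ.pairPos_mem m, rfl⟩)
    (fun m => ⟨(2 : F) • Λ.pairNeg φ m, Submodule.smul_mem _ _ (Λ.pairNeg_mem m), ?_⟩) ?_ hZ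
  · rw [map_smul, sndMat_pairNeg, smul_smul, mul_inv_cancel₀ two_ne_zero, one_smul]
  · rintro _ ⟨a, ha, rfl⟩ _ ⟨b, hb, rfl⟩
    exact ⟨_, (Λ.pairs φ).op_mem ha hb, sndMat_op a b⟩

/-- A cover of `TKK(J)` contains a cover of `psl(2, 2)` if `J` contains `M_{1,1}(F)⁺`. -/
theorem exists_psl_cover (hφ : Function.Injective φ)
    (hl : ∀ a, sop F (matLin φ 1) a = a) (hr : ∀ a, sop F a (matLin φ 1) = a) :
    ∃ (G : Subsuperalgebra F L) (π : SuperHom F G.carrier (PSLSuper F 2)), IsCover π ∧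
      ∀ r ∈ (Λ.pairs φ).carrier, ∃ (g : G.carrier) (hZ : supertrace F 2 2 (sndMat F L r) = 0),
        g.1 = r.1 ∧ π g = pslMk (sndMat F L r) hZ := by
  have hps := (Λ.pairs φ).mapHom_surjective (SuperHom.fst F L (GLSuper F 2 2))
  -- G is the first projection of the graph. The class of the matrix modulo scalars is a function of
  -- the first component by `pairs_fst_eq_zero`, and `pairs_central` makes the resulting map a
  -- central extension.
  obtain ⟨π, hπ⟩ := SuperHom.exists_factor _ hps (pslSnd (Λ.pairs φ) (Λ.pairs_supertrace φ))
    fun r hr => (pslMk_eq_zero_iff (Z := sndMat F L r.1) (Λ.pairs_supertrace φ r.1 r.2)).2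
      (Λ.pairs_fst_eq_zero hφ r.2 (congrArg Subtype.val hr))
  refine ⟨_, π, ⟨⟨inferInstance, ?_, ?_⟩, (Λ.pairs_perfect hl hr).of_surjective _ hps⟩, ?_⟩
  · intro x
    obtain ⟨Z, hZ, rfl⟩ := pslMk_surjective x
    obtain ⟨r, hr, rfl⟩ := Λ.exists_pair (φ := φ) hZ
    exact ⟨_, hπ ⟨r, hr⟩⟩
  · intro g hg g'
    obtain ⟨r, rfl⟩ := hps g
    obtain ⟨r', rfl⟩ := hps g'
    obtain ⟨c, hc⟩ := (pslMk_eq_zero_iff (Z := sndMat F L r.1)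
      (Λ.pairs_supertrace φ r.1 r.2)).1 ((hπ r).symm.trans hg)
    exact Subtype.ext (Λ.pairs_central r.2 r'.2 hc)
  · intro r hr
    exact ⟨_, Λ.pairs_supertrace φ r hr, rfl, hπ ⟨r, hr⟩⟩

end TKKLift

end Cover
end

noncomputable section
set_option linter.unusedSectionVars false

/-! ### Covers of `TKK(J)` are root graded -/

section TKKGraded

variable {F : Type*} [Field F] [CharZero F] {L : Type*} [AddCommGroup L] [Module F L]
  [Superalgebra F L] [IsLieSuperalgebra F L] {J : Type*} [AddCommGroup J] [Module F J]
  [Superalgebra F J] [IsJordanSuperalgebra F J] {ρ : SuperHom F L (TKK F J)}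

/-- The diagonal units of M_{1,1}⁺ give complementary idempotents u₁, u₂ of J. The lifts x(u_i) and
2y(u_i) of the root vectors bracket to the elements that define the Peirce grading, and
`exists_evenLift` provides an even lift B containing these very elements, so the weights taken with
respect to B are the Peirce weights. -/
theorem TKKLift.isA11Graded (Λ : TKKLift ρ) (hρ : IsCover ρ) {φ : SuperHom F (MPlus F 1 1) J}
    (hφ : Function.Injective φ) (hl : ∀ a, sop F (matLin φ 1) a = a)
    (hr : ∀ a, sop F a (matLin φ 1) = a) : IsA11Graded F L := by
  obtain ⟨G, π, hπ, hG⟩ := Λ.exists_psl_cover hφ hl hr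
  have hpos : ∀ {r s : Fin 2 ⊕ Fin 2} (hrs : r ≠ s), blockPos r = 0 → blockPos s = 1 →
      ∃ g : G.carrier, g.1 = Λ.x (matLin φ (Matrix.single (blockIdx r) (blockIdx s) 1)) ∧
        π g = pslE F r s hrs := by
    intro r s hrs h0 h1
    obtain ⟨g, hZ, hg, hπg⟩ := hG _ (Λ.pairPos_mem (Matrix.single (blockIdx r) (blockIdx s) 1))
    refine ⟨g, hg, hπg.trans (pslMk_congr hZ ?_)⟩
    rw [TKKLift.sndMat_pairPos, ← h0, ← h1, blockEmb_single]
  have hneg : ∀ {r s : Fin 2 ⊕ Fin 2} (hrs : r ≠ s), blockPos r = 1 → blockPos s = 0 →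
      ∃ g : G.carrier,
        g.1 = (2 : F) • Λ.y (matLin φ (Matrix.single (blockIdx r) (blockIdx s) 1)) ∧
        π g = pslE F r s hrs := by
    intro r s hrs h1 h0
    obtain ⟨g, hZ, hg, hπg⟩ := hG _ (Submodule.smul_mem _ (2 : F)
      (Λ.pairNeg_mem (Matrix.single (blockIdx r) (blockIdx s) 1)))
    refine ⟨g, hg, hπg.trans (pslMk_congr hZ ?_)⟩
    rw [map_smul, TKKLift.sndMat_pairNeg, smul_smul, mul_inv_cancel₀ two_ne_zero, one_smul, ← h0,
      ← h1, blockEmb_single]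
  have h0 : ∀ i : Fin 1 ⊕ Fin 1, matLin φ (Matrix.single i i 1) ∈ sgr F 0 := fun i =>
    matLin_mem φ (single_even rfl 1)
  have hidem : ∀ i : Fin 1 ⊕ Fin 1, sop F (matLin φ (Matrix.single i i 1))
      (matLin φ (Matrix.single i i 1)) = matLin φ (Matrix.single i i 1) := fun i => by
    rw [← matLin_op, superSymm_single_self]
  have hx0 := fun i => Λ.x_mem 0 _ (h0 i)
  have hy0 := fun i => Submodule.smul_mem _ (2 : F) (Λ.y_mem 0 _ (h0 i))
  obtain ⟨e₁, he₁, hπe₁⟩ := hpos (r := .inl 0) (s := .inl 1) (by decide) rfl rfl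
  obtain ⟨f₁, hf₁, hπf₁⟩ := hneg (r := .inl 1) (s := .inl 0) (by decide) rfl rfl
  obtain ⟨e₂, he₂, hπe₂⟩ := hpos (r := .inr 0) (s := .inr 1) (by decide) rfl rfl
  obtain ⟨f₂, hf₂, hπf₂⟩ := hneg (r := .inr 1) (s := .inr 0) (by decide) rfl rfl
  have e₁0 : e₁.1 ∈ sgr F 0 := he₁ ▸ hx0 (.inl 0)
  have f₁0 : f₁.1 ∈ sgr F 0 := hf₁ ▸ hy0 (.inl 0)
  have e₂0 : e₂.1 ∈ sgr F 0 := he₂ ▸ hx0 (.inr 0)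
  have f₂0 : f₂.1 ∈ sgr F 0 := hf₂ ▸ hy0 (.inr 0)
  obtain ⟨B, hB, hB₁, hB₂⟩ := exists_evenLift hπ e₁0 f₁0 e₂0 f₂0 hπe₁ hπf₁ hπe₂ hπf₂
  have hh₁ : (sop F e₁ f₁).1 = Λ.h (matLin φ (Matrix.single (.inl 0) (.inl 0) 1)) := by
    change sop F e₁.1 f₁.1 = _
    rw [he₁, hf₁, map_smul]
    rfl
  have hh₂ : (sop F e₂ f₂).1 = Λ.h (matLin φ (Matrix.single (.inr 0) (.inr 0) 1)) := by
    change sop F e₂.1 f₂.1 = _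
    rw [he₂, hf₂, map_smul]
    rfl
  -- E₁₁ + E₂₂ = 1 in M_{1,1}, and φ sends 1 to the unit of J.
  have hsum : ∀ a, sop F (matLin φ (Matrix.single (.inl 0) (.inl 0) 1)) a +
      sop F (matLin φ (Matrix.single (.inr 0) (.inr 0) 1)) a = a := by
    intro a
    have h1 : Matrix.single (.inl 0) (.inl 0) (1 : F) + Matrix.single (.inr 0) (.inr 0) 1 =
        (1 : Matrix (Fin 1 ⊕ Fin 1) (Fin 1 ⊕ Fin 1) F) := by
      ext (r | r) (s | s) <;> rw [Subsingleton.elim r 0, Subsingleton.elim s 0] <;> simp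
    rw [← LinearMap.add_apply, ← map_add, ← map_add, h1, hl]
  refine isA11Graded_of_span hπ hB hB₁ hB₂ ?_ ?_ ?_
  · rw [π.map_op, hπe₁, hπf₁]
    exact pslE₁_op_pslF₁
  · rw [π.map_op, hπe₂, hπf₂]
    exact pslE₂_op_pslF₂
  · rw [hh₁, hh₂]
    exact Λ.rootW_span hρ (h0 _) (h0 _) (hidem _) (hidem _) hsum

end TKKGraded

theorem isA11Graded_of_centrallyIsogenous {F : Type u} [Field F] [CharZero F] {L J : Type v}
    [AddCommGroup L] [Module F L] [Superalgebra F L] [IsLieSuperalgebra F L]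
    [AddCommGroup J] [Module F J] [Superalgebra F J] [IsJordanSuperalgebra F J]
    (hJ : ContainsM11 F J) (h : CentrallyIsogenous F L (TKK F J)) : IsA11Graded F L := by
  obtain ⟨φ, hφ, hunit⟩ := hJ
  have ho : matLin φ 1 ∈ sgr F 0 := matLin_mem φ one_mem_grade
  have hl : ∀ a, sop F (matLin φ 1) a = a := fun a => by
    rw [matLin_one]
    exact (hunit a).1
  have hr : ∀ a, sop F a (matLin φ 1) = a := fun a => by
    rw [matLin_one]
    exact (hunit a).2
  obtain ⟨ρ, hρ⟩ := h.exists_cover fun X hX => TKK.eq_zero_of_central ho hl hr hX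
  obtain ⟨Λ⟩ := exists_tkkLift hρ ho hl hr
  exact Λ.isA11Graded hρ hφ hl hr

end

theorem theorem5p1 {F : Type u} [Field F] [CharZero F] {L : Type v} [AddCommGroup L] [Module F L]
    [Superalgebra F L] [IsLieSuperalgebra F L] :
    IsA11Graded F L ↔
      ∃ (J : Type v) (_ : AddCommGroup J) (_ : Module F J) (_ : Superalgebra F J)
        (_ : IsJordanSuperalgebra F J), ContainsM11 F J ∧ CentrallyIsogenous F L (TKK F J) := by
  refine ⟨exists_tkk_of_isA11Graded, ?_⟩
  rintro ⟨J, _, _, _, _, hJ, h⟩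
  exact isA11Graded_of_centrallyIsogenous hJ h
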